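/- **Structures and encodings.** A signature $\mathbf R=\{R_1,\dots,R_k,<\}$ is a finite set of relation names of positive arity containing the binary name $<$. An ordered $\mathbf R$-structure $\mathfrak A$ has a finite non-empty domain $A$, and $<$ is interpreted by a (strict) linear order on $A$. Its encoding is the binary string $\mathrm{enc}(\mathfrak A)=0^n\,1\,\mathrm{enc}(R_1^{\mathfrak A})\cdots\mathrm{enc}(R_k^{\mathfrak A})$, where $n=|A|$ and $\mathrm{enc}(R_i^{\mathfrak A})$ is the string of length $n^{\mathrm{arity}(R_i)}$ that lists the truth values of $R_i$ on all tuples over $A$ in lexicographic order. **Boolean formulae.** A *positive literal* is $X(\bar x)$ and a *negative literal* is $\exists\bar v\,\neg X(\bar w)$, where $X$ is a second-order variable, $\bar x,\bar v,\bar w$ are tuples of first-order variables, and variables of $\bar v$ may occur in $\bar w$. A *Horn clause* over $\mathbf R$ is a formula $\forall\bar x\,(\varphi_1\vee\dots\vee\varphi_m)$ in which every $\varphi_i$ is a positive literal, a negative literal or a first-order formula over $\mathbf R$ (in which no second-order variable occurs), with at most one positive literal. A *Horn formula* is a conjunction of Horn clauses, and $\exists\mathbf{Horn}$ is the set of formulae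 $\exists\bar x\,\psi$ with $\psi$ a Horn formula; $\bar x$ may be empty. **Quantitative formulae.** The formulae of $\Sigma\mathrm{QSO}(\exists\mathbf{Horn})$ over $\mathbf R$ are given by $$\alpha ::= \varphi \mid s \mid (\alpha+\alpha)\mid(\alpha\cdot\alpha)\mid \Sigma x.\,\alpha\mid\Sigma X.\,\alpha,$$ where $\varphi\in\exists\mathbf{Horn}$, $s\in\mathbb N$, $x$ is a first-order variable and $X$ is a second-order variable. Their value $[\![\alpha]\!]\in\mathbb N$ in a structure $\mathfrak A$ under an assignment to the variables is defined by recursion: $\varphi$ has value $1$ if it is satisfied and $0$ otherwise, $s$ has value $s$, the operations $+$ and $\cdot$ are those of $\mathbb N$, $\Sigma x.\,\alpha$ is the sum of the values of $\alpha$ over all values $a\in A$ of $x$, and $\Sigma X.\,\alpha$ is the sum over all values $B\subseteq A^{\mathrm{arity}(X)}$ of $X$. If $\alpha$ is a sentence (it has no free first- or second-order variables), the value does not depend on the assignment and is written $[\![\alpha]\!](\mathfrak A)$. **The class TotP.** A function $f:\{0,1\}^*\to\mathbb N$ belongs to $\mathrm{TotP}$ if there is a polynomial-time nondeterministic Turing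 machine $M$ such that, for every $x\in\{0,1\}^*$, $f(x)$ is the total number of runs of $M$ on input $x$ minus one. **Proposition.** $\Sigma\mathrm{QSO}(\exists\mathbf{Horn})\subseteq\mathrm{TotP}$. That is, for every signature $\mathbf R$ and every sentence $\alpha$ of $\Sigma\mathrm{QSO}(\exists\mathbf{Horn})$ over $\mathbf R$ there is a function $f\in\mathrm{TotP}$ such that $[\![\alpha]\!](\mathfrak A)=f(\mathrm{enc}(\mathfrak A))$ for every ordered $\mathbf R$-structure $\mathfrak A$. -/

import Mathlib

namespace CountLogic

/-! ### Second-order logic over finite ordered structures -/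

/-- The relation names of a finite relational signature with positive arities, apart from `<`.
The signature meant is `{R_0, …, R_{k-1}, <}`: the binary name `<` always belongs to it and is
treated as a separate symbol, since it is always interpreted by the linear order of the domain. -/
structure Signature where
  k : ℕ
  arity : Fin k → ℕ
  arity_pos : ∀ i, 0 < arity i

/-- An interpretation of the relation names other than `<` on the domain `A`. Together with a
`Fintype` and a `LinearOrder` on `A` this is a finite ordered structure. -/
structure Interp (R : Signature) (A : Type*) where
  rel : ∀ i : Fin R.k, Set (Fin (R.arity i) → A)

/-- First-order variables. -/
abbrev FOVar : Type := ℕ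

/-- Second-order variables: infinitely many of each arity. -/
structure SOVar where
  idx : ℕ
  arity : ℕ
  deriving DecidableEq

/-- Formulae of second-order logic over a signature. -/
inductive SO (R : Signature) : Type
  | eq (x y : FOVar) : SO R
  | lt (x y : FOVar) : SO R
  | rel (i : Fin R.k) (u : Fin (R.arity i) → FOVar) : SO R
  | top : SO R
  | app (X : SOVar) (u : Fin X.arity → FOVar) : SO R
  | neg (φ : SO R) : SO R
  | or (φ ψ : SO R) : SO R
  | exFO (x : FOVar) (φ : SO R) : SO R
  | exSO (X : SOVar) (φ : SO R) : SO R

/-- First-order assignments. -/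
abbrev FOAssign (A : Type*) := FOVar → A

/-- Second-order assignments; the domain is finite, so the subsets of `A ^ arity X` are finsets. -/
abbrev SOAssign (A : Type*) := ∀ X : SOVar, Finset (Fin X.arity → A)

namespace SO

variable {R : Signature}

/-- Conjunction, `¬(¬φ ∨ ¬ψ)`. -/
def and (φ ψ : SO R) : SO R := neg (or (neg φ) (neg ψ))

/-- Universal first-order quantification, `¬∃x ¬φ`. -/
def allFO (x : FOVar) (φ : SO R) : SO R := neg (exFO x (neg φ))

/-- The satisfaction relation `(𝔄, v, V) ⊨ φ`. -/
def Sat {A : Type*} [LinearOrder A] (𝔄 : Interp R A) : SO R → FOAssign A → SOAssign A → Prop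
  | eq x y, v, _ => v x = v y
  | lt x y, v, _ => v x < v y
  | rel i u, v, _ => (fun j => v (u j)) ∈ 𝔄.rel i
  | top, _, _ => True
  | app X u, v, V => (fun j => v (u j)) ∈ V X
  | neg φ, v, V => ¬ Sat 𝔄 φ v V
  | or φ ψ, v, V => Sat 𝔄 φ v V ∨ Sat 𝔄 ψ v V
  | exFO x φ, v, V => ∃ a : A, Sat 𝔄 φ (Function.update v x a) V
  | exSO X φ, v, V => ∃ B : Finset (Fin X.arity → A), Sat 𝔄 φ v (Function.update V X B)

/-- Free first-order variables. -/
def freeFO : SO R → Set FOVar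
  | eq x y => {x, y}
  | lt x y => {x, y}
  | rel _ u => Set.range u
  | top => ∅
  | app _ u => Set.range u
  | neg φ => freeFO φ
  | or φ ψ => freeFO φ ∪ freeFO ψ
  | exFO x φ => freeFO φ \ {x}
  | exSO _ φ => freeFO φ

/-- Free second-order variables. -/
def freeSO : SO R → Set SOVar
  | eq _ _ => ∅
  | lt _ _ => ∅
  | rel _ _ => ∅
  | top => ∅
  | app X _ => {X}
  | neg φ => freeSO φ
  | or φ ψ => freeSO φ ∪ freeSO ψ
  | exFO _ φ => freeSO φ
  | exSO X φ => freeSO φ \ {X}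

/-- First-order formulae over the signature: no second-order variable occurs. -/
inductive IsFO : SO R → Prop
  | eq (x y : FOVar) : IsFO (eq x y)
  | lt (x y : FOVar) : IsFO (lt x y)
  | rel (i : Fin R.k) (u : Fin (R.arity i) → FOVar) : IsFO (rel i u)
  | top : IsFO top
  | neg {φ : SO R} : IsFO φ → IsFO (neg φ)
  | or {φ ψ : SO R} : IsFO φ → IsFO ψ → IsFO (or φ ψ)
  | exFO (x : FOVar) {φ : SO R} : IsFO φ → IsFO (exFO x φ)

/-- Negative literals `∃v₁ ⋯ ∃vₘ ¬X(w̄)`, where `m ≥ 0` and the entries of `w̄` may or may not be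
among the `vᵢ`. -/
inductive IsNegLit : SO R → Prop
  | app (X : SOVar) (u : Fin X.arity → FOVar) : IsNegLit (neg (app X u))
  | exFO (x : FOVar) {φ : SO R} : IsNegLit φ → IsNegLit (exFO x φ)

/-- `IsLitDisj p φ`: the formula `φ` is a disjunction `φ₁ ∨ ⋯ ∨ φₙ` with `n ≥ 1`, bracketed in any
way, each `φᵢ` being a positive literal `X(x̄)`, a negative literal or a first-order formula, and
exactly `p` of the `φᵢ` are taken as positive literals. -/
inductive IsLitDisj : ℕ → SO R → Prop
  | pos (X : SOVar) (u : Fin X.arity → FOVar) : IsLitDisj 1 (app X u)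
  | negLit {φ : SO R} : IsNegLit φ → IsLitDisj 0 φ
  | fo {φ : SO R} : IsFO φ → IsLitDisj 0 φ
  | or {p q : ℕ} {φ ψ : SO R} : IsLitDisj p φ → IsLitDisj q ψ → IsLitDisj (p + q) (or φ ψ)

/-- Horn clauses `∀x̄ (φ₁ ∨ ⋯ ∨ φₙ)`, with at most one positive literal. -/
inductive IsHornClause : SO R → Prop
  | body {p : ℕ} {φ : SO R} : p ≤ 1 → IsLitDisj p φ → IsHornClause φ
  | all (x : FOVar) {φ : SO R} : IsHornClause φ → IsHornClause (allFO x φ)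

/-- Horn formulae: conjunctions of Horn clauses. -/
inductive IsHorn : SO R → Prop
  | clause {φ : SO R} : IsHornClause φ → IsHorn φ
  | and {φ ψ : SO R} : IsHorn φ → IsHorn ψ → IsHorn (and φ ψ)

/-- The fragment `∃Horn`: formulae `∃x̄ ψ` with `ψ` a Horn formula. -/
inductive IsExHorn : SO R → Prop
  | horn {φ : SO R} : IsHorn φ → IsExHorn φ
  | ex (x : FOVar) {φ : SO R} : IsExHorn φ → IsExHorn (exFO x φ)

end SO

/-! ### Quantitative second-order logic -/

/-- Formulae of quantitative second-order logic. -/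
inductive QSO (R : Signature) : Type
  | bool (φ : SO R) : QSO R
  | const (s : ℕ) : QSO R
  | add (α β : QSO R) : QSO R
  | mul (α β : QSO R) : QSO R
  | sumFO (x : FOVar) (α : QSO R) : QSO R
  | prodFO (x : FOVar) (α : QSO R) : QSO R
  | sumSO (X : SOVar) (α : QSO R) : QSO R
  | prodSO (X : SOVar) (α : QSO R) : QSO R

namespace QSO

variable {R : Signature}

open Classical in
/-- The value of a formula in `(𝔄, v, V)`. -/
noncomputable def eval {A : Type*} [Fintype A] [LinearOrder A] (𝔄 : Interp R A) :
    QSO R → FOAssign A → SOAssign A → ℕ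
  | bool φ, v, V => if φ.Sat 𝔄 v V then 1 else 0
  | const s, _, _ => s
  | add α β, v, V => eval 𝔄 α v V + eval 𝔄 β v V
  | mul α β, v, V => eval 𝔄 α v V * eval 𝔄 β v V
  | sumFO x α, v, V => ∑ a : A, eval 𝔄 α (Function.update v x a) V
  | prodFO x α, v, V => ∏ a : A, eval 𝔄 α (Function.update v x a) V
  | sumSO X α, v, V => ∑ B : Finset (Fin X.arity → A), eval 𝔄 α v (Function.update V X B)
  | prodSO X α, v, V => ∏ B : Finset (Fin X.arity → A), eval 𝔄 α v (Function.update V X B)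

/-- Free first-order variables. -/
def freeFO : QSO R → Set FOVar
  | bool φ => φ.freeFO
  | const _ => ∅
  | add α β => freeFO α ∪ freeFO β
  | mul α β => freeFO α ∪ freeFO β
  | sumFO x α => freeFO α \ {x}
  | prodFO x α => freeFO α \ {x}
  | sumSO _ α => freeFO α
  | prodSO _ α => freeFO α

/-- Free second-order variables. -/
def freeSO : QSO R → Set SOVar
  | bool φ => φ.freeSO
  | const _ => ∅
  | add α β => freeSO α ∪ freeSO β
  | mul α β => freeSO α ∪ freeSO β
  | sumFO _ α => freeSO α
  | prodFO _ α => freeSO α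
  | sumSO X α => freeSO α \ {X}
  | prodSO X α => freeSO α \ {X}

/-- Sentences: formulae without free variables. -/
def IsSentence (α : QSO R) : Prop := α.freeFO = ∅ ∧ α.freeSO = ∅

/-- The fragment `ΣQSO(L)`: the quantitative products `Πx` and `ΠX` do not occur, and every Boolean
formula used belongs to `L`. -/
inductive IsSigma (L : SO R → Prop) : QSO R → Prop
  | bool {φ : SO R} : L φ → IsSigma L (bool φ)
  | const (s : ℕ) : IsSigma L (const s)
  | add {α β : QSO R} : IsSigma L α → IsSigma L β → IsSigma L (add α β)
  | mul {α β : QSO R} : IsSigma L α → IsSigma L β → IsSigma L (mul α β)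
  | sumFO (x : FOVar) {α : QSO R} : IsSigma L α → IsSigma L (sumFO x α)
  | sumSO (X : SOVar) {α : QSO R} : IsSigma L α → IsSigma L (sumSO X α)

end QSO

/-! ### Encoding of finite ordered structures -/

/-- All `m`-tuples over the list `l`, in the lexicographic order induced by the order of `l`. -/
def tuples {A : Type*} (l : List A) : (m : ℕ) → List (Fin m → A)
  | 0 => [Fin.elim0]
  | m + 1 => l.flatMap fun a => (tuples l m).map fun t => Fin.cons a t

open Classical in
/-- The encoding `0ⁿ 1 enc(R_0) ⋯ enc(R_{k-1})`, where `n` is the size of the domain and `enc(R_i)` is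
the list of the truth values of `R_i` on all tuples in lexicographic order. -/
noncomputable def enc {R : Signature} {A : Type*} [Fintype A] [LinearOrder A] (𝔄 : Interp R A) :
    List Bool :=
  List.replicate (Fintype.card A) false ++ true ::
    (List.finRange R.k).flatMap fun i =>
      (tuples ((Finset.univ : Finset A).sort (· ≤ ·)) (R.arity i)).map fun t => decide (t ∈ 𝔄.rel i)

/-! ### Nondeterministic Turing machines and the class `TotP` -/

/-- A nondeterministic multitape Turing machine with input alphabet `{0, 1}`; the blank symbol is
`default`. It halts when no transition applies. Accepting states are left out: they play no role
for the number of all runs. -/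
structure NTM where
  State : Type
  Sym : Type
  TapeIdx : Type
  [finite_state : Finite State]
  [finite_sym : Finite Sym]
  [finite_tapeIdx : Finite TapeIdx]
  [inhabited_sym : Inhabited Sym]
  [decidableEq_tapeIdx : DecidableEq TapeIdx]
  start : State
  inputTape : TapeIdx
  inputSym : Bool → Sym
  inputSym_injective : Function.Injective inputSym
  inputSym_ne_blank : ∀ b, inputSym b ≠ default
  /-- The transition relation: in state `q`, reading `s i` on tape `i`, the machine may choose any
  transition `(q', w)` in `trans q s`; it enters `q'` and on each tape `i` writes the symbol
  `(w i).1` and then moves its head as `(w i).2` says (`none`: the head stays). -/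
  trans : State → (TapeIdx → Sym) → Set (State × (TapeIdx → Sym × Option Turing.Dir))

namespace NTM

attribute [instance] NTM.finite_state NTM.finite_sym NTM.finite_tapeIdx NTM.inhabited_sym
  NTM.decidableEq_tapeIdx

/-- Transitions: new state, and the symbol to write and the head move for each tape. -/
abbrev Action (M : NTM) : Type := M.State × (M.TapeIdx → M.Sym × Option Turing.Dir)

/-- Configurations: a state and the contents and head position of each (two-way infinite) tape. -/
structure Cfg (M : NTM) where
  state : M.State
  tape : M.TapeIdx → Turing.Tape M.Sym

variable (M : NTM)

/-- The initial configuration: the input is on the input tape, with the head on its first symbol,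
and the other tapes are blank. -/
def init (x : List Bool) : M.Cfg where
  state := M.start
  tape := Function.update (fun _ => Turing.Tape.mk₁ []) M.inputTape
    (Turing.Tape.mk₁ (x.map M.inputSym))

variable {M}

/-- The transitions that apply in a configuration. -/
def Cfg.enabled (c : M.Cfg) : Set M.Action := M.trans c.state fun i => (c.tape i).head

/-- The configuration that a transition leads to. -/
def Cfg.next (c : M.Cfg) (a : M.Action) : M.Cfg where
  state := a.1
  tape i :=
    let t := (c.tape i).write (a.2 i).1
    match (a.2 i).2 with
    | none => t
    | some d => t.move d

/-- `c.IsPath l`: the machine can choose the transitions in `l`, one after the other, from `c` on. -/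
def Cfg.IsPath : M.Cfg → List M.Action → Prop
  | _, [] => True
  | c, a :: l => a ∈ c.enabled ∧ (c.next a).IsPath l

/-- `c.IsRun l`: the list `l` is a complete run from `c`, one that ends when no transition applies. -/
def Cfg.IsRun : M.Cfg → List M.Action → Prop
  | c, [] => c.enabled = ∅
  | c, a :: l => a ∈ c.enabled ∧ (c.next a).IsRun l

variable (M)

/-- On every input `x`, each sequence of steps that the machine can make has length at most
`p(|x|)`, for some polynomial `p`. In particular the machine always halts. -/
def PolyTime : Prop :=
  ∃ p : Polynomial ℕ, ∀ (x : List Bool) (l : List M.Action),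
    (M.init x).IsPath l → l.length ≤ p.eval x.length

/-- The total number of runs on input `x`. -/
noncomputable def total (x : List Bool) : ℕ := {l | (M.init x).IsRun l}.ncard

end NTM

/-- The class `TotP`: the functions `f` with `f x = total_M(x) - 1` for a polynomial-time
nondeterministic Turing machine `M` (which has at least one run on each input). -/
def TotP : Set (List Bool → ℕ) :=
  {f | ∃ M : NTM, M.PolyTime ∧ ∀ x, M.total x = f x + 1}

end CountLogic

/-! Distributivity turns `α` into a finite sum of terms `Σx̄ ΣX̄ (φ₁ ∧ ⋯ ∧ φₗ)` with `φᵢ` in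
`∃Horn`, once bound variables are renamed apart (`QSO.terms`, `QSO.sum_terms`). With the existential
quantifiers pulled to the front, such a term is a sum over `x̄` of the number of choices of `X̄` for
which some `ȳ` satisfies a list of Horn clauses (`Term.Ok.exists_problem`).

Such solutions are easy to find. Suppose that for some tuples it has been decided whether they
belong to the relations. These decisions are again Horn clauses. For each of the polynomially many
`ȳ` the least model is computed by propagation; clauses without positive literal get the auxiliary
head `bad`. The least model lies inside every other model, so the decisions extend to a solution for
this `ȳ` exactly if `bad` is not derived (`Cmd.detTo_model`, `Problem.Wf.detTo_viable`).

Hence the solutions can be enumerated without dead ends: decide tuple after tuple, and branch only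
if both answers are viable. Every branch ends in exactly one solution, and the number of runs is the
number of solutions, provided that there is one (`Problem.Wf.counts_bit`,
`Problem.Wf.counts_guess`). To add up these numbers, for each value of `x̄` that admits a solution
one branch enumerates and halts while another goes on to the next value. The branch that is left
after all terms is the one extra run that `TotP` subtracts (`Problem.Wf.den_main`,
`QSO.exists_cmd`).

The rest implements this on a Turing machine. Programs over structures (`Cmd`) have a run count
`Cmd.den` in continuation style. They are compiled to structured tape programs (`Prog`), where
elements are head positions and relations are tables (`Prog.tot_compile`). These in turn become
machines whose states are the finitely many stacks of pending programs (`Prog.Tot.counts`). The time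
bound is needed on all strings, so every string with leading zeros is read as some structure, with
missing bits taken as `false` (`Prog.exists_tot`, `Prog.runner_polyTime`). -/

namespace CountLogic

/-! ### A structured programming language for nondeterministic Turing machines -/

/-- Structured programs over tapes indexed by `K` with symbols from `Γ`. -/
inductive Prog (K Γ : Type) : Type
  | nop
  | halt
  | move (k : K) (d : Turing.Dir)
  | write (k : K) (f : Γ → Γ)
  | seq (p q : Prog K Γ)
  | ite (k : K) (c : Γ → Bool) (p q : Prog K Γ)
  | loop (k l : K) (c : Γ → Γ → Bool) (p : Prog K Γ)
  | fork (p q : Prog K Γ)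

/-! ### Tapes as functions on the integers -/

/-- A two-way infinite tape with absolute positions. -/
@[ext] structure ITape (Γ : Type) where
  cont : ℤ → Γ
  pos : ℤ

namespace ITape

variable {Γ : Type}

/-- The symbol under the head. -/
def head (t : ITape Γ) : Γ := t.cont t.pos

/-- Move the head. -/
def moved (t : ITape Γ) : Turing.Dir → ITape Γ
  | .left => ⟨t.cont, t.pos - 1⟩
  | .right => ⟨t.cont, t.pos + 1⟩

/-- Write a symbol under the head. -/
def written (t : ITape Γ) (s : Γ) : ITape Γ := ⟨Function.update t.cont t.pos s, t.pos⟩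

/-- The Turing tape `T` has the contents and the head position of `t`. -/
def Models [Inhabited Γ] (T : Turing.Tape Γ) (t : ITape Γ) : Prop :=
  ∀ i : ℤ, T.nth i = t.cont (t.pos + i)

variable [Inhabited Γ] {T : Turing.Tape Γ} {t : ITape Γ}

lemma Models.head_eq (h : Models T t) : T.head = t.head := by
  have := h 0
  simpa [Turing.Tape.nth_zero, ITape.head] using this

lemma Models.write (h : Models T t) (s : Γ) : Models (T.write s) (t.written s) := by
  intro i
  rw [Turing.Tape.write_nth]
  by_cases hi : i = 0
  · simp [hi, written]
  · simp [hi, written, h i]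

lemma Models.move (h : Models T t) (d : Turing.Dir) : Models (T.move d) (t.moved d) := by
  intro i
  cases d
  · rw [Turing.Tape.move_left_nth, h]
    exact congrArg t.cont (by simp only [moved]; ring)
  · rw [Turing.Tape.move_right_nth, h]
    exact congrArg t.cont (by simp only [moved]; ring)

/-- The tape that holds the list `l`, starting at position `0`. -/
def ofList (l : List Γ) : ITape Γ where
  cont i := if 0 ≤ i then l.getD i.toNat default else default
  pos := 0

lemma models_ofList (l : List Γ) :
    Models (Turing.Tape.mk₁ l) (ITape.ofList l) := by
  intro i
  have h : ∀ n : ℕ, (Turing.Tape.mk₁ l).nth n = l.getD n default := by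
    intro n
    rw [Turing.Tape.mk₁, Turing.Tape.mk₂, Turing.Tape.mk'_nth_nat, Turing.ListBlank.nth_mk,
      List.getD_default_eq_getI]
  rcases i with n | n
  · simpa [ITape.ofList] using h n
  · have h0 : ¬ (0 : ℤ) ≤ Int.negSucc n := by omega
    simp only [ITape.ofList, zero_add, h0, if_false]
    show Turing.ListBlank.nth (Turing.ListBlank.mk []) n = _
    rw [Turing.ListBlank.nth_mk]
    simp [List.getI]

end ITape

/-! ### Stacks, single steps and run counts of structured programs -/

namespace Prog

variable {K Γ : Type} [DecidableEq K]

/-- Stacks of programs to be executed one after the other. -/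
abbrev Stack (K Γ : Type) := List (Prog K Γ)

/-- What a step does on each tape. -/
abbrev Effect (K Γ : Type) := K → Γ × Option Turing.Dir

/-- The possible steps with a given stack when `h` is read. -/
def succs : Stack K Γ → (K → Γ) → List (Stack K Γ × Effect K Γ)
  | [], _ => []
  | nop :: S, h => [(S, fun k => (h k, none))]
  | halt :: _, _ => []
  | move k d :: S, h => [(S, fun l => (h l, if l = k then some d else none))]
  | write k f :: S, h => [(S, fun l => (if l = k then f (h l) else h l, none))]
  | seq p q :: S, h => [(p :: q :: S, fun k => (h k, none))]
  | ite k c p q :: S, h => [((bif c (h k) then p else q) :: S, fun k => (h k, none))]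
  | loop k l c p :: S, h =>
      [(bif c (h k) (h l) then p :: loop k l c p :: S else S, fun k => (h k, none))]
  -- The `nop` gives the two stacks different lengths. So the two steps are different actions even
  -- if `p = q`, and their runs are counted separately.
  | fork p q :: S, h => [(p :: S, fun k => (h k, none)), (nop :: q :: S, fun k => (h k, none))]

/-- The stacks that occur while the program runs on top of the stack `S`. -/
def reach : Prog K Γ → Stack K Γ → Set (Stack K Γ)
  | seq p q, S => {seq p q :: S} ∪ (reach p (q :: S) ∪ reach q S)
  | ite k c p q, S => {ite k c p q :: S} ∪ (reach p S ∪ reach q S)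
  | loop k l c p, S => {loop k l c p :: S} ∪ reach p (loop k l c p :: S)
  | fork p q, S => {fork p q :: S, nop :: q :: S} ∪ (reach p S ∪ reach q S)
  | p, S => {p :: S}

lemma finite_reach (p : Prog K Γ) (S : Stack K Γ) : (reach p S).Finite := by
  induction p generalizing S with
  | seq p q hp hq => exact (Set.finite_singleton _).union ((hp _).union (hq _))
  | ite k c p q hp hq => exact (Set.finite_singleton _).union ((hp _).union (hq _))
  | loop k l c p hp => exact (Set.finite_singleton _).union (hp _)
  | fork p q hp hq => exact ((Set.finite_singleton _).insert _).union ((hp _).union (hq _))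
  | _ => exact Set.finite_singleton _

lemma mem_reach (p : Prog K Γ) (S : Stack K Γ) : p :: S ∈ reach p S := by
  cases p <;> simp [reach]

/-- The stack `S` below `p` is only uncovered when `p` ends, and a loop puts itself back below its
body instead of letting the stack grow. So finitely many stacks are closed under steps and can serve
as states. -/
lemma reach_closed (p : Prog K Γ) (S U : Stack K Γ) (h : K → Γ) (a : Stack K Γ × Effect K Γ)
    (hU : U ∈ reach p S) (ha : a ∈ succs U h) : a.1 ∈ reach p S ∨ a.1 = S := by
  induction p generalizing S U with
  | seq p q hp hq =>
    simp only [reach, Set.mem_union, Set.mem_singleton_iff] at hU ⊢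
    rcases hU with rfl | hU | hU
    · simp only [succs, List.mem_singleton] at ha
      subst ha
      exact Or.inl (Or.inr (Or.inl (mem_reach _ _)))
    · rcases hp _ _ hU ha with h | h
      · tauto
      · rw [h]; exact Or.inl (Or.inr (Or.inr (mem_reach _ _)))
    · have := hq _ _ hU ha
      tauto
  | ite k c p q hp hq =>
    simp only [reach, Set.mem_union, Set.mem_singleton_iff] at hU ⊢
    rcases hU with rfl | hU | hU
    · simp only [succs, List.mem_singleton] at ha
      subst ha
      cases c (h k)
      · exact Or.inl (Or.inr (Or.inr (mem_reach _ _)))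
      · exact Or.inl (Or.inr (Or.inl (mem_reach _ _)))
    · have := hp _ _ hU ha
      tauto
    · have := hq _ _ hU ha
      tauto
  | loop k l c p hp =>
    simp only [reach, Set.mem_union, Set.mem_singleton_iff] at hU ⊢
    rcases hU with rfl | hU
    · simp only [succs, List.mem_singleton] at ha
      subst ha
      cases c (h k) (h l)
      · exact Or.inr rfl
      · exact Or.inl (Or.inr (mem_reach _ _))
    · have := hp _ _ hU ha
      tauto
  | fork p q hp hq =>
    simp only [reach, Set.mem_union, Set.mem_singleton_iff, Set.mem_insert_iff] at hU ⊢
    rcases hU with (rfl | rfl) | hU | hU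
    · simp only [succs, List.mem_cons, List.not_mem_nil, or_false] at ha
      rcases ha with rfl | rfl
      · exact Or.inl (Or.inr (Or.inl (mem_reach _ _)))
      · exact Or.inl (Or.inl (Or.inr rfl))
    · simp only [succs, List.mem_singleton] at ha
      subst ha
      exact Or.inl (Or.inr (Or.inr (mem_reach _ _)))
    · have := hp _ _ hU ha
      tauto
    · have := hq _ _ hU ha
      tauto
  | _ =>
    simp only [reach, Set.mem_singleton_iff] at hU
    subst hU
    simp only [succs, List.mem_singleton, List.not_mem_nil] at ha
    try (subst ha; exact Or.inr rfl)

/-- The stacks that occur while the program runs. -/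
def states (p : Prog K Γ) : Set (Stack K Γ) := insert [] (reach p [])

lemma states_closed {p : Prog K Γ} {U : Stack K Γ} {h : K → Γ} {a : Stack K Γ × Effect K Γ}
    (hU : U ∈ states p) (ha : a ∈ succs U h) : a.1 ∈ states p := by
  rcases hU with rfl | hU
  · simp [succs] at ha
  · exact (reach_closed p [] U h a hU ha).symm

instance (p : Prog K Γ) : Finite (states p) := ((finite_reach p []).insert []).to_subtype

/-- The tapes that a program uses. -/
def tapes : Prog K Γ → Finset K
  | nop => ∅
  | halt => ∅
  | move k _ => {k}
  | write k _ => {k}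
  | seq p q => tapes p ∪ tapes q
  | ite k _ p q => {k} ∪ (tapes p ∪ tapes q)
  | loop k l _ p => {k, l} ∪ tapes p
  | fork p q => tapes p ∪ tapes q

/-- All programs of the stack only use tapes from `F`. -/
def StackIn (F : Finset K) (S : Stack K Γ) : Prop := ∀ p ∈ S, p.tapes ⊆ F

/-- `Tot S σ c t`: with the stack `S` and the tapes `σ` there are exactly `c` runs, and all of them
have length at most `t`. -/
inductive Tot : Stack K Γ → (K → ITape Γ) → ℕ → ℕ → Prop
  | nil {σ t} : Tot [] σ 1 t
  | halt {S σ t} : Tot (halt :: S) σ 1 t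
  | nop {S σ c t} : Tot S σ c t → Tot (nop :: S) σ c (t + 1)
  | move {S σ c t k d} : Tot S (Function.update σ k ((σ k).moved d)) c t →
      Tot (move k d :: S) σ c (t + 1)
  | write {S σ c t k f} : Tot S (Function.update σ k ((σ k).written (f (σ k).head))) c t →
      Tot (write k f :: S) σ c (t + 1)
  | seq {S σ c t p q} : Tot (p :: q :: S) σ c t → Tot (seq p q :: S) σ c (t + 1)
  | ite {S σ c t k p q} {b : Γ → Bool} : Tot ((bif b (σ k).head then p else q) :: S) σ c t →
      Tot (ite k b p q :: S) σ c (t + 1)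
  | loop {S σ c t k l p} {b : Γ → Γ → Bool} :
      Tot (bif b (σ k).head (σ l).head then p :: loop k l b p :: S else S) σ c t →
      Tot (loop k l b p :: S) σ c (t + 1)
  | fork {S σ c₁ c₂ t p q} : Tot (p :: S) σ c₁ t → Tot (nop :: q :: S) σ c₂ t →
      Tot (fork p q :: S) σ (c₁ + c₂) (t + 1)

lemma Tot.mono {S : Stack K Γ} {σ : K → ITape Γ} {c t t' : ℕ} (h : Tot S σ c t) (ht : t ≤ t') :
    Tot S σ c t' := by
  induction h generalizing t' with
  | nil => exact Tot.nil
  | halt => exact Tot.halt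
  | fork _ _ h₁ h₂ =>
    obtain ⟨u, rfl⟩ : ∃ u, t' = u + 1 := ⟨t' - 1, by omega⟩
    exact Tot.fork (h₁ (by omega)) (h₂ (by omega))
  | _ =>
    rename_i ih
    obtain ⟨u, rfl⟩ : ∃ u, t' = u + 1 := ⟨t' - 1, by omega⟩
    constructor
    exact ih (by omega)

end Prog

/-! ### Counting the runs of a machine -/

namespace NTM

variable {M : NTM}

lemma init_tape_self (x : List Bool) :
    (M.init x).tape M.inputTape = Turing.Tape.mk₁ (x.map M.inputSym) := by
  simp [init]

lemma init_tape_of_ne (x : List Bool) {k : M.TapeIdx} (hk : k ≠ M.inputTape) :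
    (M.init x).tape k = Turing.Tape.mk₁ [] := by
  simp [init, hk]

/-- From `c` on there are exactly `n` runs, and no path is longer than `t`. -/
def Cfg.Counts (c : M.Cfg) (n t : ℕ) : Prop :=
  {l | c.IsRun l}.Finite ∧ {l | c.IsRun l}.ncard = n ∧ ∀ l, c.IsPath l → l.length ≤ t

lemma Cfg.Counts.of_halted {c : M.Cfg} (h : c.enabled = ∅) (t : ℕ) : c.Counts 1 t := by
  have hr : {l | c.IsRun l} = {[]} := by
    ext l
    cases l <;> simp [IsRun, h]
  refine ⟨by simp [hr], by simp [hr], fun l hl => ?_⟩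
  cases l with
  | nil => simp
  | cons a l => simp [IsPath, h] at hl

lemma Cfg.Counts.of_single {c : M.Cfg} {a : M.Action} {n t : ℕ} (h : c.enabled = {a})
    (hn : (c.next a).Counts n t) : c.Counts n (t + 1) := by
  have hr : {l | c.IsRun l} = List.cons a '' {l | (c.next a).IsRun l} := by
    ext l
    cases l with
    | nil => simp [IsRun, h]
    | cons b l =>
      simp only [IsRun, h, Set.mem_singleton_iff, Set.mem_ofPred_eq, Set.mem_image, List.cons.injEq]
      constructor
      · rintro ⟨rfl, hl⟩
        exact ⟨l, hl, rfl, rfl⟩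
      · rintro ⟨l', hl, rfl, rfl⟩
        exact ⟨rfl, hl⟩
  refine ⟨hr ▸ hn.1.image _, ?_, fun l hl => ?_⟩
  · rw [hr, Set.ncard_image_of_injective _ (List.cons_injective), hn.2.1]
  · cases l with
    | nil => simp
    | cons b l =>
      obtain ⟨hb, hl⟩ := hl
      rw [h, Set.mem_singleton_iff] at hb
      subst hb
      simpa using hn.2.2 l hl

/-- The first action tells apart the runs of the two branches, which is why `hab` is needed for the
numbers to add up. -/
lemma Cfg.Counts.of_pair {c : M.Cfg} {a b : M.Action} {m n t : ℕ} (h : c.enabled = {a, b})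
    (hab : a ≠ b) (hm : (c.next a).Counts m t) (hn : (c.next b).Counts n t) :
    c.Counts (m + n) (t + 1) := by
  have hr : {l | c.IsRun l} = List.cons a '' {l | (c.next a).IsRun l} ∪
      List.cons b '' {l | (c.next b).IsRun l} := by
    ext l
    cases l with
    | nil =>
      have : ({a, b} : Set M.Action) ≠ ∅ := (Set.insert_nonempty _ _).ne_empty
      simp [IsRun, h, this]
    | cons d l =>
      simp only [IsRun, h, Set.mem_insert_iff, Set.mem_singleton_iff, Set.mem_ofPred_eq,
        Set.mem_union, Set.mem_image, List.cons.injEq]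
      constructor
      · rintro ⟨rfl | rfl, hl⟩
        · exact Or.inl ⟨l, hl, rfl, rfl⟩
        · exact Or.inr ⟨l, hl, rfl, rfl⟩
      · rintro (⟨l', hl, rfl, rfl⟩ | ⟨l', hl, rfl, rfl⟩)
        · exact ⟨Or.inl rfl, hl⟩
        · exact ⟨Or.inr rfl, hl⟩
  refine ⟨hr ▸ (hm.1.image _).union (hn.1.image _), ?_, fun l hl => ?_⟩
  · rw [hr, Set.ncard_union_eq _ (hm.1.image _) (hn.1.image _),
      Set.ncard_image_of_injective _ List.cons_injective,
      Set.ncard_image_of_injective _ List.cons_injective, hm.2.1, hn.2.1]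
    rw [Set.disjoint_left]
    rintro _ ⟨l, -, rfl⟩ ⟨l', -, h'⟩
    simp only [List.cons.injEq] at h'
    exact hab h'.1.symm
  · cases l with
    | nil => simp
    | cons d l =>
      obtain ⟨hd, hl⟩ := hl
      rw [h] at hd
      rcases hd with rfl | hd
      · simpa using hm.2.2 l hl
      · rw [Set.mem_singleton_iff] at hd
        subst hd
        simpa using hn.2.2 l hl

end NTM

/-! ### The machine of a program -/

namespace Prog

variable {K Γ : Type} [DecidableEq K]

/-- Extend a function on the tapes in `F` to all tapes. -/
def extend [Inhabited Γ] {F : Finset K} (h : F → Γ) (k : K) : Γ :=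
  if hk : k ∈ F then h ⟨k, hk⟩ else default

/-- The machine that runs a program, with the tapes in `F`. -/
def machine [Finite Γ] [Inhabited Γ] (p : Prog K Γ) (F : Finset K) (inp : F) (sym : Bool → Γ)
    (hinj : Function.Injective sym) (hne : ∀ b, sym b ≠ default) : NTM where
  State := states p
  Sym := Γ
  TapeIdx := F
  start := ⟨[p], Or.inr (mem_reach p [])⟩
  inputTape := inp
  inputSym := sym
  inputSym_injective := hinj
  inputSym_ne_blank := hne
  trans S h := {a | ∃ b ∈ succs S.1 (extend h), a.1.1 = b.1 ∧ a.2 = fun k => b.2 k.1}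

section

variable [Finite Γ] [Inhabited Γ] {p : Prog K Γ} {F : Finset K} {inp : F} {sym : Bool → Γ}
  {hinj : Function.Injective sym} {hne : ∀ b, sym b ≠ default}

local notation "𝓜" => machine p F inp sym hinj hne

/-- The configuration with stack `S`, the tapes of which are described by `σ`. -/
def Shows (c : (machine p F inp sym hinj hne).Cfg) (S : Stack K Γ) (σ : K → ITape Γ) : Prop :=
  c.state.1 = S ∧ ∀ k : F, (ITape.Models (c.tape k) (σ k.1) : Prop)

/-- The action given by an element of `succs`. -/
def toAction {S : Stack K Γ} (hS : S ∈ states p) {h : K → Γ} {b : Stack K Γ × Effect K Γ}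
    (hb : b ∈ succs S h) : (machine p F inp sym hinj hne).Action :=
  (⟨b.1, states_closed hS hb⟩, fun k => b.2 k.1)

lemma Shows.mem_enabled_iff {c : (machine p F inp sym hinj hne).Cfg} {S : Stack K Γ}
    {σ : K → ITape Γ} (hc : Shows c S σ) (a : (machine p F inp sym hinj hne).Action) :
    a ∈ c.enabled ↔ ∃ b ∈ succs S (extend fun k : F => (σ k.1).head),
      a.1.1 = b.1 ∧ a.2 = fun k => b.2 k.1 := by
  obtain ⟨rfl, hT⟩ := hc
  have : (fun k : F => (σ k.1).head) = fun k : F => (c.tape k).head :=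
    funext fun k => (hT k).head_eq.symm
  rw [this]
  rfl

lemma extend_apply {h : K → Γ} {k : K} (hk : k ∈ F) : extend (fun k : F => h k.1) k = h k := by
  simp [extend, hk]

lemma Shows.enabled_single {c : (machine p F inp sym hinj hne).Cfg} {S : Stack K Γ}
    {σ : K → ITape Γ} (hc : Shows c S σ) {b : Stack K Γ × Effect K Γ}
    (hb : succs S (extend fun k : F => (σ k.1).head) = [b]) :
    ∃ a : (machine p F inp sym hinj hne).Action, c.enabled = {a} ∧ a.1.1 = b.1 ∧
      a.2 = fun k => b.2 k.1 := by
  have hS : S ∈ states p := hc.1 ▸ c.state.2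
  have hm : b ∈ succs S (extend fun k : F => (σ k.1).head) := by simp [hb]
  refine ⟨toAction hS hm, ?_, rfl, rfl⟩
  ext a
  rw [hc.mem_enabled_iff, hb]
  simp only [List.mem_singleton, exists_eq_left, Set.mem_singleton_iff]
  constructor
  · rintro ⟨h₁, h₂⟩
    exact Prod.ext (Subtype.ext h₁) h₂
  · rintro rfl
    exact ⟨rfl, rfl⟩

lemma Shows.enabled_pair {c : (machine p F inp sym hinj hne).Cfg} {S : Stack K Γ}
    {σ : K → ITape Γ} (hc : Shows c S σ) {b b' : Stack K Γ × Effect K Γ} (hbb : b.1 ≠ b'.1)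
    (hb : succs S (extend fun k : F => (σ k.1).head) = [b, b']) :
    ∃ a a' : (machine p F inp sym hinj hne).Action, c.enabled = {a, a'} ∧ a ≠ a' ∧
      (a.1.1 = b.1 ∧ a.2 = fun k => b.2 k.1) ∧ (a'.1.1 = b'.1 ∧ a'.2 = fun k => b'.2 k.1) := by
  have hS : S ∈ states p := hc.1 ▸ c.state.2
  have hm : b ∈ succs S (extend fun k : F => (σ k.1).head) := by simp [hb]
  have hm' : b' ∈ succs S (extend fun k : F => (σ k.1).head) := by simp [hb]
  refine ⟨toAction hS hm, toAction hS hm', ?_, ?_, ⟨rfl, rfl⟩, rfl, rfl⟩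
  · ext a
    rw [hc.mem_enabled_iff, hb]
    simp only [List.mem_cons, List.not_mem_nil, or_false, Set.mem_insert_iff,
      Set.mem_singleton_iff]
    constructor
    · rintro ⟨_, rfl | rfl, h₁, h₂⟩
      · exact Or.inl (Prod.ext (Subtype.ext h₁) h₂)
      · exact Or.inr (Prod.ext (Subtype.ext h₁) h₂)
    · rintro (rfl | rfl)
      · exact ⟨_, Or.inl rfl, rfl, rfl⟩
      · exact ⟨_, Or.inr rfl, rfl, rfl⟩
  · intro h
    exact hbb (congrArg (fun a => a.1.1) h)

lemma Shows.next {c : (machine p F inp sym hinj hne).Cfg} {S S' : Stack K Γ}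
    {σ σ' : K → ITape Γ} (hc : Shows c S σ) {a : (machine p F inp sym hinj hne).Action}
    (ha : a.1.1 = S') (h : ∀ k : F, σ' k.1 =
      match (a.2 k).2 with
      | none => (σ k.1).written (a.2 k).1
      | some d => ((σ k.1).written (a.2 k).1).moved d) : Shows (c.next a) S' σ' := by
  refine ⟨ha, fun k => ?_⟩
  rw [h k]
  have hk := (hc.2 k).write (a.2 k).1
  show ITape.Models (match (a.2 k).2 with
    | none => (c.tape k).write (a.2 k).1
    | some d => ((c.tape k).write (a.2 k).1).move d) _
  cases (a.2 k).2 with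
  | none => exact hk
  | some d => exact hk.move d

lemma written_head (t : ITape Γ) : t.written t.head = t := by
  simp [ITape.written, ITape.head]

/-- Each rule of `Tot` mirrors one machine step, or a halt. Since `F` contains all tapes that the
stack uses, the machine reads on them the symbols described by `σ`. -/
theorem Tot.counts {S : Stack K Γ} {σ : K → ITape Γ} {n t : ℕ} (h : Tot S σ n t)
    (c : (machine p F inp sym hinj hne).Cfg) (hF : StackIn F S) (hc : Shows c S σ) :
    c.Counts n t := by
  have hext : ∀ {σ : K → ITape Γ} {k : K}, k ∈ F →
      extend (fun k : F => (σ k.1).head) k = (σ k).head := fun {σ k} hk =>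
    extend_apply (h := fun k => (σ k).head) hk
  -- The rules that only rearrange the stack: every tape gets its own symbol written back.
  have stay : ∀ {S S' : Stack K Γ} {σ : K → ITape Γ} {n t : ℕ}
      (c : (machine p F inp sym hinj hne).Cfg), Shows c S σ →
      succs S (extend fun k : F => (σ k.1).head) =
        [(S', fun k => (extend (fun k : F => (σ k.1).head) k, none))] →
      (∀ c : (machine p F inp sym hinj hne).Cfg, Shows c S' σ → c.Counts n t) →
      c.Counts n (t + 1) := by
    intro S S' σ n t c hc hs ih
    obtain ⟨a, he, h₁, h₂⟩ := hc.enabled_single hs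
    refine .of_single he (ih _ (hc.next h₁ fun k => ?_))
    rw [h₂]
    simp [hext k.2, written_head]
  induction h generalizing c with
  | nil =>
    refine .of_halted (Set.eq_empty_of_forall_notMem fun a ha => ?_) _
    rw [hc.mem_enabled_iff] at ha
    simp [succs] at ha
  | halt =>
    refine .of_halted (Set.eq_empty_of_forall_notMem fun a ha => ?_) _
    rw [hc.mem_enabled_iff] at ha
    simp [succs] at ha
  | nop _ ih =>
    exact stay c hc rfl fun c' => ih c' (fun q hq => hF q (List.mem_cons_of_mem _ hq))
  | @move S σ n t k d _ ih =>
    obtain ⟨a, he, h₁, h₂⟩ := hc.enabled_single rfl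
    refine .of_single he (ih _ (fun q hq => hF q (List.mem_cons_of_mem _ hq))
      (hc.next h₁ fun l => ?_))
    rw [h₂]
    by_cases hl : l.1 = k
    · subst hl
      simp [hext l.2, written_head]
    · simp [hl, hext l.2, written_head]
  | @write S σ n t k f _ ih =>
    obtain ⟨a, he, h₁, h₂⟩ := hc.enabled_single rfl
    refine .of_single he (ih _ (fun q hq => hF q (List.mem_cons_of_mem _ hq))
      (hc.next h₁ fun l => ?_))
    rw [h₂]
    by_cases hl : l.1 = k
    · subst hl
      simp [hext l.2]
    · simp [hl, hext l.2, written_head]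
  | @seq S σ n t p q _ ih =>
    refine stay c hc rfl fun c' => ih c' fun r hr => ?_
    have hpq := hF _ List.mem_cons_self
    simp only [tapes, Finset.union_subset_iff] at hpq
    simp only [List.mem_cons] at hr
    rcases hr with rfl | rfl | hr
    · exact hpq.1
    · exact hpq.2
    · exact hF r (List.mem_cons_of_mem _ hr)
  | @ite S σ n t k p q b _ ih =>
    have hpq := hF _ List.mem_cons_self
    simp only [tapes, Finset.union_subset_iff, Finset.singleton_subset_iff] at hpq
    refine stay c hc (S' := (bif b (σ k).head then p else q) :: S) ?_ fun c' => ih c' fun r hr => ?_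
    · simp [succs, hext hpq.1]
    · simp only [List.mem_cons] at hr
      rcases hr with rfl | hr
      · cases b (σ k).head
        · exact hpq.2.2
        · exact hpq.2.1
      · exact hF r (List.mem_cons_of_mem _ hr)
  | @loop S σ n t k l p b _ ih =>
    have hpq := hF _ List.mem_cons_self
    have hp := hpq
    simp only [tapes, Finset.union_subset_iff, Finset.insert_subset_iff,
      Finset.singleton_subset_iff] at hpq
    refine stay c hc (S' := bif b (σ k).head (σ l).head then p :: Prog.loop k l b p :: S else S) ?_
      fun c' => ih c' ?_
    · simp [succs, hext hpq.1.1, hext hpq.1.2]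
    · intro r hr
      cases hb : b (σ k).head (σ l).head
      · rw [hb] at hr
        exact hF r (List.mem_cons_of_mem _ hr)
      · rw [hb] at hr
        simp only [cond_true, List.mem_cons] at hr
        rcases hr with rfl | rfl | hr
        · exact hpq.2
        · exact hp
        · exact hF r (List.mem_cons_of_mem _ hr)
  | @fork S σ n₁ n₂ t p q _ _ ih₁ ih₂ =>
    have hpq := hF _ List.mem_cons_self
    simp only [tapes, Finset.union_subset_iff] at hpq
    obtain ⟨a, a', he, hne, ⟨h₁, h₂⟩, h₁', h₂'⟩ := hc.enabled_pair (b := (p :: S, _))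
      (b' := (Prog.nop :: q :: S, _)) (fun h => by simpa using congrArg List.length h) rfl
    refine .of_pair he hne (ih₁ _ (fun r hr => ?_) (hc.next h₁ fun k => ?_))
      (ih₂ _ (fun r hr => ?_) (hc.next h₁' fun k => ?_))
    · simp only [List.mem_cons] at hr
      rcases hr with rfl | hr
      · exact hpq.1
      · exact hF r (List.mem_cons_of_mem _ hr)
    · rw [h₂]; simp [hext k.2, written_head]
    · simp only [List.mem_cons] at hr
      rcases hr with rfl | rfl | hr
      · simp [tapes]
      · exact hpq.2
      · exact hF r (List.mem_cons_of_mem _ hr)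
    · rw [h₂']; simp [hext k.2, written_head]

/-- Only the tapes in `F` are constrained, so `σ` may be chosen at will on the tapes that the
machine does not have. -/
theorem counts_init {x : List Bool} {σ : K → ITape Γ} {n t : ℕ} (h : Tot [p] σ n t)
    (hp : p.tapes ⊆ F) (hinp : σ inp.1 = ITape.ofList (x.map sym))
    (hσ : ∀ k ∈ F, k ≠ inp.1 → σ k = ITape.ofList []) :
    ((machine p F inp sym hinj hne).init x).Counts n t := by
  refine h.counts _ (fun q hq => by rw [List.mem_singleton.1 hq]; exact hp) ⟨rfl, fun k => ?_⟩
  by_cases hk : k = inp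
  · subst hk
    have : ((machine p F k sym hinj hne).init x).tape k = Turing.Tape.mk₁ (x.map sym) :=
      NTM.init_tape_self x
    rw [this, hinp]
    exact ITape.models_ofList _
  · have : ((machine p F inp sym hinj hne).init x).tape k = Turing.Tape.mk₁ [] :=
      NTM.init_tape_of_ne x hk
    rw [this, hσ k k.2 fun h => hk (Subtype.ext h)]
    exact ITape.models_ofList _

end

end Prog

end CountLogic

namespace CountLogic

/-! ### Deterministic execution -/

namespace Prog

variable {K Γ : Type} [DecidableEq K]

/-- Started on the tapes `σ`, the program `p` ends deterministically on the tapes `σ'` after at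
most `τ` steps. -/
def Exec (p : Prog K Γ) (σ σ' : K → ITape Γ) (τ : ℕ) : Prop :=
  ∀ ⦃S c t⦄, Tot S σ' c t → Tot (p :: S) σ c (t + τ)

namespace Exec

variable {p q : Prog K Γ} {σ σ₁ σ₂ : K → ITape Γ} {a b : ℕ}

lemma mono (h : Exec p σ σ₁ a) (hab : a ≤ b) : Exec p σ σ₁ b :=
  fun _ _ _ H => (h H).mono (by omega)

protected lemma nop : Exec nop σ σ 1 := fun _ _ _ H => .nop H

protected lemma move (k : K) (d : Turing.Dir) :
    Exec (move k d) σ (Function.update σ k ((σ k).moved d)) 1 := fun _ _ _ H => .move H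

protected lemma write (k : K) (f : Γ → Γ) :
    Exec (write k f) σ (Function.update σ k ((σ k).written (f (σ k).head))) 1 :=
  fun _ _ _ H => .write H

protected lemma seq (hp : Exec p σ σ₁ a) (hq : Exec q σ₁ σ₂ b) :
    Exec (seq p q) σ σ₂ (a + b + 1) := fun _ _ _ H =>
  (Tot.seq (hp (hq H))).mono (by omega)

protected lemma ite {k : K} {c : Γ → Bool}
    (h : Exec (bif c (σ k).head then p else q) σ σ₁ a) : Exec (ite k c p q) σ σ₁ (a + 1) :=
  fun _ _ _ H => .ite (h H)

lemma loop_exit {k l : K} {c : Γ → Γ → Bool} (h : c (σ k).head (σ l).head = false) :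
    Exec (loop k l c p) σ σ 1 := fun _ _ _ H => .loop (by rwa [h])

lemma loop_step {k l : K} {c : Γ → Γ → Bool} (h : c (σ k).head (σ l).head = true)
    (hp : Exec p σ σ₁ a) (hl : Exec (loop k l c p) σ₁ σ₂ b) :
    Exec (loop k l c p) σ σ₂ (a + b + 1) := fun S _ t H => by
  refine (Tot.loop (t := t + b + a) ?_).mono (by omega)
  rw [h]
  exact hp (hl H)

/-- A loop that runs `m` times. -/
lemma loop_iterate {k l : K} {c : Γ → Γ → Bool} (st : ℕ → K → ITape Γ) (m : ℕ)
    (hc : ∀ i < m, c (st i k).head (st i l).head = true)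
    (hm : c (st m k).head (st m l).head = false)
    (hp : ∀ i < m, Exec p (st i) (st (i + 1)) a) :
    Exec (loop k l c p) (st 0) (st m) (m * (a + 1) + 1) := by
  -- The induction is on the number `j` of rounds still to come, because `Exec` is composed from the
  -- end backwards.
  suffices h : ∀ j ≤ m, Exec (loop k l c p) (st (m - j)) (st m) (j * (a + 1) + 1) by
    simpa using h m le_rfl
  intro j hj
  induction j with
  | zero => simpa using loop_exit hm
  | succ j ih =>
    have e : m - (j + 1) + 1 = m - j := by omega
    have h := hp (m - (j + 1)) (by omega)
    rw [e] at h
    exact (loop_step (hc _ (by omega)) h (ih (by omega))).mono (by ring_nf; omega)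

end Exec

end Prog

/-! ### The tapes and basic programs -/

/-- Tape symbols: the blank, or a bit together with a mark that tells whether the cell is the first
one of its tape. -/
abbrev Cell := Option (Bool × Bool)

namespace Cell

/-- The symbol is marked as first of its tape. -/
def isMark (s : Cell) : Bool := (s.map Prod.fst).getD false

/-- The bit of the symbol, `false` for the blank. -/
def bit (s : Cell) : Bool := (s.map Prod.snd).getD false

@[simp] lemma isMark_some (a b : Bool) : isMark (some (a, b)) = a := rfl
@[simp] lemma bit_some (a b : Bool) : bit (some (a, b)) = b := rfl
@[simp] lemma isMark_none : isMark none = false := rfl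
@[simp] lemma bit_none : bit none = false := rfl

end Cell

/-- The tapes: the input, a tape for the results of tests, a register for each first-order
variable, counters, a counter for temporary use, and a tape for each second-order variable and
each relation name. -/
inductive TapeId (R : Signature) : Type
  | input
  | flag
  | reg (x : ℕ)
  | aux (j : ℕ)
  | tmp
  | arr (X : SOVar)
  | rel (i : Fin R.k)
  deriving DecidableEq

/-- The contents of the registers: the first cell is marked, and `n` cells are not blank. -/
def ruler (n : ℕ) (z : ℤ) : Cell :=
  if z = 0 then some (true, false) else if 0 < z ∧ z < n then some (false, false) else none

/-- A register with value `a`. -/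
def rulerAt (n a : ℕ) : ITape Cell := ⟨ruler n, a⟩

lemma isMark_ruler (n a : ℕ) : (ruler n a).isMark = decide (a = 0) := by
  unfold ruler
  by_cases h : a = 0
  · simp [h]
  · by_cases h' : 0 < a ∧ a < n
    · simp [h, h']
    · simp [h, h']

lemma isSome_ruler {n : ℕ} (hn : 0 < n) (a : ℕ) : (ruler n a).isSome = decide (a < n) := by
  unfold ruler
  by_cases h : a = 0
  · simp [h, hn]
  · by_cases h' : a < n
    · have : 0 < a := by omega
      simp [h, h', this]
    · simp [h, h']

@[simp] lemma ruler_zero (n : ℕ) : ruler n 0 = some (true, false) := rfl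

@[simp] lemma head_rulerAt (n a : ℕ) : (rulerAt n a).head = ruler n a := rfl

lemma moved_right_rulerAt (n a : ℕ) : (rulerAt n a).moved .right = rulerAt n (a + 1) := by
  simp [rulerAt, ITape.moved]

lemma moved_left_rulerAt (n a : ℕ) : (rulerAt n (a + 1)).moved .left = rulerAt n a := by
  simp [rulerAt, ITape.moved]

/-- The first cell is marked, and no other one. -/
def Marked (g : ℤ → Cell) : Prop := ∀ a : ℕ, (g a).isMark = decide (a = 0)

lemma marked_ruler (n : ℕ) : Marked (ruler n) := isMark_ruler n

namespace Prog

variable {R : Signature}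

/-- Move the head to the marked cell. -/
def rewind (k : TapeId R) : Prog (TapeId R) Cell :=
  loop k k (fun s _ => !s.isMark) (move k .left)

lemma exec_rewind {k : TapeId R} {σ : TapeId R → ITape Cell} {g : ℤ → Cell} (hg : Marked g)
    {a : ℕ} (hk : σ k = ⟨g, a⟩) :
    Exec (rewind k) σ (Function.update σ k ⟨g, 0⟩) (a * 2 + 1) := by
  have h := Exec.loop_iterate (p := move k .left) (k := k) (l := k)
    (c := fun s _ => !s.isMark) (a := 1)
    (fun i => Function.update σ k ⟨g, ((a - i : ℕ) : ℤ)⟩) a ?_ ?_ ?_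
  · unfold rewind
    simpa [← hk, Function.update_eq_self] using h
  · intro i hi
    have : a - i ≠ 0 := by omega
    simp only [Function.update_self, ITape.head, hg (a - i), Bool.not_eq_true', this,
      decide_eq_false_iff_not, not_false_eq_true]
  · simp only [Function.update_self, ITape.head, hg (a - a)]
    simp
  · intro i hi
    convert Exec.move k .left using 1
    have : ((a - i : ℕ) : ℤ) - 1 = ((a - (i + 1) : ℕ) : ℤ) := by omega
    simp [ITape.moved, this]

/-- If the tapes in `A` are registers with value `0`, then `p` turns `σ` into `F σ`. -/
def Does (n : ℕ) (A : Set (TapeId R)) (p : Prog (TapeId R) Cell)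
    (F : (TapeId R → ITape Cell) → TapeId R → ITape Cell) (τ : ℕ) : Prop :=
  ∀ σ, (∀ k ∈ A, σ k = rulerAt n 0) → Exec p σ (F σ) τ

/-- The transformation `F` neither changes nor reads the tape `k`. -/
def Ignores (F : (TapeId R → ITape Cell) → TapeId R → ITape Cell) (k : TapeId R) : Prop :=
  ∀ σ v, F (Function.update σ k v) = Function.update (F σ) k v

lemma Ignores.apply {F : (TapeId R → ITape Cell) → TapeId R → ITape Cell} {k : TapeId R}
    (h : Ignores F k) (σ : TapeId R → ITape Cell) : F σ k = σ k := by
  have := congrFun (h σ (σ k)) k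
  rwa [Function.update_eq_self, Function.update_self] at this

lemma Ignores.iterate {F : (TapeId R → ITape Cell) → TapeId R → ITape Cell} {k : TapeId R}
    (h : Ignores F k) (m : ℕ) : Ignores F^[m] k := by
  induction m with
  | zero => intro σ v; rfl
  | succ m ih =>
    intro σ v
    rw [Function.iterate_succ_apply', Function.iterate_succ_apply', ih, h]

/-- Run `p` once for every value of the register `z`. -/
def loopN (z : TapeId R) (p : Prog (TapeId R) Cell) : Prog (TapeId R) Cell :=
  seq (loop z z (fun s _ => s.isSome) (seq p (move z .right))) (rewind z)

/-- As `F` neither reads nor changes `z`, it commutes with the motion of the head of `z`. After the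
final rewind only the `n`-fold application of `F` is visible. -/
lemma does_loopN {n : ℕ} (hn : 0 < n) {A : Set (TapeId R)} {z : TapeId R}
    {p : Prog (TapeId R) Cell} {F : (TapeId R → ITape Cell) → TapeId R → ITape Cell} {τ : ℕ}
    (hz : z ∉ A) (hF : ∀ k ∈ insert z A, Ignores F k) (hp : Does n A p F τ) :
    Does n (insert z A) (loopN z p) F^[n] (n * (τ + 5) + 3) := by
  intro σ hσ
  have hz' : F^[n] σ z = rulerAt n 0 := by
    rw [((hF z (Set.mem_insert _ _)).iterate n).apply, hσ z (Set.mem_insert _ _)]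
  have h₁ := Exec.loop_iterate (p := seq p (move z .right)) (k := z) (l := z)
    (c := fun s _ => s.isSome) (a := τ + 1 + 1)
    (fun i => Function.update (F^[i] σ) z (rulerAt n i)) n ?_ ?_ ?_
  · have h₂ := exec_rewind (k := z) (σ := Function.update (F^[n] σ) z (rulerAt n n))
      (marked_ruler n) (a := n) (by simp [rulerAt])
    have h := h₁.seq h₂
    have e₀ : Function.update (F^[0] σ) z (rulerAt n 0) = σ := by
      rw [← hσ z (Set.mem_insert _ _)]; exact Function.update_eq_self ..
    have e₁ : Function.update (Function.update (F^[n] σ) z (rulerAt n n)) z ⟨ruler n, 0⟩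
        = F^[n] σ := by
      rw [Function.update_idem]
      have : (⟨ruler n, 0⟩ : ITape Cell) = F^[n] σ z := by rw [hz']; simp [rulerAt]
      rw [this]; exact Function.update_eq_self ..
    rw [e₀, e₁] at h
    exact h.mono (by ring_nf; omega)
  · intro i hi
    simp [isSome_ruler hn, hi]
  · simp [isSome_ruler hn]
  · intro i hi
    have h := hp (Function.update (F^[i] σ) z (rulerAt n i)) fun k hk => by
      have hkz : k ≠ z := fun h => hz (h ▸ hk)
      rw [Function.update_of_ne hkz, ((hF k (Set.mem_insert_of_mem _ hk)).iterate i).apply,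
        hσ k (Set.mem_insert_of_mem _ hk)]
    rw [hF z (Set.mem_insert _ _)] at h
    convert h.seq (Exec.move z .right) using 1
    rw [Function.update_self, moved_right_rulerAt, Function.update_idem,
      Function.iterate_succ_apply']

/-- Run `p` as often as there are `m`-tuples. -/
def loops : ℕ → Prog (TapeId R) Cell → Prog (TapeId R) Cell
  | 0, p => p
  | m + 1, p => loopN (.aux m) (loops m p)

/-- The time for `loops`. -/
def loopsCost (n τ : ℕ) : ℕ → ℕ
  | 0 => τ
  | m + 1 => n * (loopsCost n τ m + 5) + 3

lemma does_loops {n : ℕ} (hn : 0 < n) {p : Prog (TapeId R) Cell}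
    {F : (TapeId R → ITape Cell) → TapeId R → ITape Cell} {τ : ℕ}
    (hF : ∀ j, Ignores F (.aux j)) (hp : Does n ∅ p F τ) (m : ℕ) :
    Does n {k | ∃ j < m, k = .aux j} (loops m p) F^[n ^ m] (loopsCost n τ m) := by
  induction m with
  | zero =>
    intro σ _
    exact hp σ (by simp)
  | succ m ih =>
    have h := does_loopN (z := .aux m) hn (by simp) (fun k hk => ?_) ih
    · have e : insert (TapeId.aux m : TapeId R) {k | ∃ j < m, k = .aux j} =
          {k | ∃ j < m + 1, k = .aux j} := by
        ext k
        simp only [Set.mem_insert_iff, Set.mem_ofPred_eq, Nat.lt_succ_iff_lt_or_eq]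
        constructor
        · rintro (rfl | ⟨j, hj, rfl⟩)
          · exact ⟨m, Or.inr rfl, rfl⟩
          · exact ⟨j, Or.inl hj, rfl⟩
        · rintro ⟨j, hj | rfl, rfl⟩
          · exact Or.inr ⟨j, hj, rfl⟩
          · exact Or.inl rfl
      rw [e] at h
      rw [pow_succ, Function.iterate_mul]
      exact h
    · obtain ⟨j, rfl⟩ : ∃ j, k = .aux j := by
        rcases hk with rfl | ⟨j, -, rfl⟩
        exacts [⟨m, rfl⟩, ⟨j, rfl⟩]
      exact (hF j).iterate _

lemma update_update_update {α β : Type*} [DecidableEq α] {a b : α} (h : a ≠ b) (f : α → β)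
    (x y z : β) : Function.update (Function.update (Function.update f a x) b y) a z =
      Function.update (Function.update f a z) b y := by
  rw [Function.update_comm h, Function.update_idem, Function.update_comm h.symm]

/-- Run `p` as often as the value of the register `u` says. -/
def repeatReg (u : TapeId R) (p : Prog (TapeId R) Cell) : Prog (TapeId R) Cell :=
  seq (loop u u (fun s _ => !s.isMark) (seq (move u .left) (seq (move .tmp .right) p)))
    (loop .tmp .tmp (fun s _ => !s.isMark) (seq (move .tmp .left) (move u .right)))

/-- The value of `u` can only be read by walking its head to the mark, which destroys it. The walk
is therefore recorded on `tmp`, and the second loop undoes it. -/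
lemma exec_repeatReg {n a : ℕ} {A : Set (TapeId R)} {u : TapeId R}
    {p : Prog (TapeId R) Cell} {F : (TapeId R → ITape Cell) → TapeId R → ITape Cell} {τ : ℕ}
    (hu : u ∉ A) (ht : TapeId.tmp ∉ A) (hut : u ≠ .tmp)
    (hF : ∀ k ∈ A, Ignores F k) (hFu : Ignores F u) (hFt : Ignores F .tmp)
    (hp : Does n A p F τ) {σ : TapeId R → ITape Cell} (hσ : ∀ k ∈ A, σ k = rulerAt n 0)
    (hσt : σ .tmp = rulerAt n 0) (hσu : σ u = rulerAt n a) :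
    Exec (repeatReg u p) σ (F^[a] σ) (a * (τ + 9) + 3) := by
  have h₁ := Exec.loop_iterate (p := seq (move u .left) (seq (move .tmp .right) p)) (k := u)
    (l := u) (c := fun s _ => !s.isMark) (a := τ + 4)
    (fun i => Function.update (Function.update (F^[i] σ) u (rulerAt n (a - i))) .tmp
      (rulerAt n i)) a ?_ ?_ ?_
  · have h₂ := Exec.loop_iterate (p := seq (move .tmp .left) (move u .right)) (k := .tmp)
      (l := .tmp) (c := fun s _ => !s.isMark) (a := 3)
      (fun i => Function.update (Function.update (F^[a] σ) u (rulerAt n i)) .tmp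
        (rulerAt n (a - i))) a ?_ ?_ ?_
    · have h := Exec.seq (σ₁ := Function.update (Function.update (F^[a] σ) u (rulerAt n 0)) .tmp
        (rulerAt n a)) (by simpa using h₁) (by simpa using h₂)
      have e₀ : Function.update (Function.update σ u (rulerAt n a)) .tmp (rulerAt n 0) = σ := by
        rw [← hσu, Function.update_eq_self, ← hσt, Function.update_eq_self]
      have e₁ : Function.update (Function.update (F^[a] σ) u (rulerAt n a)) .tmp (rulerAt n 0) =
          F^[a] σ := by
        have e₂ : rulerAt n a = F^[a] σ u := by rw [(hFu.iterate a).apply, hσu]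
        have e₃ : rulerAt n 0 = F^[a] σ .tmp := by rw [(hFt.iterate a).apply, hσt]
        rw [e₂, Function.update_eq_self, e₃, Function.update_eq_self]
      rw [e₀, e₁] at h
      exact h.mono (by ring_nf; omega)
    · intro i hi
      have : a - i ≠ 0 := by omega
      simp [isMark_ruler, this]
    · simp
    · intro i hi
      convert (Exec.move (.tmp : TapeId R) .left).seq (Exec.move u .right) using 1
      have e : a - i = a - (i + 1) + 1 := by omega
      rw [Function.update_self, e, moved_left_rulerAt, Function.update_idem,
        Function.update_of_ne hut, Function.update_self, moved_right_rulerAt,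
        update_update_update hut]
  · intro i hi
    have : a - i ≠ 0 := by omega
    simp [isMark_ruler, Function.update_of_ne hut, this]
  · simp [Function.update_of_ne hut]
  · intro i hi
    have e : a - i = a - (i + 1) + 1 := by omega
    have h := hp (Function.update (Function.update (F^[i] σ) u (rulerAt n (a - (i + 1)))) .tmp
      (rulerAt n (i + 1))) fun k hk => by
      have hku : k ≠ u := fun h => hu (h ▸ hk)
      have hkt : k ≠ .tmp := fun h => ht (h ▸ hk)
      rw [Function.update_of_ne hkt, Function.update_of_ne hku,
        ((hF k hk).iterate i).apply, hσ k hk]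
    rw [hFt, hFu, ← Function.iterate_succ_apply' F] at h
    refine Exec.mono (a := 1 + (1 + τ + 1) + 1) ((Exec.move u .left).seq ((Exec.move .tmp .right).seq
      (σ₂ := Function.update (Function.update (F^[i + 1] σ) u (rulerAt n (a - (i + 1)))) .tmp
        (rulerAt n (i + 1))) (b := τ) ?_)) (by omega)
    convert h using 1
    rw [Function.update_of_ne hut, Function.update_self, Function.update_of_ne hut.symm,
      Function.update_self, e, moved_left_rulerAt, moved_right_rulerAt,
      update_update_update hut, Function.update_idem]

/-- Move the head of `k` by `w` cells. -/
def shift (k : TapeId R) (w : ℕ) (σ : TapeId R → ITape Cell) : TapeId R → ITape Cell :=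
  Function.update σ k ⟨(σ k).cont, (σ k).pos + w⟩

lemma shift_iterate (k : TapeId R) (w m : ℕ) : (shift k w)^[m] = shift k (m * w) := by
  induction m with
  | zero => funext σ; simp [shift]
  | succ m ih =>
    funext σ
    rw [Function.iterate_succ_apply', ih]
    simp [shift]
    congr 2
    ring

lemma ignores_shift {k l : TapeId R} (h : l ≠ k) (w : ℕ) : Ignores (shift k w) l := by
  intro σ v
  unfold shift
  rw [Function.update_of_ne h.symm, Function.update_comm h]

/-- The position of a tuple in the lexicographic order. -/
def addr (n : ℕ) : (m : ℕ) → (Fin m → ℕ) → ℕ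
  | 0, _ => 0
  | m + 1, t => t 0 * n ^ m + addr n m (Fin.tail t)

/-- Move the head of `k` to the position of the tuple of the values of the registers `u`. -/
def seek (k : TapeId R) : (m : ℕ) → (Fin m → ℕ) → Prog (TapeId R) Cell
  | 0, _ => nop
  | m + 1, u => seq (repeatReg (.reg (u 0)) (loops m (move k .right))) (seek k m (Fin.tail u))

/-- The time for `seek`. -/
def seekCost (n : ℕ) : ℕ → ℕ
  | 0 => 1
  | m + 1 => n * (loopsCost n 1 m + 9) + 3 + seekCost n m + 1

/-- The number `addr n m t` has the digits `t` in base `n`. The leading digit is handled by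
repeating `t 0` times the `m` nested loops that move the head by `n ^ m` cells. -/
lemma exec_seek {n : ℕ} (hn : 0 < n) {k : TapeId R} (hk : ∀ x, k ≠ .reg x) (hk' : ∀ j, k ≠ .aux j)
    (hkt : k ≠ .tmp) (m : ℕ) (u t : Fin m → ℕ) (ht : ∀ j, t j ≤ n) {σ : TapeId R → ITape Cell}
    (ha : ∀ j, σ (.aux j) = rulerAt n 0) (htmp : σ .tmp = rulerAt n 0)
    (hu : ∀ j, σ (.reg (u j)) = rulerAt n (t j)) :
    Exec (seek k m u) σ (shift k (addr n m t) σ) (seekCost n m) := by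
  induction m generalizing σ with
  | zero =>
    have : shift k (addr n 0 t) σ = σ := by simp [shift, addr]
    rw [this]
    exact Exec.nop
  | succ m ih =>
    have hmove : Does n ∅ (move k .right) (shift k 1) 1 := fun σ _ => by
      simpa [shift, ITape.moved] using Exec.move (σ := σ) k .right
    have h₁ := does_loops hn (fun j => ignores_shift (hk' j).symm 1) hmove m
    rw [shift_iterate, mul_one] at h₁
    have h₂ := exec_repeatReg (u := .reg (u 0)) (σ := σ) (by simp) (by simp) (by simp)
      (by rintro _ ⟨j, -, rfl⟩; exact ignores_shift (hk' j).symm _)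
      (ignores_shift (hk _).symm _) (ignores_shift hkt.symm _) h₁
      (by rintro _ ⟨j, -, rfl⟩; exact ha j) htmp (hu 0)
    rw [shift_iterate] at h₂
    have h₃ := ih (Fin.tail u) (Fin.tail t) (fun j => ht j.succ)
      (σ := shift k (t 0 * n ^ m) σ)
      (fun j => by rw [(ignores_shift (hk' j).symm _).apply, ha])
      (by rw [(ignores_shift hkt.symm _).apply, htmp])
      (fun j => by rw [(ignores_shift (hk _).symm _).apply]; exact hu j.succ)
    have h := (h₂.seq h₃).mono (b := seekCost n (m + 1)) ?_
    · refine (?_ : shift k (addr n (m + 1) t) σ = _) ▸ h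
      simp [shift, addr]
      congr 2
      ring
    · have := Nat.mul_le_mul_right (loopsCost n 1 m + 9) (ht 0)
      simp only [seekCost]
      omega

/-- Store a test result. -/
def putFlag (b : Bool) : Prog (TapeId R) Cell := write .flag fun _ => some (false, b)

/-- The tapes with the test result changed. -/
def withFlag (b : Bool) (σ : TapeId R → ITape Cell) : TapeId R → ITape Cell :=
  Function.update σ .flag ((σ .flag).written (some (false, b)))

lemma exec_putFlag (b : Bool) (σ : TapeId R → ITape Cell) :
    Exec (putFlag b) σ (withFlag b σ) 1 := Exec.write _ _

lemma withFlag_of_ne (b : Bool) (σ : TapeId R → ITape Cell) {k : TapeId R} (h : k ≠ .flag) :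
    withFlag b σ k = σ k := Function.update_of_ne h ..

/-- Read the bit at the position of the tuple of the values of the registers `u`. -/
def readBit (k : TapeId R) (m : ℕ) (u : Fin m → ℕ) : Prog (TapeId R) Cell :=
  seq (seek k m u) (seq (ite k Cell.bit (putFlag true) (putFlag false)) (rewind k))

/-- Write the bit at the position of the tuple of the values of the registers `u`. -/
def writeBit (k : TapeId R) (m : ℕ) (u : Fin m → ℕ) (b : Bool) : Prog (TapeId R) Cell :=
  seq (seek k m u) (seq (write k fun s => some (s.isMark, b)) (rewind k))

/-- The time for `readBit` and `writeBit`. -/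
def accessCost (n m : ℕ) : ℕ := seekCost n m + (n ^ m * 2 + 5)

lemma addr_lt {n m : ℕ} (t : Fin m → ℕ) (ht : ∀ j, t j < n) : addr n m t < n ^ m := by
  induction m with
  | zero => simp [addr]
  | succ m ih =>
    have h := ih (Fin.tail t) fun j => ht _
    have h0 := ht 0
    rw [addr, pow_succ]
    calc t 0 * n ^ m + addr n m (Fin.tail t) < t 0 * n ^ m + n ^ m := by omega
      _ = (t 0 + 1) * n ^ m := by ring
      _ ≤ n * n ^ m := Nat.mul_le_mul_right _ h0
      _ = n ^ m * n := by ring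

lemma addr_injective {n m : ℕ} (s t : Fin m → ℕ) (hs : ∀ j, s j < n) (ht : ∀ j, t j < n)
    (h : addr n m s = addr n m t) : s = t := by
  induction m with
  | zero => exact Subsingleton.elim _ _
  | succ m ih =>
    have hs' := addr_lt (Fin.tail s) fun j => hs _
    have ht' := addr_lt (Fin.tail t) fun j => ht _
    simp only [addr] at h
    have hpos : 0 < n ^ m := by omega
    have h0 : s 0 = t 0 := by
      have e₁ : (s 0 * n ^ m + addr n m (Fin.tail s)) / n ^ m = s 0 := by
        rw [add_comm, Nat.add_mul_div_right _ _ hpos, Nat.div_eq_of_lt hs', zero_add]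
      have e₂ : (t 0 * n ^ m + addr n m (Fin.tail t)) / n ^ m = t 0 := by
        rw [add_comm, Nat.add_mul_div_right _ _ hpos, Nat.div_eq_of_lt ht', zero_add]
      rw [← e₁, ← e₂, h]
    have htail : Fin.tail s = Fin.tail t :=
      ih _ _ (fun j => hs _) (fun j => ht _) (by rw [h0] at h; omega)
    rw [← Fin.cons_self_tail s, ← Fin.cons_self_tail t, h0, htail]

lemma exec_readBit {n : ℕ} (hn : 0 < n) {k : TapeId R} (hk : ∀ x, k ≠ .reg x)
    (hk' : ∀ j, k ≠ .aux j) (hkt : k ≠ .tmp) (hkf : k ≠ .flag) (m : ℕ) (u t : Fin m → ℕ)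
    (ht : ∀ j, t j < n) {σ : TapeId R → ITape Cell}
    (ha : ∀ j, σ (.aux j) = rulerAt n 0) (htmp : σ .tmp = rulerAt n 0)
    (hu : ∀ j, σ (.reg (u j)) = rulerAt n (t j)) {g : ℤ → Cell} (hg : Marked g)
    (hσ : σ k = ⟨g, 0⟩) :
    Exec (readBit k m u) σ (withFlag (g (addr n m t)).bit σ) (accessCost n m) := by
  have h₁ := exec_seek hn hk hk' hkt m u t (fun j => (ht j).le) ha htmp hu
  set a := addr n m t with ha_def
  have hlt : a < n ^ m := addr_lt t ht
  have hs : shift k a σ k = ⟨g, a⟩ := by simp [shift, hσ]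
  have h₂ : Exec (ite k Cell.bit (putFlag true) (putFlag false)) (shift k a σ)
      (withFlag (g a).bit (shift k a σ)) 2 := by
    refine Exec.ite (a := 1) ?_
    rw [hs]
    show Exec (bif (g a).bit then _ else _) _ _ _
    cases (g a).bit
    · exact exec_putFlag _ _
    · exact exec_putFlag _ _
  have h₃ := exec_rewind (k := k) (σ := withFlag (g a).bit (shift k a σ)) hg (a := a)
    (by rw [withFlag_of_ne _ _ hkf, hs])
  have h := (h₁.seq (h₂.seq h₃)).mono (b := accessCost n m) (by rw [accessCost]; omega)
  convert h using 1
  · rfl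
  · rw [withFlag, withFlag, Function.update_comm hkf.symm, shift, Function.update_of_ne hkf.symm,
      Function.update_idem, ← hσ, Function.update_eq_self]

lemma exec_writeBit {n : ℕ} (hn : 0 < n) {k : TapeId R} (hk : ∀ x, k ≠ .reg x)
    (hk' : ∀ j, k ≠ .aux j) (hkt : k ≠ .tmp) (m : ℕ) (u t : Fin m → ℕ) (b : Bool)
    (ht : ∀ j, t j < n) {σ : TapeId R → ITape Cell}
    (ha : ∀ j, σ (.aux j) = rulerAt n 0) (htmp : σ .tmp = rulerAt n 0)
    (hu : ∀ j, σ (.reg (u j)) = rulerAt n (t j)) {g : ℤ → Cell} (hg : Marked g)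
    (hσ : σ k = ⟨g, 0⟩) :
    ∃ g', Marked g' ∧ (∀ a : ℕ, (g' a).bit = if a = addr n m t then b else (g a).bit) ∧
      Exec (writeBit k m u b) σ (Function.update σ k ⟨g', 0⟩) (accessCost n m) := by
  have h₁ := exec_seek hn hk hk' hkt m u t (fun j => (ht j).le) ha htmp hu
  set a := addr n m t with ha_def
  have hlt : a < n ^ m := addr_lt t ht
  have hs : shift k a σ k = ⟨g, a⟩ := by simp [shift, hσ]
  have h₂ := Exec.write (σ := shift k a σ) k fun s => some (s.isMark, b)
  -- The write keeps the mark of the cell, so the tape can still be rewound.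
  have hg' : Marked (Function.update g a (some ((g a).isMark, b))) := by
    intro z
    by_cases h : z = a
    · simp [h, hg a]
    · have : (z : ℤ) ≠ a := by exact_mod_cast h
      rw [Function.update_of_ne this, hg z]
  refine ⟨Function.update g a (some ((g a).isMark, b)), hg', fun z => ?_, ?_⟩
  · by_cases h : z = a
    · simp [h]
    · have : (z : ℤ) ≠ a := by exact_mod_cast h
      rw [Function.update_of_ne this, if_neg h]
  · rw [hs] at h₂
    have h₃ := exec_rewind (k := k) (σ := Function.update (shift k a σ) k
      (ITape.written ⟨g, a⟩ (some ((g a).isMark, b)))) hg' (a := a) (by simp [ITape.written])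
    have h := (h₁.seq (h₂.seq h₃)).mono (b := accessCost n m) (by rw [accessCost]; omega)
    convert h using 1
    · rfl
    · rw [shift, Function.update_idem, Function.update_idem]

/-- Compare the registers `x` and `y`: the result is `f (x ≤ y) (y ≤ x)`. -/
def compare (x y : ℕ) (f : Bool → Bool → Bool) : Prog (TapeId R) Cell :=
  seq (loop (.reg x) (.reg y) (fun s t => !s.isMark && !t.isMark)
      (seq (move (.reg x) .left) (seq (move (.reg y) .left) (move .tmp .right))))
    (seq (ite (.reg x) Cell.isMark
        (ite (.reg y) Cell.isMark (putFlag (f true true)) (putFlag (f true false)))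
        (ite (.reg y) Cell.isMark (putFlag (f false true)) (putFlag (f false false))))
      (loop .tmp .tmp (fun s _ => !s.isMark)
        (seq (move .tmp .left) (seq (move (.reg x) .right) (move (.reg y) .right)))))

/-- Both heads walk left together until one of them is on its mark, that is for `min a b` steps,
which `tmp` counts. The two marks then tell which of the inequalities hold, and the walk is undone.
The registers have to be different, since a common one would move twice per round. -/
lemma exec_compare {n a b : ℕ} {x y : ℕ} (hxy : x ≠ y) (f : Bool → Bool → Bool) (ha : a ≤ n)
    {σ : TapeId R → ITape Cell} (htmp : σ .tmp = rulerAt n 0)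
    (hx : σ (.reg x) = rulerAt n a) (hy : σ (.reg y) = rulerAt n b) :
    Exec (compare x y f) σ (withFlag (f (decide (a ≤ b)) (decide (b ≤ a))) σ)
      (n * 12 + 7) := by
  have hxy' : (TapeId.reg x : TapeId R) ≠ .reg y := by simpa using hxy
  let st (τ : TapeId R → ITape Cell) (i j l : ℕ) : TapeId R → ITape Cell :=
    Function.update (Function.update (Function.update τ (.reg x) (rulerAt n i)) (.reg y)
      (rulerAt n j)) .tmp (rulerAt n l)
  have stx : ∀ τ i j l, st τ i j l (.reg x) = rulerAt n i := fun τ i j l => by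
    simp [st, Function.update_of_ne hxy']
  have sty : ∀ τ i j l, st τ i j l (.reg y) = rulerAt n j := fun τ i j l => by simp [st]
  have stt : ∀ τ i j l, st τ i j l .tmp = rulerAt n l := fun τ i j l => by simp [st]
  have ux : ∀ τ i j l i', Function.update (st τ i j l) (.reg x) (rulerAt n i') = st τ i' j l := by
    intro τ i j l i'
    simp only [st]
    rw [Function.update_comm (by simp), Function.update_comm hxy'.symm, Function.update_idem]
  have uy : ∀ τ i j l j', Function.update (st τ i j l) (.reg y) (rulerAt n j') = st τ i j' l := by
    intro τ i j l i'
    simp only [st]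
    rw [Function.update_comm (by simp), Function.update_idem]
  have ut : ∀ τ i j l l', Function.update (st τ i j l) .tmp (rulerAt n l') = st τ i j l' := by
    intro τ i j l i'
    simp only [st]
    rw [Function.update_idem]
  set m := min a b with hm
  have h₁ := Exec.loop_iterate
    (p := seq (move (.reg x) .left) (seq (move (.reg y) .left) (move .tmp .right)))
    (k := .reg x) (l := .reg y) (c := fun s t => !s.isMark && !t.isMark) (a := 5)
    (fun i => st σ (a - i) (b - i) i) m ?_ ?_ ?_
  · have h₂ : Exec (ite (.reg x) Cell.isMark
        (ite (.reg y) Cell.isMark (putFlag (f true true)) (putFlag (f true false)))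
        (ite (.reg y) Cell.isMark (putFlag (f false true)) (putFlag (f false false))))
        (st σ (a - m) (b - m) m)
        (withFlag (f (decide (a ≤ b)) (decide (b ≤ a))) (st σ (a - m) (b - m) m)) 3 := by
      have ex : a - m = 0 ↔ a ≤ b := by omega
      have ey : b - m = 0 ↔ b ≤ a := by omega
      refine Exec.ite (a := 2) ?_
      simp only [stx, head_rulerAt, isMark_ruler, ex]
      by_cases hab : a ≤ b
      · simp only [hab, decide_true, cond_true]
        refine Exec.ite (a := 1) ?_
        simp only [sty, head_rulerAt, isMark_ruler, ey]
        by_cases hba : b ≤ a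
        · simpa [hba] using exec_putFlag _ _
        · simpa [hba] using exec_putFlag _ _
      · simp only [hab, decide_false, cond_false]
        refine Exec.ite (a := 1) ?_
        simp only [sty, head_rulerAt, isMark_ruler, ey]
        by_cases hba : b ≤ a
        · simpa [hba] using exec_putFlag _ _
        · simpa [hba] using exec_putFlag _ _
    set v := f (decide (a ≤ b)) (decide (b ≤ a)) with hv
    have wf : ∀ i j l, withFlag v (st σ i j l) = st (withFlag v σ) i j l := by
      intro i j l
      simp only [st, withFlag]
      rw [Function.update_of_ne (by simp), Function.update_of_ne (by simp),
        Function.update_of_ne (by simp)]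
      rw [Function.update_comm (by simp : (TapeId.tmp : TapeId R) ≠ .flag),
        Function.update_comm (by simp : (TapeId.reg y : TapeId R) ≠ .flag),
        Function.update_comm (by simp : (TapeId.reg x : TapeId R) ≠ .flag)]
    have h₃ := Exec.loop_iterate
      (p := seq (move .tmp .left) (seq (move (.reg x) .right) (move (.reg y) .right)))
      (k := .tmp) (l := .tmp) (c := fun s _ => !s.isMark) (a := 5)
      (fun i => st (withFlag v σ) (a - m + i) (b - m + i) (m - i)) m ?_ ?_ ?_
    · rw [wf] at h₂
      have h := h₁.seq (h₂.seq h₃)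
      have e₀ : st σ (a - 0) (b - 0) 0 = σ := by
        simp only [st, Nat.sub_zero]
        rw [← hx, Function.update_eq_self, ← hy, Function.update_eq_self, ← htmp,
          Function.update_eq_self]
      have e₁ : st (withFlag v σ) (a - m + m) (b - m + m) (m - m) = withFlag v σ := by
        have ea : a - m + m = a := by omega
        have eb : b - m + m = b := by omega
        have hx' : withFlag v σ (.reg x) = rulerAt n a := by
          rw [withFlag_of_ne _ _ (by simp), hx]
        have hy' : withFlag v σ (.reg y) = rulerAt n b := by
          rw [withFlag_of_ne _ _ (by simp), hy]
        have ht' : withFlag v σ .tmp = rulerAt n 0 := by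
          rw [withFlag_of_ne _ _ (by simp), htmp]
        simp only [st, ea, eb, Nat.sub_self]
        rw [← hx', Function.update_eq_self, ← hy', Function.update_eq_self, ← ht',
          Function.update_eq_self]
      rw [e₀, e₁] at h
      exact h.mono (by omega)
    · intro i hi
      have : m - i ≠ 0 := by omega
      simp [stt, isMark_ruler, this]
    · simp [stt]
    · intro i hi
      have e : m - i = m - (i + 1) + 1 := by omega
      convert (Exec.move (.tmp : TapeId R) .left).seq
        ((Exec.move (.reg x) .right).seq (Exec.move (.reg y) .right)) using 1
      rw [stt, e, moved_left_rulerAt, ut, stx, moved_right_rulerAt, ux, sty, moved_right_rulerAt,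
        uy]
      rfl
  · intro i hi
    have h₁ : a - i ≠ 0 := by omega
    have h₂ : b - i ≠ 0 := by omega
    simp [stx, sty, isMark_ruler, h₁, h₂]
  · rcases le_total a b with h | h
    · have : a - m = 0 := by omega
      simp [stx, sty, isMark_ruler, this]
    · have : b - m = 0 := by omega
      simp [stx, sty, isMark_ruler, this]
  · intro i hi
    have e₁ : a - i = a - (i + 1) + 1 := by omega
    have e₂ : b - i = b - (i + 1) + 1 := by omega
    convert (Exec.move (.reg x : TapeId R) .left).seq
      ((Exec.move (.reg y) .left).seq (Exec.move .tmp .right)) using 1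
    rw [stx, e₁, moved_left_rulerAt, ux, sty, e₂, moved_left_rulerAt, uy, stt,
      moved_right_rulerAt, ut]

end Prog

end CountLogic

namespace CountLogic

/-! ### The elements of a finite linear order -/

section Elems

variable (A : Type*) [Fintype A] [LinearOrder A]

/-- The elements in increasing order. -/
def elems : List A := (Finset.univ : Finset A).sort (· ≤ ·)

lemma length_elems : (elems A).length = Fintype.card A := Finset.length_sort _

lemma nodup_elems : (elems A).Nodup := Finset.sort_nodup _ _

variable {A}

lemma mem_elems (a : A) : a ∈ elems A := (Finset.mem_sort _).2 (Finset.mem_univ a)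

/-- The number of smaller elements. -/
def rank (a : A) : ℕ := (elems A).idxOf a

lemma rank_lt (a : A) : rank a < Fintype.card A := by
  rw [← length_elems]
  exact List.idxOf_lt_length_iff.2 (mem_elems a)

lemma getElem_rank (a : A) (h : rank a < (elems A).length) : (elems A)[rank a] = a :=
  List.getElem_idxOf h

lemma rank_getElem (i : ℕ) (h : i < (elems A).length) : rank (elems A)[i] = i :=
  (nodup_elems A).idxOf_getElem i h

lemma rank_le_rank {a b : A} : rank a ≤ rank b ↔ a ≤ b := by
  have ha := (rank_lt a).trans_eq (length_elems A).symm
  have hb := (rank_lt b).trans_eq (length_elems A).symm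
  have h := (Finset.sortedLT_sort (Finset.univ : Finset A)).getElem_le_getElem_iff
    (hi := ha) (hj := hb)
  rw [← h]
  show (elems A)[rank a] ≤ (elems A)[rank b] ↔ _
  rw [getElem_rank, getElem_rank]

lemma rank_injective : Function.Injective (rank : A → ℕ) := fun a b h =>
  le_antisymm (rank_le_rank.1 h.le) (rank_le_rank.1 h.ge)

end Elems

/-! ### A programming language for finite ordered structures -/

/-- Programs with registers for elements of the domain and with relation variables. The tests are
formulae, without second-order quantifiers. -/
inductive Cmd (R : Signature) : Type
  | nop
  | halt
  | put (X : SOVar) (u : Fin X.arity → FOVar) (b : Bool)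
  | ite (φ : SO R) (p q : Cmd R)
  | each (x : FOVar) (p : Cmd R)
  | seq (p q : Cmd R)
  | fork (p q : Cmd R)

/-- The bound variables of the formula are at least `d` and increase inwards, and second-order
quantifiers do not occur. -/
def SO.Bounded {R : Signature} : ℕ → SO R → Prop
  | d, .neg φ => Bounded d φ
  | d, .or φ ψ => Bounded d φ ∧ Bounded d ψ
  | d, .exFO x φ => d ≤ x ∧ Bounded (x + 1) φ
  | _, .exSO _ _ => False
  | _, _ => True

namespace Cmd

variable {R : Signature}

/-- The loop variables of the program are at least `d` and increase inwards. -/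
def Bounded : ℕ → Cmd R → Prop
  | d, .ite φ p q => φ.Bounded d ∧ Bounded d p ∧ Bounded d q
  | d, .each x p => d ≤ x ∧ Bounded (x + 1) p
  | d, .seq p q => Bounded d p ∧ Bounded d q
  | d, .fork p q => Bounded d p ∧ Bounded d q
  | _, _ => True

open Classical in
/-- The number of runs of a program, as a function of the relations in its start, if the number
of runs after the end of the program is given by `k`. -/
noncomputable def den {A : Type*} [Fintype A] [LinearOrder A] (𝔄 : Interp R A) :
    Cmd R → FOAssign A → (SOAssign A → ℕ) → SOAssign A → ℕ
  | nop, _, k, s => k s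
  | halt, _, _, _ => 1
  | put X u b, e, k, s => k (Function.update s X
      (if b then insert (fun j => e (u j)) (s X) else (s X).erase fun j => e (u j)))
  | ite φ p q, e, k, s => if φ.Sat 𝔄 e s then den 𝔄 p e k s else den 𝔄 q e k s
  | each x p, e, k, s =>
      ((elems A).foldr (fun a k' => den 𝔄 p (Function.update e x a) k') k) s
  | seq p q, e, k, s => den 𝔄 p e (den 𝔄 q e k) s
  | fork p q, e, k, s => den 𝔄 p e k s + den 𝔄 q e k s

end Cmd

/-! ### Compilation of programs over structures to tape programs -/

namespace Prog

variable {R : Signature}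

/-- Evaluate a formula; the result is stored on the tape `flag`. -/
def test : SO R → Prog (TapeId R) Cell
  -- `compare` only works for two different registers.
  | .eq x y => if x = y then putFlag true else compare x y fun a b => a && b
  | .lt x y => if x = y then putFlag false else compare x y fun a b => a && !b
  | .rel i u => readBit (.rel i) (R.arity i) u
  | .top => putFlag true
  | .app X u => readBit (.arr X) X.arity u
  | .neg φ => seq (test φ) (ite .flag Cell.bit (putFlag false) (putFlag true))
  | .or φ ψ => seq (test φ) (ite .flag Cell.bit nop (test ψ))
  -- The search stops at the first witness, so that its positive answer is not overwritten by the
  -- next test.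
  | .exFO x φ => seq (putFlag false)
      (seq (loop (.reg x) .flag (fun s t => s.isSome && !t.bit)
        (seq (test φ) (move (.reg x) .right))) (rewind (.reg x)))
  | .exSO _ _ => nop

/-- The time for `test`. -/
def testCost (n : ℕ) : SO R → ℕ
  | .eq _ _ => n * 12 + 7
  | .lt _ _ => n * 12 + 7
  | .rel i _ => accessCost n (R.arity i)
  | .top => 1
  | .app X _ => accessCost n X.arity
  | .neg φ => testCost n φ + 3
  | .or φ ψ => testCost n φ + testCost n ψ + 3
  | .exFO _ φ => n * (testCost n φ + 5) + 10
  | .exSO _ _ => 1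

/-- The Turing machine program for a program. -/
def compile : Cmd R → Prog (TapeId R) Cell
  | .nop => nop
  | .halt => halt
  | .put X u b => writeBit (.arr X) X.arity u b
  | .ite φ p q => seq (test φ) (ite .flag Cell.bit (compile p) (compile q))
  | .each x p => loopN (.reg x) (compile p)
  | .seq p q => seq (compile p) (compile q)
  | .fork p q => fork (compile p) (compile q)

/-- The time for `compile`. -/
def cmdCost (n : ℕ) : Cmd R → ℕ
  | .nop => 1
  | .halt => 0
  | .put X _ _ => accessCost n X.arity
  | .ite φ p q => testCost n φ + cmdCost n p + cmdCost n q + 2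
  | .each _ p => n * (cmdCost n p + 5) + 10
  | .seq p q => cmdCost n p + cmdCost n q + 1
  | .fork p q => cmdCost n p + cmdCost n q + 2

variable {A : Type*} [Fintype A] [LinearOrder A]

/-- The tape `t` holds the relation `S`. -/
def IsTable {m : ℕ} (S : Set (Fin m → A)) (t : ITape Cell) : Prop :=
  ∃ g, Marked g ∧ t = ⟨g, 0⟩ ∧
    ∀ u, (g (addr (Fintype.card A) m fun j => rank (u j))).bit = true ↔ u ∈ S

/-- The tapes represent the structure `𝔄`, the assignment `e` and the relations `s`; the variables
from `d` on are not in use. -/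
structure Rep (𝔄 : Interp R A) (d : ℕ) (e : FOAssign A) (s : SOAssign A)
    (σ : TapeId R → ITape Cell) : Prop where
  reg : ∀ x, σ (.reg x) = rulerAt (Fintype.card A) (rank (e x))
  zero : ∀ x ≥ d, rank (e x) = 0
  aux : ∀ j, σ (.aux j) = rulerAt (Fintype.card A) 0
  tmp : σ .tmp = rulerAt (Fintype.card A) 0
  arr : ∀ X, IsTable (s X : Set (Fin X.arity → A)) (σ (.arr X))
  rel : ∀ i, IsTable (𝔄.rel i) (σ (.rel i))

variable {𝔄 : Interp R A} {d : ℕ} {e : FOAssign A} {s : SOAssign A} {σ : TapeId R → ITape Cell}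

lemma Rep.flag (h : Rep 𝔄 d e s σ) (t : ITape Cell) :
    Rep 𝔄 d e s (Function.update σ .flag t) where
  reg x := by rw [Function.update_of_ne (by simp), h.reg]
  zero := h.zero
  aux x := by rw [Function.update_of_ne (by simp), h.aux]
  tmp := by rw [Function.update_of_ne (by simp), h.tmp]
  arr x := by rw [Function.update_of_ne (by simp)]; exact h.arr x
  rel x := by rw [Function.update_of_ne (by simp)]; exact h.rel x

lemma Rep.bind (h : Rep 𝔄 d e s σ) {x : ℕ} (hx : d ≤ x) (a : A) :
    Rep 𝔄 (x + 1) (Function.update e x a) s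
      (Function.update σ (.reg x) (rulerAt (Fintype.card A) (rank a))) where
  reg y := by
    by_cases hy : y = x
    · subst hy; simp
    · rw [Function.update_of_ne (by simpa using hy), Function.update_of_ne hy, h.reg]
  zero y hy := by
    have hy' : y ≠ x := by omega
    rw [Function.update_of_ne hy', h.zero y (by omega)]
  aux x := by rw [Function.update_of_ne (by simp), h.aux]
  tmp := by rw [Function.update_of_ne (by simp), h.tmp]
  arr x := by rw [Function.update_of_ne (by simp)]; exact h.arr x
  rel x := by rw [Function.update_of_ne (by simp)]; exact h.rel x

/-- Variables from `d` on have rank `0` under `e`. So the rewound register of `x` represents `e x`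
again. -/
lemma Rep.unbind {x : ℕ} {a : A} (h : Rep 𝔄 (x + 1) (Function.update e x a) s σ)
    (hx : d ≤ x) (he : ∀ y ≥ d, rank (e y) = 0) :
    Rep 𝔄 d e s (Function.update σ (.reg x) (rulerAt (Fintype.card A) 0)) where
  reg y := by
    by_cases hy : y = x
    · subst hy; simp [he y hx]
    · rw [Function.update_of_ne (by simpa using hy), h.reg, Function.update_of_ne hy]
  zero := he
  aux x := by rw [Function.update_of_ne (by simp), h.aux]
  tmp := by rw [Function.update_of_ne (by simp), h.tmp]
  arr x := by rw [Function.update_of_ne (by simp)]; exact h.arr x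
  rel x := by rw [Function.update_of_ne (by simp)]; exact h.rel x

lemma Rep.card_pos (_ : Rep 𝔄 d e s σ) : 0 < Fintype.card A := (rank_lt (e 0)).pos

lemma Rep.exec_read (h : Rep 𝔄 d e s σ) {k : TapeId R} (hk : ∀ x, k ≠ .reg x)
    (hk' : ∀ j, k ≠ .aux j) (hkt : k ≠ .tmp) (hkf : k ≠ .flag) {m : ℕ} (u : Fin m → ℕ)
    {S : Set (Fin m → A)} (hS : IsTable S (σ k)) :
    ∃ t, (t.head.bit = true ↔ (fun j => e (u j)) ∈ S) ∧
      Exec (readBit k m u) σ (Function.update σ .flag t) (accessCost (Fintype.card A) m) := by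
  obtain ⟨g, hg, ht, hb⟩ := hS
  refine ⟨_, ?_, exec_readBit h.card_pos hk hk' hkt hkf m u (fun j => rank (e (u j)))
    (fun j => rank_lt _) h.aux h.tmp (fun j => h.reg _) hg ht⟩
  rw [← hb]
  simp [ITape.written, ITape.head]

/-- All tapes other than `flag` are restored, so tests can be nested. `Bounded` guarantees that the
register of a quantified variable is at `0` when its loop starts and is not used by an enclosing
loop. -/
lemma exec_test (φ : SO R) (hφ : φ.Bounded d) (h : Rep 𝔄 d e s σ) :
    ∃ t, (t.head.bit = true ↔ φ.Sat 𝔄 e s) ∧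
      Exec (test φ) σ (Function.update σ .flag t) (testCost (Fintype.card A) φ) := by
  induction φ generalizing d e σ with
  | eq x y =>
    rw [test, testCost]
    split_ifs with hxy
    · refine ⟨_, ?_, (exec_putFlag true σ).mono (by omega)⟩
      simp [SO.Sat, hxy, ITape.written, ITape.head]
    · refine ⟨_, ?_, exec_compare hxy _ (rank_lt _).le h.tmp (h.reg x) (h.reg y)⟩
      rw [SO.Sat, le_antisymm_iff (a := e x)]
      simp [ITape.written, ITape.head, rank_le_rank]
  | lt x y =>
    rw [test, testCost]
    split_ifs with hxy
    · refine ⟨_, ?_, (exec_putFlag false σ).mono (by omega)⟩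
      simp [SO.Sat, hxy, ITape.written, ITape.head]
    · refine ⟨_, ?_, exec_compare hxy _ (rank_lt _).le h.tmp (h.reg x) (h.reg y)⟩
      rw [SO.Sat, lt_iff_le_not_ge]
      simp [ITape.written, ITape.head, rank_le_rank]
  | rel i u => exact h.exec_read (by simp) (by simp) (by simp) (by simp) u (h.rel i)
  | app X u => exact h.exec_read (by simp) (by simp) (by simp) (by simp) u (h.arr X)
  | top =>
    refine ⟨_, ?_, exec_putFlag true σ⟩
    simp [SO.Sat, ITape.written, ITape.head]
  | neg φ ih =>
    obtain ⟨t, ht, hx⟩ := ih hφ h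
    have h₂ : Exec (ite .flag Cell.bit (putFlag false) (putFlag true)) _ _ 2 :=
      Exec.ite (a := 1) (σ := Function.update σ .flag t)
        (σ₁ := withFlag (!t.head.bit) (Function.update σ .flag t)) (by
          rw [Function.update_self]
          cases t.head.bit
          · exact exec_putFlag _ _
          · exact exec_putFlag _ _)
    rw [withFlag, Function.update_idem] at h₂
    refine ⟨_, ?_, hx.seq h₂⟩
    simp [SO.Sat, ← ht, ITape.written, ITape.head]
  | or φ ψ ih₁ ih₂ =>
    obtain ⟨t, ht, hx⟩ := ih₁ hφ.1 h
    obtain ⟨t', ht', hx'⟩ := ih₂ hφ.2 (h.flag t)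
    rw [Function.update_idem] at hx'
    by_cases hb : t.head.bit = true
    · refine ⟨t, by simp [SO.Sat, hb, ← ht], (hx.seq (Exec.ite (a := 1) ?_)).mono
        (b := testCost (Fintype.card A) (.or φ ψ)) (by simp only [testCost]; omega)⟩
      simp only [Function.update_self, hb, cond_true]
      exact Exec.nop
    · refine ⟨t', by simp [SO.Sat, hb, ← ht, ← ht'], (hx.seq (Exec.ite (a := testCost (Fintype.card A) ψ) ?_)).mono
        (b := testCost (Fintype.card A) (.or φ ψ)) (by simp only [testCost]; omega)⟩
      simp only [Function.update_self, hb, cond_false]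
      exact hx'
  | exSO X φ => exact hφ.elim
  | exFO x φ ih =>
    set n := Fintype.card A with hn
    have hpos : 0 < n := h.card_pos
    have hne : (TapeId.flag : TapeId R) ≠ .reg x := by simp
    -- Here `j` is the number of elements still to be tried. Where the head of the register stops
    -- depends on the first witness, hence the unspecified `i'`; the final rewind makes it
    -- irrelevant.
    have key : ∀ j ≤ n, ∀ t : ITape Cell, t.head.bit = false → ∃ t' : ITape Cell, ∃ i' ≤ n,
        (t'.head.bit = true ↔ ∃ a : A, n - j ≤ rank a ∧ φ.Sat 𝔄 (Function.update e x a) s) ∧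
        Exec (loop (.reg x) .flag (fun s t => s.isSome && !t.bit)
          (seq (test φ) (move (.reg x) .right)))
          (Function.update (Function.update σ (.reg x) (rulerAt n (n - j))) .flag t)
          (Function.update (Function.update σ (.reg x) (rulerAt n i')) .flag t')
          (j * (testCost n φ + 3) + 1) := by
      intro j hj
      induction j with
      | zero =>
        intro t ht
        refine ⟨t, n, le_rfl, ?_, ?_⟩
        · simp only [ht, Bool.false_eq_true, Nat.sub_zero, false_iff, not_exists, not_and]
          intro a ha
          have := rank_lt a
          omega
        · simpa using Exec.loop_exit (by simp [isSome_ruler hpos])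
      | succ j ihj =>
        intro t ht
        have hlt : n - (j + 1) < (elems A).length := by rw [length_elems]; omega
        set a := (elems A)[n - (j + 1)] with ha
        have hra : rank a = n - (j + 1) := rank_getElem _ hlt
        obtain ⟨t₁, ht₁, hx₁⟩ := ih hφ.2 ((h.bind hφ.1 a).flag t)
        rw [← hn, hra, Function.update_idem] at hx₁
        have hx₂ := hx₁.seq (Exec.move (.reg x) .right)
        have e₁ : n - (j + 1) + 1 = n - j := by omega
        rw [Function.update_of_ne hne.symm, Function.update_self, moved_right_rulerAt, e₁,
          Function.update_comm hne, Function.update_idem] at hx₂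
        have hc : ∀ b : A, n - (j + 1) ≤ rank b ↔ n - j ≤ rank b ∨ b = a := by
          intro b
          constructor
          · intro hb
            by_cases hb' : n - j ≤ rank b
            · exact Or.inl hb'
            · exact Or.inr (rank_injective (by omega))
          · rintro (hb | rfl) <;> omega
        have step : ∀ {σ' : TapeId R → ITape Cell} {c : ℕ},
            Exec (loop (.reg x) .flag (fun s t => s.isSome && !t.bit)
              (seq (test φ) (move (.reg x) .right)))
              (Function.update (Function.update σ (.reg x) (rulerAt n (n - j))) .flag t₁)
              σ' c →
            Exec (loop (.reg x) .flag (fun s t => s.isSome && !t.bit)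
              (seq (test φ) (move (.reg x) .right)))
              (Function.update (Function.update σ (.reg x) (rulerAt n (n - (j + 1)))) .flag t)
              σ' (testCost n φ + 1 + 1 + c + 1) := fun hl =>
          Exec.loop_step (by
            have : n - (j + 1) < n := by omega
            simp [isSome_ruler hpos, this, ht]) hx₂ hl
        by_cases hb : t₁.head.bit = true
        · refine ⟨t₁, n - j, by omega, ?_, (step (Exec.loop_exit ?_)).mono ?_⟩
          · exact iff_of_true hb ⟨a, hra.ge, ht₁.1 hb⟩
          · simp [hb]
          · rw [Nat.add_mul]; omega
        · obtain ⟨t', i', hi', ht', hx'⟩ := ihj (by omega) t₁ (by simpa using hb)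
          refine ⟨t', i', hi', ht'.trans ?_, (step hx').mono ?_⟩
          · simp only [hc]
            constructor
            · rintro ⟨b, hb, hs⟩
              exact ⟨b, Or.inl hb, hs⟩
            · rintro ⟨b, hb | rfl, hs⟩
              · exact ⟨b, hb, hs⟩
              · exact absurd (ht₁.2 hs) hb
          · rw [Nat.add_mul]; omega
    obtain ⟨t', i', hi', ht', hx'⟩ := key n le_rfl ((σ .flag).written (some (false, false)))
      (by simp [ITape.written, ITape.head])
    have hr := exec_rewind (k := .reg x)
      (σ := Function.update (Function.update σ (.reg x) (rulerAt n i')) .flag t')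
      (marked_ruler n) (a := i') (by simp [rulerAt])
    have hreg : σ (.reg x) = rulerAt n 0 := by rw [h.reg, h.zero x hφ.1]
    refine ⟨t', ?_, ?_⟩
    · simp [ht', SO.Sat]
    · have e₀ : Function.update (Function.update σ (.reg x) (rulerAt n (n - n))) .flag
          ((σ .flag).written (some (false, false))) = withFlag false σ := by
        rw [Nat.sub_self, ← hreg, Function.update_eq_self]
        rfl
      have e₁ : Function.update (Function.update (Function.update σ (.reg x) (rulerAt n i'))
          .flag t') (.reg x) ⟨ruler n, 0⟩ = Function.update σ .flag t' := by
        have : (⟨ruler n, 0⟩ : ITape Cell) = σ (.reg x) := by rw [hreg]; rfl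
        rw [Function.update_comm hne, Function.update_idem, this, Function.update_eq_self]
      rw [e₀] at hx'
      rw [e₁] at hr
      refine ((exec_putFlag false σ).seq (hx'.seq hr)).mono ?_
      simp only [testCost]
      ring_nf
      omega

/-- Different tuples have different addresses, because `rank` and `addr` are injective. So a write
affects a single tuple of a single relation. -/
lemma Rep.put (h : Rep 𝔄 d e s σ) (X : SOVar) (u : Fin X.arity → ℕ) (b : Bool)
    {S : Finset (Fin X.arity → A)}
    (hS : ∀ t, t ∈ S ↔ if t = (fun j => e (u j)) then b = true else t ∈ s X) :
    ∃ σ', Rep 𝔄 d e (Function.update s X S) σ' ∧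
      Exec (writeBit (.arr X) X.arity u b) σ σ' (accessCost (Fintype.card A) X.arity) := by
  obtain ⟨g, hg, ht, hb⟩ := h.arr X
  obtain ⟨g', hg', hb', hx⟩ := exec_writeBit h.card_pos (k := .arr X) (by simp) (by simp) (by simp)
    X.arity u (fun j => rank (e (u j))) b (fun j => rank_lt _) h.aux h.tmp (fun j => h.reg _) hg ht
  refine ⟨_, ⟨?_, h.zero, ?_, ?_, ?_, ?_⟩, hx⟩
  · intro x; rw [Function.update_of_ne (by simp), h.reg]
  · intro x; rw [Function.update_of_ne (by simp), h.aux]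
  · rw [Function.update_of_ne (by simp), h.tmp]
  · intro Y
    by_cases hY : Y = X
    · subst hY
      rw [Function.update_self, Function.update_self]
      refine ⟨g', hg', rfl, fun v => ?_⟩
      rw [hb', Finset.mem_coe, hS]
      by_cases hv : v = fun j => e (u j)
      · subst hv; simp
      · have : addr (Fintype.card A) Y.arity (fun j => rank (v j)) ≠
            addr (Fintype.card A) Y.arity (fun j => rank (e (u j))) := fun hh => hv <| by
          have := addr_injective _ _ (fun j => rank_lt _) (fun j => rank_lt _) hh
          exact funext fun j => rank_injective (congrFun this j)
        rw [if_neg this, if_neg hv, hb]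
        rfl
    · have e₁ : Function.update s X S Y = s Y := Function.update_of_ne hY ..
      rw [e₁, Function.update_of_ne (by simpa using hY)]
      exact h.arr Y
  · intro x; rw [Function.update_of_ne (by simp)]; exact h.rel x

/-- The pending stack `S` is only known through `k`, which counts its runs for every representation
of every choice of relations, with a common time bound `T`. In this form a fork can hand the same
continuation to both branches. -/
theorem tot_compile (p : Cmd R) (hp : p.Bounded d) {k : SOAssign A → ℕ}
    {S : Stack (TapeId R) Cell} {T : ℕ} (hk : ∀ s σ, Rep 𝔄 d e s σ → Tot S σ (k s) T)
    (h : Rep 𝔄 d e s σ) :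
    Tot (compile p :: S) σ (p.den 𝔄 e k s) (T + cmdCost (Fintype.card A) p) := by
  classical
  induction p generalizing d e s σ k S T with
  | nop => exact .nop (hk _ _ h)
  | halt => exact .halt
  | put X u b =>
    rw [Cmd.den]
    obtain ⟨σ', hσ', hx⟩ := h.put X u b (S := if b then insert (fun j => e (u j)) (s X) else
      (s X).erase fun j => e (u j)) (by
        intro t
        by_cases ht : t = fun j => e (u j)
        · cases b <;> simp [ht]
        · cases b <;> simp [ht])
    convert hx (hk _ _ hσ') using 2 <;> rfl
  | ite φ p q hp' hq' =>
    obtain ⟨t, ht, hx⟩ := exec_test φ hp.1 h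
    rw [compile, Cmd.den]
    have h' := h.flag t
    split_ifs with hs
    · refine (Tot.seq (hx (.ite ?_))).mono (t := T + cmdCost (Fintype.card A) p + 1 +
        testCost (Fintype.card A) φ + 1) (by simp only [cmdCost]; omega)
      rw [Function.update_self, ht.2 hs]
      exact hp' hp.2.1 hk h'
    · refine (Tot.seq (hx (.ite ?_))).mono (t := T + cmdCost (Fintype.card A) q + 1 +
        testCost (Fintype.card A) φ + 1) (by simp only [cmdCost]; omega)
      have : t.head.bit = false := by rw [← Bool.not_eq_true, ht]; exact hs
      rw [Function.update_self, this]
      exact hq' hp.2.2 hk h'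
  | seq p q hp' hq' =>
    rw [compile, Cmd.den]
    refine (Tot.seq (hp' hp.1 (T := T + cmdCost (Fintype.card A) q)
      (fun s σ hr => hq' hp.2 hk hr) h)).mono ?_
    simp only [cmdCost]; omega
  | fork p q hp' hq' =>
    rw [compile, Cmd.den]
    refine Tot.mono (t := T + cmdCost (Fintype.card A) p + cmdCost (Fintype.card A) q + 1 + 1)
      (.fork ?_ ?_) ?_
    · exact (hp' hp.1 hk h).mono (by omega)
    · exact .nop ((hq' hp.2 hk h).mono (by omega))
    · simp only [cmdCost]; omega
  | each x p hp' =>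
    set n := Fintype.card A with hn
    have hpos : 0 < n := h.card_pos
    have hreg : ∀ {s σ}, Rep 𝔄 d e s σ → σ (.reg x) = rulerAt n 0 := fun h => by
      rw [h.reg, h.zero x hp.1]
    -- `does_loopN` does not apply, since the body may branch. The induction is on the list `l` of
    -- elements still to come, with the rewinding of the register as part of the continuation.
    have key : ∀ l : List A, l.length ≤ n → l = (elems A).drop (n - l.length) →
        ∀ s σ, Rep 𝔄 d e s σ →
        Tot (loop (.reg x) (.reg x) (fun s _ => s.isSome) (seq (compile p) (move (.reg x) .right))
          :: rewind (.reg x) :: S) (Function.update σ (.reg x) (rulerAt n (n - l.length)))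
          (l.foldr (fun a k' => p.den 𝔄 (Function.update e x a) k') k s)
          (T + (n * 2 + 1) + 1 + l.length * (cmdCost n p + 3)) := by
      intro l
      induction l with
      | nil =>
        intro _ _ s σ hr
        refine (Tot.loop (t := T + (n * 2 + 1)) ?_).mono (by omega)
        simp only [Function.update_self, List.length_nil, Nat.sub_zero, head_rulerAt,
          isSome_ruler hpos, lt_irrefl, decide_false, cond_false, List.foldr_nil]
        refine exec_rewind (marked_ruler n) (a := n) (by simp [rulerAt]) ?_
        rw [Function.update_idem]
        have : (⟨ruler n, 0⟩ : ITape Cell) = σ (.reg x) := by rw [hreg hr]; rfl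
        rw [this, Function.update_eq_self]
        exact hk _ _ hr
      | cons a l ih =>
        intro hl hd s σ hr
        simp only [List.length_cons] at hl hd ⊢
        have hlt : n - (l.length + 1) < (elems A).length := by rw [length_elems]; omega
        rw [List.drop_eq_getElem_cons hlt, List.cons.injEq] at hd
        have e₁ : n - (l.length + 1) + 1 = n - l.length := by omega
        rw [e₁] at hd
        have hra : rank a = n - (l.length + 1) := by rw [hd.1, rank_getElem]
        refine (Tot.loop (t := T + (n * 2 + 1) + 1 + l.length * (cmdCost n p + 3) + 1
          + cmdCost n p + 1) ?_).mono (by rw [Nat.add_mul]; omega)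
        have hlt' : n - (l.length + 1) < n := by omega
        simp only [Function.update_self, head_rulerAt, isSome_ruler hpos, hlt', decide_true,
          cond_true, List.foldr_cons]
        refine Tot.seq (hp' hp.2 ?_ (hra ▸ hr.bind hp.1 a))
        intro s' σ' hr'
        refine Tot.move ?_
        have hr'' := hr'.unbind (d := d) (e := e) hp.1 hr.zero
        have := ih (by omega) hd.2 s' _ hr''
        rw [Function.update_idem] at this
        rw [hr'.reg, Function.update_self, moved_right_rulerAt, hra, e₁]
        exact this
    have hlen : (elems A).length = n := length_elems A
    have := key (elems A) hlen.le (by simp [hlen]) s σ h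
    rw [hlen, Nat.sub_self, ← hreg h, Function.update_eq_self] at this
    rw [compile, Cmd.den]
    refine (Tot.seq this).mono ?_
    simp only [cmdCost]
    ring_nf
    omega

end Prog

end CountLogic

namespace CountLogic

/-! ### Polynomial bounds -/

/-- Functions bounded by a polynomial. -/
def PolyBounded (f : ℕ → ℕ) : Prop := ∃ P : Polynomial ℕ, ∀ n, f n ≤ P.eval n

namespace PolyBounded

variable {f g : ℕ → ℕ}

lemma const (c : ℕ) : PolyBounded fun _ => c := ⟨.C c, by simp⟩

protected lemma id : PolyBounded fun n => n := ⟨.X, by simp⟩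

lemma add (hf : PolyBounded f) (hg : PolyBounded g) : PolyBounded fun n => f n + g n := by
  obtain ⟨P, hP⟩ := hf
  obtain ⟨Q, hQ⟩ := hg
  exact ⟨P + Q, fun n => by rw [Polynomial.eval_add]; exact add_le_add (hP n) (hQ n)⟩

lemma mul (hf : PolyBounded f) (hg : PolyBounded g) : PolyBounded fun n => f n * g n := by
  obtain ⟨P, hP⟩ := hf
  obtain ⟨Q, hQ⟩ := hg
  exact ⟨P * Q, fun n => by rw [Polynomial.eval_mul]; exact Nat.mul_le_mul (hP n) (hQ n)⟩

lemma pow (m : ℕ) : PolyBounded fun n => n ^ m := ⟨.X ^ m, by simp⟩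

end PolyBounded

lemma polynomial_eval_mono (P : Polynomial ℕ) {m n : ℕ} (h : m ≤ n) : P.eval m ≤ P.eval n := by
  rw [Polynomial.eval_eq_sum, Polynomial.eval_eq_sum]
  exact Finset.sum_le_sum fun i _ => Nat.mul_le_mul_left _ (Nat.pow_le_pow_left h i)

namespace Prog

open PolyBounded

variable {R : Signature}

lemma polyBounded_loopsCost (τ m : ℕ) : PolyBounded fun n => loopsCost n τ m := by
  induction m with
  | zero => exact const τ
  | succ m ih => exact (PolyBounded.id.mul (ih.add (const 5))).add (const 3)

lemma polyBounded_seekCost (m : ℕ) : PolyBounded fun n => seekCost n m := by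
  induction m with
  | zero => exact const 1
  | succ m ih =>
    exact (((PolyBounded.id.mul ((polyBounded_loopsCost 1 m).add (const 9))).add (const 3)).add
      ih).add (const 1)

lemma polyBounded_accessCost (m : ℕ) : PolyBounded fun n => accessCost n m :=
  (polyBounded_seekCost m).add (((pow m).mul (const 2)).add (const 5))

lemma polyBounded_testCost (φ : SO R) : PolyBounded fun n => testCost n φ := by
  induction φ with
  | eq x y => exact (PolyBounded.id.mul (const 12)).add (const 7)
  | lt x y => exact (PolyBounded.id.mul (const 12)).add (const 7)
  | rel i u => exact polyBounded_accessCost _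
  | top => exact const 1
  | app X u => exact polyBounded_accessCost _
  | neg φ ih => exact ih.add (const 3)
  | or φ ψ ih₁ ih₂ => exact (ih₁.add ih₂).add (const 3)
  | exFO x φ ih => exact (PolyBounded.id.mul (ih.add (const 5))).add (const 10)
  | exSO X φ => exact const 1

lemma polyBounded_cmdCost (p : Cmd R) : PolyBounded fun n => cmdCost n p := by
  induction p with
  | nop => exact const 1
  | halt => exact const 0
  | put X u b => exact polyBounded_accessCost _
  | ite φ p q hp hq => exact (((polyBounded_testCost φ).add hp).add hq).add (const 2)
  | each x p hp => exact (PolyBounded.id.mul (hp.add (const 5))).add (const 10)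
  | seq p q hp hq => exact (hp.add hq).add (const 1)
  | fork p q hp hq => exact (hp.add hq).add (const 2)

/-! ### Reading the input -/

/-- Run `f k` for every `k` of the list. -/
def forEach {α : Type} (l : List α) (f : α → Prog (TapeId R) Cell) : Prog (TapeId R) Cell :=
  l.foldr (fun k p => seq (f k) p) nop

lemma exec_forEach {l : List (TapeId R)} (hl : l.Nodup) {f : TapeId R → Prog (TapeId R) Cell}
    {h : ITape Cell → ITape Cell} {P : ITape Cell → Prop} {τ : ℕ}
    (hf : ∀ k σ, P (σ k) → Exec (f k) σ (Function.update σ k (h (σ k))) τ)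
    {σ : TapeId R → ITape Cell} (hσ : ∀ k ∈ l, P (σ k)) :
    Exec (forEach l f) σ (fun k => if k ∈ l then h (σ k) else σ k) (l.length * (τ + 1) + 1) := by
  induction l generalizing σ with
  | nil => simpa [forEach] using Exec.nop
  | cons k l ih =>
    rw [List.nodup_cons] at hl
    have h₂ := ih hl.2 (σ := Function.update σ k (h (σ k))) fun k' hk' => by
      have : k' ≠ k := fun hh => hl.1 (hh ▸ hk')
      rw [Function.update_of_ne this]
      exact hσ k' (List.mem_cons_of_mem _ hk')
    have h₁ := (hf k σ (hσ k List.mem_cons_self)).seq h₂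
    have e : (fun k_1 ↦ if k_1 ∈ l then h (Function.update σ k (h (σ k)) k_1)
        else Function.update σ k (h (σ k)) k_1) =
        fun k' => if k' ∈ k :: l then h (σ k') else σ k' := by
      funext k'
      by_cases hk : k' = k
      · subst hk; simp [hl.1]
      · simp [hk]
    rw [e] at h₁
    exact h₁.mono (by simp only [List.length_cons]; ring_nf; omega)

lemma tapes_forEach {α : Type} (l : List α) (f : α → Prog (TapeId R) Cell) (F : Finset (TapeId R))
    (h : ∀ a ∈ l, (f a).tapes ⊆ F) : (forEach l f).tapes ⊆ F := by
  induction l with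
  | nil => simp [forEach, tapes]
  | cons a l ih =>
    exact Finset.union_subset (h a List.mem_cons_self)
      (ih fun b hb => h b (List.mem_cons_of_mem _ hb))

/-- The symbol of an input bit. -/
def inputCell (b : Bool) : Cell := some (false, b)

/-- Copy one input bit to the tape of the relation name `i`. -/
def copyBit (i : Fin R.k) : Prog (TapeId R) Cell :=
  seq (ite .input Cell.bit (write (.rel i) fun s => some (s.isMark, true))
      (write (.rel i) fun s => some (s.isMark, false)))
    (seq (move (.rel i) .right) (move .input .right))

/-- What `copyBit` does to the tapes. -/
def copyStep (i : Fin R.k) (σ : TapeId R → ITape Cell) : TapeId R → ITape Cell :=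
  Function.update (Function.update σ (.rel i)
    (((σ (.rel i)).written (some ((σ (.rel i)).head.isMark, (σ .input).head.bit))).moved .right))
    .input ((σ .input).moved .right)

lemma ignores_copyStep (i : Fin R.k) (j : ℕ) : Ignores (copyStep i) (.aux j) := by
  intro σ v
  unfold copyStep
  rw [Function.update_of_ne (by simp), Function.update_of_ne (by simp),
    Function.update_comm (by simp : (TapeId.aux j : TapeId R) ≠ .rel i),
    Function.update_comm (by simp : (TapeId.aux j : TapeId R) ≠ .input)]

lemma exec_copyBit (i : Fin R.k) (σ : TapeId R → ITape Cell) :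
    Exec (copyBit i) σ (copyStep i σ) 6 := by
  have h₁ : Exec (ite .input Cell.bit (write (.rel i) fun s => some (s.isMark, true))
      (write (.rel i) fun s => some (s.isMark, false))) σ (Function.update σ (.rel i)
      ((σ (.rel i)).written (some ((σ (.rel i)).head.isMark, (σ .input).head.bit)))) 2 := by
    refine Exec.ite (a := 1) ?_
    cases (σ .input).head.bit
    · exact Exec.write _ _
    · exact Exec.write _ _
  convert h₁.seq ((Exec.move (.rel i) .right).seq (Exec.move .input .right)) using 1
  · rfl
  rw [Function.update_self, Function.update_idem, Function.update_of_ne (by simp)]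
  rfl

/-- Each write copies the mark found in the cell, so the growing table stays rewindable. Cells from
`m` on are left unspecified. -/
lemma copyStep_iterate (i : Fin R.k) {σ : TapeId R → ITape Cell} {inp g : ℤ → Cell} {q : ℕ}
    (hσ : σ .input = ⟨inp, q⟩) (hg : Marked g) (hσ' : σ (.rel i) = ⟨g, 0⟩) (m : ℕ) :
    ∃ g', Marked g' ∧ (∀ a < m, (g' a).bit = (inp ((q + a : ℕ) : ℤ)).bit) ∧
      (copyStep i)^[m] σ = Function.update (Function.update σ (.rel i) ⟨g', m⟩) .input
        ⟨inp, (q + m : ℕ)⟩ := by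
  induction m with
  | zero =>
    refine ⟨g, hg, by simp, ?_⟩
    simp [← hσ, ← hσ']
  | succ m ih =>
    obtain ⟨g', hg', hb, he⟩ := ih
    refine ⟨Function.update g' m (some ((g' m).isMark, (inp ((q + m : ℕ) : ℤ)).bit)), ?_, ?_, ?_⟩
    · intro z
      by_cases h : z = m
      · simp [h, hg' m]
      · have : (z : ℤ) ≠ m := by exact_mod_cast h
        rw [Function.update_of_ne this, hg' z]
    · intro a ha
      by_cases h : a = m
      · subst h; simp
      · have : (a : ℤ) ≠ m := by exact_mod_cast h
        rw [Function.update_of_ne this, hb a (by omega)]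
    · rw [Function.iterate_succ_apply', he, copyStep]
      simp only [Function.update_self, ITape.moved, ITape.head, ITape.written]
      rw [Function.update_of_ne (by simp), Function.update_self,
        Function.update_comm (by simp : (TapeId.input : TapeId R) ≠ .rel i), Function.update_idem,
        Function.update_idem]
      simp only [Nat.cast_add, Nat.cast_succ]
      congr 2

/-- Copy the table of the relation name `i` from the input. -/
def copyRel (i : Fin R.k) : Prog (TapeId R) Cell :=
  seq (loops (R.arity i) (copyBit i)) (rewind (.rel i))

/-- The time for `copyRel`. -/
def copyCost (n m : ℕ) : ℕ := loopsCost n 6 m + (n ^ m * 2 + 1) + 1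

lemma exec_copyRel {n : ℕ} (hn : 0 < n) (i : Fin R.k) {σ : TapeId R → ITape Cell}
    {inp g : ℤ → Cell} {q : ℕ} (ha : ∀ j, σ (.aux j) = rulerAt n 0)
    (hσ : σ .input = ⟨inp, q⟩) (hg : Marked g) (hσ' : σ (.rel i) = ⟨g, 0⟩) :
    ∃ g', Marked g' ∧ (∀ a < n ^ R.arity i, (g' a).bit = (inp ((q + a : ℕ) : ℤ)).bit) ∧
      Exec (copyRel i) σ (Function.update (Function.update σ (.rel i) ⟨g', 0⟩) .input
        ⟨inp, (q + n ^ R.arity i : ℕ)⟩) (copyCost n (R.arity i)) := by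
  obtain ⟨g', hg', hb, he⟩ := copyStep_iterate i hσ hg hσ' (n ^ R.arity i)
  refine ⟨g', hg', hb, ?_⟩
  have h₁ := does_loops hn (ignores_copyStep i) (fun σ _ => exec_copyBit i σ) (R.arity i) σ
    (by rintro _ ⟨j, -, rfl⟩; exact ha j)
  rw [he] at h₁
  have h₂ := exec_rewind (k := .rel i) (σ := Function.update (Function.update σ (.rel i)
    ⟨g', (n ^ R.arity i : ℕ)⟩) .input ⟨inp, (q + n ^ R.arity i : ℕ)⟩) hg' (a := n ^ R.arity i)
    (by rw [Function.update_of_ne (by simp), Function.update_self])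
  rw [Function.update_comm (by simp : (TapeId.input : TapeId R) ≠ .rel i),
    Function.update_idem] at h₂
  exact h₁.seq h₂

/-- The position of the table of `i` if the tables of the names in the list follow each other. -/
def offset (n : ℕ) : List (Fin R.k) → Fin R.k → ℕ
  | [], _ => 0
  | j :: l, i => if i = j then 0 else n ^ R.arity j + offset n l i

/-- The time to copy the tables of the names in the list. -/
def copiesCost (n : ℕ) (l : List (Fin R.k)) : ℕ :=
  l.foldr (fun i c => copyCost n (R.arity i) + c + 1) 1

lemma exec_copies {n : ℕ} (hn : 0 < n) (l : List (Fin R.k)) (hl : l.Nodup)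
    {σ : TapeId R → ITape Cell} {inp g : ℤ → Cell} {q : ℕ} (ha : ∀ j, σ (.aux j) = rulerAt n 0)
    (hσ : σ .input = ⟨inp, q⟩) (hg : Marked g) (hσ' : ∀ i ∈ l, σ (.rel i) = ⟨g, 0⟩) :
    ∃ σ', Exec (forEach l copyRel) σ σ' (copiesCost n l) ∧
      (∀ k, k ≠ .input → (∀ i ∈ l, k ≠ .rel i) → σ' k = σ k) ∧
      ∀ i ∈ l, ∃ g', Marked g' ∧ σ' (.rel i) = ⟨g', 0⟩ ∧
        ∀ a < n ^ R.arity i, (g' a).bit = (inp ((q + offset n l i + a : ℕ) : ℤ)).bit := by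
  induction l generalizing σ q with
  | nil => exact ⟨σ, Exec.nop, fun _ _ _ => rfl, by simp⟩
  | cons i l ih =>
    rw [List.nodup_cons] at hl
    obtain ⟨g₁, hg₁, hb₁, hx₁⟩ := exec_copyRel hn i ha hσ hg (hσ' i List.mem_cons_self)
    obtain ⟨σ', hx₂, hs, ht⟩ := ih hl.2
      (σ := Function.update (Function.update σ (.rel i) ⟨g₁, 0⟩) .input
        ⟨inp, (q + n ^ R.arity i : ℕ)⟩) (q := q + n ^ R.arity i)
      (fun j => by rw [Function.update_of_ne (by simp), Function.update_of_ne (by simp), ha])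
      (Function.update_self ..) (fun j hj => by
        have : j ≠ i := fun h => hl.1 (h ▸ hj)
        rw [Function.update_of_ne (by simp), Function.update_of_ne (by simpa using this)]
        exact hσ' j (List.mem_cons_of_mem _ hj))
    refine ⟨σ', hx₁.seq hx₂, fun k hk hk' => ?_, fun j hj => ?_⟩
    · rw [hs k hk fun j hj => hk' j (List.mem_cons_of_mem _ hj), Function.update_of_ne hk,
        Function.update_of_ne (hk' i List.mem_cons_self)]
    · rcases List.mem_cons.1 hj with rfl | hj
      · refine ⟨g₁, hg₁, ?_, fun a h => ?_⟩
        · rw [hs _ (by simp) fun k hk h => hl.1 (by simp at h; exact h ▸ hk),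
            Function.update_of_ne (by simp), Function.update_self]
        · rw [hb₁ a h]
          simp [offset]
      · obtain ⟨g', hg', he, hb⟩ := ht j hj
        have : j ≠ i := fun h => hl.1 (h ▸ hj)
        refine ⟨g', hg', he, fun a h => ?_⟩
        rw [hb a h]
        simp [offset, this, add_assoc]

/-- The tapes that serve as registers. -/
def isReg : TapeId R → Bool
  | .reg _ => true
  | .aux _ => true
  | .tmp => true
  | _ => false

/-- The tapes that serve as tables. -/
def isTab : TapeId R → Bool
  | .arr _ => true
  | .rel _ => true
  | _ => false

/-- Mark the first cell. -/
def putMark (k : TapeId R) : Prog (TapeId R) Cell := write k fun _ => some (true, false)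

/-- Lengthen a register by one cell. -/
def grow (k : TapeId R) (b : Bool) : Prog (TapeId R) Cell :=
  seq (write k fun _ => some (b, false)) (move k .right)

/-- Set up the registers in `L` for a domain with as many elements as the input has leading zeros,
set up the tables in `L`, and then run `p`; halt at once if the domain is empty. -/
def setup (L : List (TapeId R)) (p : Prog (TapeId R) Cell) : Prog (TapeId R) Cell :=
  ite .input (fun s => s.isSome && !s.bit)
    (seq (forEach (L.filter isTab) putMark)
      (seq (forEach (L.filter isReg) fun k => grow k true)
        (seq (move .input .right)
          (seq (loop .input .input (fun s _ => s.isSome && !s.bit)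
              (seq (forEach (L.filter isReg) fun k => grow k false) (move .input .right)))
            (seq (forEach (L.filter isReg) rewind)
              (seq (move .input .right) p))))))
    halt

lemma tapes_setup (L : List (TapeId R)) (p : Prog (TapeId R) Cell) (hp : p.tapes ⊆ L.toFinset) :
    (setup L p).tapes ⊆ insert .input L.toFinset := by
  have hf : ∀ (c : TapeId R → Bool) (f : TapeId R → Prog (TapeId R) Cell),
      (∀ k, (f k).tapes = {k}) → (forEach (L.filter c) f).tapes ⊆ insert .input L.toFinset := by
    intro c f h
    refine tapes_forEach _ _ _ fun k hk => ?_
    rw [h, Finset.singleton_subset_iff, Finset.mem_insert, List.mem_toFinset]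
    exact Or.inr (List.mem_of_mem_filter hk)
  have h₁ := hf isTab putMark fun k => rfl
  have h₂ := hf isReg (fun k => grow k true) fun k => by simp [grow, tapes]
  have h₃ := hf isReg (fun k => grow k false) fun k => by simp [grow, tapes]
  have h₄ := hf isReg rewind fun k => by simp [rewind, tapes]
  have h₅ := hp.trans (Finset.subset_insert .input _)
  simp only [setup, tapes, Finset.union_subset_iff, Finset.singleton_subset_iff,
    Finset.insert_subset_iff, Finset.mem_insert_self, true_and, and_true, Finset.empty_subset]
  exact ⟨h₁, h₂, h₃, h₄, h₅⟩

/-- A register under construction with `i` cells has its head on the first blank one. For `i = 0`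
the tape is still empty, and the new cell is the one to be marked. -/
lemma grow_rulerAt (i : ℕ) (b : Bool) (hb : b = decide (i = 0)) (t : ITape Cell)
    (ht : t = if i = 0 then ITape.ofList [] else rulerAt i i) :
    (t.written (some (b, false))).moved .right = rulerAt (i + 1) (i + 1) := by
  subst ht hb
  ext z
  · by_cases hi : i = 0
    · subst hi
      by_cases hz : z = 0
      · subst hz
        simp [ITape.written, ITape.moved, rulerAt, ITape.ofList]
      · have : ¬ (0 < z ∧ z < 1) := by omega
        simp [ITape.written, ITape.moved, rulerAt, ruler, hz, this, ITape.ofList]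
    · by_cases hz : z = i
      · subst hz
        have : 0 < i := by omega
        simp [ITape.written, ITape.moved, rulerAt, hi, ruler, this]
      · by_cases hz0 : z = 0
        · subst hz0
          have : (0 : ℤ) ≠ i := by omega
          simp [ITape.written, ITape.moved, rulerAt, hi, Function.update_of_ne this]
        · have : (0 < z ∧ z < i) ↔ (0 < z ∧ z < i + 1) := by omega
          simp [ITape.written, ITape.moved, rulerAt, hi, ruler, hz, hz0, this]
  · by_cases hi : i = 0
    · subst hi; simp [ITape.written, ITape.moved, rulerAt, ITape.ofList]
    · simp [ITape.written, ITape.moved, rulerAt, hi]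

/-- The time for `setup`. -/
def setupCost (n l : ℕ) : ℕ :=
  (l * 2 + 1) + (l * 4 + 1) + 1 + (n * (l * 4 + 4) + 1) + (l * (n * 2 + 2) + 1) + 1 + 8

/-- Each leading zero lengthens all registers by one cell, so the size `n` is never computed. The
symbol after the zeros is skipped whatever it is, possibly a blank; this covers strings that are not
encodings. -/
theorem tot_setup_of_tot {n : ℕ} (hn : 0 < n) (L : List (TapeId R)) (hL : L.Nodup)
    {σ : TapeId R → ITape Cell} {inp : ℤ → Cell}
    (hσ : σ .input = ⟨inp, 0⟩) (hinp : ∀ i < n, inp (i : ℕ) = some (false, false))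
    (hinp' : inp (n : ℕ) = none ∨ (inp (n : ℕ)).bit = true)
    (hreg : ∀ k ∈ L, isReg k → σ k = ITape.ofList [])
    (p : Prog (TapeId R) Cell) {c τ : ℕ}
    (hp : Tot [p] (fun k => if k = .input then ⟨inp, (n + 1 : ℕ)⟩ else
      if k ∈ L.filter isReg then rulerAt n 0 else
      if k ∈ L.filter isTab then (σ k).written (some (true, false)) else σ k) c τ) :
    Tot [setup L p] σ c (setupCost n L.length + τ) := by
  set Lr := L.filter isReg with hLr
  set Lt := L.filter isTab with hLt
  have hlr : Lr.length ≤ L.length := List.length_filter_le _ _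
  have hlt : Lt.length ≤ L.length := List.length_filter_le _ _
  have nr : Lr.Nodup := hL.filter _
  have nt : Lt.Nodup := hL.filter _
  have rt : ∀ k, k ∈ Lr → k ∉ Lt := by
    intro k hk hk'
    have h₁ := List.of_mem_filter hk
    have h₂ := List.of_mem_filter hk'
    cases k <;> simp_all [isReg, isTab]
  have ir : TapeId.input ∉ Lr := fun h => by simpa [isReg] using List.of_mem_filter h
  have it : TapeId.input ∉ Lt := fun h => by simpa [isTab] using List.of_mem_filter h
  let base : TapeId R → ITape Cell :=
    fun k => if k ∈ Lt then (σ k).written (some (true, false)) else σ k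
  let st (i : ℕ) : TapeId R → ITape Cell := fun k =>
    if k = .input then ⟨inp, (i : ℕ)⟩ else if k ∈ Lr then rulerAt i i else base k
  have hgrow : ∀ (b : Bool) (k : TapeId R) (σ : TapeId R → ITape Cell), True →
      Exec (grow k b) σ (Function.update σ k (((σ k).written (some (b, false))).moved .right))
        3 := fun b k σ _ => by
    convert (Exec.write k fun _ => some (b, false)).seq (Exec.move k .right) using 1
    · rfl
    rw [Function.update_self, Function.update_idem]
  have h₁ : Exec (forEach Lt putMark) σ base (Lt.length * 2 + 1) :=
    exec_forEach nt (P := fun _ => True) (h := fun t => t.written (some (true, false))) (τ := 1)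
      (fun k σ _ => Exec.write k _) (fun _ _ => trivial)
  have h₂ := exec_forEach nr (σ := base) (P := fun _ => True) (f := fun k => grow k true)
    (h := fun t => (t.written (some (true, false))).moved .right) (hgrow true) (fun _ _ => trivial)
  have h₃ := Exec.move (σ := fun k => if k ∈ Lr then
    ((base k).written (some (true, false))).moved .right else base k) .input .right
  have e₃ : Function.update (fun k => if k ∈ Lr then
      ((base k).written (some (true, false))).moved .right else base k) .input
      (((fun k => if k ∈ Lr then ((base k).written (some (true, false))).moved .right else base k)
        .input).moved .right) = st 1 := by
    funext k
    by_cases hk : k = .input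
    · subst hk
      simp only [Function.update_self, st, if_true, ir, base, it, hσ, ITape.moved]
      simp
    · rw [Function.update_of_ne hk]
      simp only [st, hk, if_false]
      by_cases hr : k ∈ Lr
      · simp only [hr, if_true, base, rt k hr, if_false]
        exact grow_rulerAt 0 true rfl _ (hreg k (List.mem_of_mem_filter hr) (List.of_mem_filter hr))
      · simp only [hr, if_false]
  rw [e₃] at h₃
  -- There are only `n - 1` rounds: the first zero has been consumed already, when the marked cells
  -- were written.
  have h₄ := Exec.loop_iterate (p := seq (forEach Lr fun k => grow k false) (move .input .right))
    (k := .input) (l := .input) (c := fun s _ => s.isSome && !s.bit) (a := Lr.length * 4 + 3)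
    (fun i => st (i + 1)) (n - 1) ?_ ?_ ?_
  · have e₄ : n - 1 + 1 = n := by omega
    rw [e₄, zero_add] at h₄
    have h₅ := exec_forEach nr (f := rewind) (σ := st n) (P := fun t => t = rulerAt n n)
      (h := fun _ => rulerAt n 0) (τ := n * 2 + 1)
      (fun k σ hk => by simpa [rulerAt] using exec_rewind (marked_ruler n) (a := n) hk)
      (fun k hk => by
        have : k ≠ .input := fun h => ir (h ▸ hk)
        simp only [st, this, hk, if_true, if_false])
    have h₆ := Exec.move (σ := fun k => if k ∈ Lr then rulerAt n 0 else st n k) .input .right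
    have e₆ : Function.update (fun k => if k ∈ Lr then rulerAt n 0 else st n k) .input
        (((fun k => if k ∈ Lr then rulerAt n 0 else st n k) .input).moved .right) =
        (fun k => if k = .input then ⟨inp, (n + 1 : ℕ)⟩ else if k ∈ Lr then rulerAt n 0 else
          if k ∈ Lt then (σ k).written (some (true, false)) else σ k) := by
      funext k
      by_cases hk : k = .input
      · subst hk
        simp only [Function.update_self, if_true, ir, if_false, st, ITape.moved]
        simp
      · rw [Function.update_of_ne hk]
        simp only [hk, if_false, st, base]
        by_cases hr : k ∈ Lr <;> simp [hr]
    rw [e₆] at h₆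
    have h₇ := Tot.seq (h₁ (.seq (h₂ (.seq (h₃ (.seq (h₄ (.seq (h₅ (.seq (h₆ hp)))))))))))
    have hc : ((σ .input).head.isSome && !(σ .input).head.bit) = true := by
      have := hinp 0 hn
      rw [hσ]
      simp only [ITape.head]
      rw [show (0 : ℤ) = ((0 : ℕ) : ℤ) from rfl, this]
      rfl
    refine (Tot.ite (t := setupCost n L.length + τ - 1) ?_).mono (by simp only [setupCost]; omega)
    rw [hc]
    refine h₇.mono ?_
    have k₁ : (n - 1) * (Lr.length * 4 + 3 + 1) ≤ n * (L.length * 4 + 4) :=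
      Nat.mul_le_mul (by omega) (by omega)
    have k₂ : Lr.length * (n * 2 + 1 + 1) ≤ L.length * (n * 2 + 2) :=
      Nat.mul_le_mul hlr (by omega)
    simp only [setupCost]
    omega
  · intro i hi
    have h := hinp (i + 1) (by omega)
    push_cast at h
    simp [st, ITape.head, h]
  · have e₄ : n - 1 + 1 = n := by omega
    rcases hinp' with h | h
    · simp only [st, e₄, if_true, ITape.head, h]; rfl
    · simp only [st, e₄, if_true, ITape.head, h]; simp
  · intro i hi
    have h := (exec_forEach nr (σ := st (i + 1)) (P := fun _ => True)
      (f := fun k => grow k false)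
      (h := fun t => (t.written (some (false, false))).moved .right) (hgrow false)
      (fun _ _ => trivial)).seq (Exec.move .input .right)
    refine (?_ : _ = st (i + 1 + 1)) ▸ h.mono (by omega)
    funext k
    by_cases hk : k = .input
    · subst hk
      simp only [Function.update_self, st, if_true, ir, if_false, ITape.moved]
      push_cast
      rfl
    · rw [Function.update_of_ne hk]
      simp only [st, hk, if_false]
      by_cases hr : k ∈ Lr
      · simp only [hr, if_true]
        exact grow_rulerAt (i + 1) false (by simp) _ (by simp)
      · simp only [hr, if_false]

end Prog

end CountLogic

namespace CountLogic

/-! ### The machine on arbitrary inputs -/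

namespace Prog

open PolyBounded

variable {R : Signature}

lemma Tot.pos {K Γ : Type} [DecidableEq K] {S : Stack K Γ} {σ : K → ITape Γ} {c t : ℕ}
    (h : Tot S σ c t) : 0 < c := by
  induction h with
  | nil => exact one_pos
  | halt => exact one_pos
  | fork _ _ h₁ h₂ => omega
  | _ => assumption

/-- The program that reads a structure and then runs `p`. -/
def body (p : Cmd R) : Prog (TapeId R) Cell :=
  seq (forEach (List.finRange R.k) copyRel) (compile p)

/-- The tapes that `body p` uses. -/
noncomputable def bodyTapes (p : Cmd R) : List (TapeId R) := (body p).tapes.toList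

/-- The tapes on input `x`. Those that are not used are taken to be set up already. -/
noncomputable def start (p : Cmd R) (n : ℕ) (x : List Bool) (k : TapeId R) : ITape Cell :=
  if k = .input then ITape.ofList (x.map inputCell)
  else if k ∈ bodyTapes p then ITape.ofList []
  else if isReg k then rulerAt n 0
  else if isTab k then ⟨ruler 1, 0⟩
  else ITape.ofList []

lemma written_blank :
    (ITape.ofList ([] : List Cell)).written (some (true, false)) = ⟨ruler 1, 0⟩ := by
  ext z
  · by_cases hz : z = 0
    · subst hz; simp [ITape.ofList, ITape.written]
    · have : ¬ (0 < z ∧ z < 1) := by omega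
      simp [ITape.ofList, ITape.written, ruler, hz, this]
  · rfl

lemma bit_ruler (n : ℕ) (z : ℤ) : (ruler n z).bit = false := by
  unfold ruler
  split_ifs <;> rfl

/-- The first `n` bits of `x` are zeros, and then there is no further zero. -/
def ZerosLength (x : List Bool) (n : ℕ) : Prop :=
  (∀ i < n, x[i]? = some false) ∧ x[n]? ≠ some false

lemma exists_zerosLength (x : List Bool) : ∃ n ≤ x.length, ZerosLength x n := by
  induction x with
  | nil => exact ⟨0, le_rfl, by simp [ZerosLength]⟩
  | cons b x ih =>
    cases b
    · obtain ⟨n, hn, h₁, h₂⟩ := ih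
      refine ⟨n + 1, by simpa using hn, fun i hi => ?_, by simpa using h₂⟩
      cases i with
      | zero => rfl
      | succ i => simpa using h₁ i (by omega)
    · exact ⟨0, by simp, by simp [ZerosLength]⟩

lemma ofList_cont (x : List Bool) (i : ℕ) :
    (ITape.ofList (x.map inputCell)).cont i = (x[i]?.map inputCell).getD none := by
  have : (default : Cell) = none := rfl
  simp [ITape.ofList, List.getD_eq_getElem?_getD, this]

lemma bit_ofList_cont (x : List Bool) (i : ℕ) :
    ((ITape.ofList (x.map inputCell)).cont i).bit = x.getD i false := by
  rw [ofList_cont, List.getD_eq_getElem?_getD]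
  cases x[i]? <;> rfl

/-- The time on a domain of size `n`. -/
noncomputable def totalCost (p : Cmd R) (n : ℕ) : ℕ :=
  setupCost n (bodyTapes p).length + (copiesCost n (List.finRange R.k) + cmdCost n p + 2)

lemma polyBounded_totalCost (p : Cmd R) : PolyBounded (totalCost p) := by
  have h₁ : PolyBounded fun n => setupCost n (bodyTapes p).length := by
    unfold setupCost
    exact ((((((const _).add (const _)).add (const _)).add ((PolyBounded.id.mul (const _)).add
      (const _))).add (((const _).mul ((PolyBounded.id.mul (const _)).add (const _))).add
      (const _))).add (const _)).add (const _)
  have h₂ : ∀ l : List (Fin R.k), PolyBounded fun n => copiesCost n l := by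
    intro l
    induction l with
    | nil => exact const 1
    | cons i l ih =>
      exact ((((polyBounded_loopsCost 6 _).add (((pow _).mul (const 2)).add (const 1))).add
        (const 1)).add ih).add (const 1)
  exact h₁.add (((h₂ _).add (polyBounded_cmdCost p)).add (const 2))

/-- The bits after the zeros and the following one are the tables of `𝔄`. -/
def Lists {A : Type*} [Fintype A] [LinearOrder A] (x : List Bool) (𝔄 : Interp R A) : Prop :=
  ∀ i u, x.getD (Fintype.card A + 1 + offset (Fintype.card A) (List.finRange R.k) i +
    addr (Fintype.card A) (R.arity i) fun j => rank (u j)) false = true ↔ u ∈ 𝔄.rel i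

/-- A tape with nothing but its mark is the table of the empty relation. This is how the relation
variables start, and it is the state from which `exec_copies` fills the tables of the relation
names. -/
theorem tot_setup {A : Type*} [Fintype A] [LinearOrder A] [Nonempty A] {p : Cmd R}
    (hp : p.Bounded 0) {x : List Bool} (hx : ZerosLength x (Fintype.card A)) {𝔄 : Interp R A}
    (h𝔄 : Lists x 𝔄) {e : FOAssign A} (he : ∀ x, rank (e x) = 0) :
    Tot [setup (bodyTapes p) (body p)] (start p (Fintype.card A) x)
      (p.den 𝔄 e (fun _ => 1) fun _ => ∅) (totalCost p (Fintype.card A)) := by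
  set n := Fintype.card A with hn
  have hpos : 0 < n := Fintype.card_pos
  set inp := (ITape.ofList (x.map inputCell)).cont with hinp
  let σ₁ : TapeId R → ITape Cell := fun k => if k = .input then ⟨inp, (n + 1 : ℕ)⟩ else
    if k ∈ (bodyTapes p).filter isReg then rulerAt n 0 else
    if k ∈ (bodyTapes p).filter isTab then (start p n x k).written (some (true, false))
    else start p n x k
  have hreg : ∀ k, isReg k → σ₁ k = rulerAt n 0 := by
    intro k hk
    have h₁ : k ≠ .input := by rintro rfl; simp [isReg] at hk
    have h₂ : ¬ isTab k := by cases k <;> simp_all [isReg, isTab]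
    by_cases hL : k ∈ bodyTapes p <;>
      simp [σ₁, start, h₁, hk, hL, h₂]
  have htab : ∀ k, isTab k → σ₁ k = ⟨ruler 1, 0⟩ := by
    intro k hk
    have h₁ : k ≠ .input := by rintro rfl; simp [isTab] at hk
    have h₂ : ¬ isReg k := by cases k <;> simp_all [isReg, isTab]
    by_cases hL : k ∈ bodyTapes p <;>
      simp [σ₁, start, h₁, hk, hL, h₂, written_blank]
  obtain ⟨σ₂, hx₂, hs, ht⟩ := exec_copies hpos (List.finRange R.k) (List.nodup_finRange _)
    (σ := σ₁) (inp := inp) (g := ruler 1) (q := n + 1) (fun j => hreg _ rfl) (by simp [σ₁])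
    (marked_ruler 1) (fun i _ => htab _ rfl)
  have hrep : Rep 𝔄 0 e (fun _ => ∅) σ₂ := by
    refine ⟨fun x => ?_, fun x _ => he x, fun j => ?_, ?_, fun X => ?_, fun i => ?_⟩
    · rw [hs _ (by simp) (by simp), he]; exact hreg _ rfl
    · rw [hs _ (by simp) (by simp)]; exact hreg _ rfl
    · rw [hs _ (by simp) (by simp)]; exact hreg _ rfl
    · rw [hs _ (by simp) (by simp), htab _ rfl]
      exact ⟨_, marked_ruler 1, rfl, by simp [bit_ruler]⟩
    · obtain ⟨g', hg', hg, hb⟩ := ht i (List.mem_finRange i)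
      refine ⟨g', hg', hg, fun u => ?_⟩
      rw [hb _ (addr_lt _ fun j => rank_lt _), hinp, bit_ofList_cont, ← h𝔄 i u]
  have hc := tot_compile (S := []) (T := 0) p hp (k := fun _ => 1) (fun _ _ _ => .nil) hrep
  have hbody : Tot [body p] σ₁ (p.den 𝔄 e (fun _ => 1) fun _ => ∅)
      (0 + cmdCost n p + copiesCost n (List.finRange R.k) + 1) := .seq (hx₂ hc)
  have hget : ∀ i : ℕ, inp i = (x[i]?.map inputCell).getD none := ofList_cont x
  refine (tot_setup_of_tot hpos (bodyTapes p) (Finset.nodup_toList _) (σ := start p n x)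
    (inp := inp) (by simp [start, hinp, ITape.ofList]) (fun i hi => ?_) ?_ ?_ (body p)
    hbody).mono ?_
  · rw [hget, hx.1 i hi]; rfl
  · rw [hget]
    have := hx.2
    rcases h : x[n]? with _ | _ | _
    · exact Or.inl rfl
    · exact absurd h this
    · exact Or.inr rfl
  · intro k hk hk'
    have : k ≠ .input := by rintro rfl; simp [isReg] at hk'
    simp [start, this, hk]
  · simp only [totalCost]
    omega

theorem tot_setup_zero (p : Cmd R) {x : List Bool} (hx : ZerosLength x 0) (t : ℕ) :
    Tot [setup (bodyTapes p) (body p)] (start p 0 x) 1 (t + 1) := by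
  have h : (start p 0 x .input).head = (x[0]?.map inputCell).getD none := by
    rw [start, if_pos rfl]
    exact ofList_cont x 0
  refine Tot.ite ?_
  rw [h]
  have := hx.2
  rcases hx0 : x[0]? with _ | _ | _
  · exact .halt
  · exact absurd hx0 this
  · exact .halt

/-- The machine that runs a program on an encoded structure. -/
noncomputable def runner (p : Cmd R) : NTM :=
  machine (setup (bodyTapes p) (body p)) (insert .input (bodyTapes p).toFinset)
    ⟨.input, Finset.mem_insert_self _ _⟩ inputCell
    (fun a b h => by simpa [inputCell] using h) (fun b h => by cases h)

lemma counts_runner (p : Cmd R) {x : List Bool} {n c t : ℕ}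
    (h : Tot [setup (bodyTapes p) (body p)] (start p n x) c t) :
    ((runner p).init x).Counts c t := by
  refine counts_init h (tapes_setup _ _ ?_) (if_pos rfl) fun k hk hk' => ?_
  · rw [bodyTapes, Finset.toList_toFinset]
  · have : k ∈ bodyTapes p := by
      rcases Finset.mem_insert.1 hk with h | h
      · exact absurd h hk'
      · exact List.mem_toFinset.1 h
    simp [start, this, show k ≠ .input from hk']

/-- Any string with `n > 0` leading zeros is treated as a structure on `Fin n`: the truth values are
read off at the positions used by the encoding, with `false` beyond the end of the string. Without
leading zeros the machine halts at once. So there is nothing to be checked about the input. -/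
lemma exists_tot (p : Cmd R) (hp : p.Bounded 0) {x : List Bool} {n : ℕ} (hx : ZerosLength x n) :
    ∃ c, Tot [setup (bodyTapes p) (body p)] (start p n x) c (totalCost p n + 1) := by
  rcases Nat.eq_zero_or_pos n with rfl | hn
  · exact ⟨1, tot_setup_zero p hx _⟩
  · have : NeZero n := ⟨hn.ne'⟩
    let 𝔄 : Interp R (Fin n) := ⟨fun i => {u | x.getD (Fintype.card (Fin n) + 1 +
      offset (Fintype.card (Fin n)) (List.finRange R.k) i +
      addr (Fintype.card (Fin n)) (R.arity i) fun j => rank (u j)) false = true}⟩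
    have he : rank (0 : Fin n) = 0 := by
      have h0 : 0 < (elems (Fin n)).length := by rw [length_elems]; simpa using hn
      have h1 : rank (0 : Fin n) ≤ rank (elems (Fin n))[0] := rank_le_rank.2 (Fin.zero_le _)
      rw [rank_getElem] at h1
      omega
    have h := tot_setup (A := Fin n) (𝔄 := 𝔄) hp (x := x) (by simpa using hx)
      (fun i u => Iff.rfl) (e := fun _ => 0) fun _ => he
    rw [Fintype.card_fin] at h
    exact ⟨_, h.mono (by omega)⟩

theorem runner_polyTime (p : Cmd R) (hp : p.Bounded 0) : (runner p).PolyTime := by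
  obtain ⟨P, hP⟩ := (polyBounded_totalCost p).add (const 1)
  refine ⟨P, fun x l hl => ?_⟩
  obtain ⟨n, hn, hx⟩ := exists_zerosLength x
  obtain ⟨c, hc⟩ := exists_tot p hp hx
  exact ((counts_runner p hc).2.2 l hl).trans ((hP n).trans (polynomial_eval_mono P hn))

theorem runner_total_pos (p : Cmd R) (hp : p.Bounded 0) (x : List Bool) :
    0 < (runner p).total x := by
  obtain ⟨n, hn, hx⟩ := exists_zerosLength x
  obtain ⟨c, hc⟩ := exists_tot p hp hx
  exact hc.pos.trans_eq (counts_runner p hc).2.1.symm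

/-! ### The encoding of a structure -/

section Encoding

variable {A : Type*}

lemma length_tuples (l : List A) (m : ℕ) : (tuples l m).length = l.length ^ m := by
  induction m with
  | zero => rfl
  | succ m ih => simp [tuples, List.length_flatMap, ih, pow_succ, mul_comm]

lemma getElem?_flatMap_const {α β : Type*} (f : α → List β) (n : ℕ) (l : List α)
    (hf : ∀ a ∈ l, (f a).length = n) (i j : ℕ) (hi : i < l.length) (hj : j < n) :
    (l.flatMap f)[i * n + j]? = (f l[i])[j]? := by
  induction l generalizing i with
  | nil => simp at hi
  | cons a l ih =>
    have ha := hf a List.mem_cons_self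
    rw [List.flatMap_cons]
    cases i with
    | zero =>
      rw [List.getElem?_append_left (by omega)]
      simp
    | succ i =>
      rw [List.getElem?_append_right (by rw [ha]; nlinarith)]
      have e : (i + 1) * n + j - (f a).length = i * n + j := by rw [ha, Nat.add_mul]; omega
      rw [e, ih (fun b hb => hf b (List.mem_cons_of_mem _ hb)) i (by simpa using hi)]
      simp

variable [Fintype A] [LinearOrder A]

lemma getElem?_tuples (m : ℕ) (u : Fin m → A) :
    (tuples (elems A) m)[addr (Fintype.card A) m fun j => rank (u j)]? = some u := by
  induction m with
  | zero =>
    simp only [tuples, addr, List.getElem?_cons_zero, Option.some.injEq]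
    exact Subsingleton.elim _ _
  | succ m ih =>
    have hr : rank (u 0) < (elems A).length := by rw [length_elems]; exact rank_lt _
    rw [tuples, addr, getElem?_flatMap_const _ (Fintype.card A ^ m) _ ?_ _ _ hr ?_]
    · rw [List.getElem?_map]
      have := ih (Fin.tail u)
      rw [show (Fin.tail fun j => rank (u j)) = fun j => rank (Fin.tail u j) from rfl, this,
        getElem_rank]
      simp
    · intro a _
      rw [List.length_map, length_tuples, length_elems]
    · exact addr_lt _ fun j => rank_lt _

lemma getElem?_flatMap_offset {β : Type*} (n : ℕ) (f : Fin R.k → List β)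
    (hf : ∀ i, (f i).length = n ^ R.arity i) (l : List (Fin R.k)) {i : Fin R.k} (hi : i ∈ l)
    {a : ℕ} (ha : a < n ^ R.arity i) : (l.flatMap f)[offset n l i + a]? = (f i)[a]? := by
  induction l with
  | nil => simp at hi
  | cons j l ih =>
    rw [List.flatMap_cons, offset]
    split_ifs with h
    · subst h
      rw [zero_add, List.getElem?_append_left (by rw [hf]; exact ha)]
    · rw [List.getElem?_append_right (by rw [hf]; omega), hf, add_assoc, Nat.add_sub_cancel_left]
      exact ih (List.mem_of_ne_of_mem h hi)

lemma zerosLength_enc (𝔄 : Interp R A) : ZerosLength (enc 𝔄) (Fintype.card A) := by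
  refine ⟨fun i hi => ?_, ?_⟩
  · rw [enc, List.getElem?_append_left (by simpa using hi)]
    simp [hi]
  · rw [enc, List.getElem?_append_right (by simp)]
    simp

lemma lists_enc (𝔄 : Interp R A) : Lists (enc 𝔄) 𝔄 := by
  classical
  intro i u
  rw [enc, List.getD_eq_getElem?_getD, add_assoc, add_assoc,
    List.getElem?_append_right (by simp), List.length_replicate, Nat.add_sub_cancel_left,
    add_comm 1, List.getElem?_cons_succ, getElem?_flatMap_offset _ _ ?_ _ (List.mem_finRange i)
    (addr_lt _ fun j => rank_lt _), List.getElem?_map]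
  · have := getElem?_tuples (R.arity i) u
    rw [elems] at this
    rw [this]
    simp
  · intro i
    rw [List.length_map, length_tuples]
    congr 1
    exact length_elems A

end Encoding

theorem runner_total {A : Type*} [Fintype A] [LinearOrder A] [Nonempty A] (p : Cmd R)
    (hp : p.Bounded 0) (𝔄 : Interp R A) {e : FOAssign A} (he : ∀ x, rank (e x) = 0) :
    (runner p).total (enc 𝔄) = p.den 𝔄 e (fun _ => 1) fun _ => ∅ :=
  (counts_runner p (tot_setup hp (zerosLength_enc 𝔄) (lists_enc 𝔄) he)).2.1

end Prog

end CountLogic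

namespace CountLogic

variable {R : Signature} {A : Type*} [Fintype A] [LinearOrder A] {𝔄 : Interp R A}

/-! ### Deterministic programs and nested loops -/

/-- The assignments that differ from `e` on `ls` only, in lexicographic order. -/
def envs (e : FOAssign A) : List FOVar → List (FOAssign A)
  | [] => [e]
  | x :: ls => (elems A).flatMap fun a => envs (Function.update e x a) ls

lemma mem_envs {e e' : FOAssign A} {ls : List FOVar} :
    e' ∈ envs e ls ↔ ∀ x ∉ ls, e' x = e x := by
  induction ls generalizing e with
  | nil => simp [envs, funext_iff]
  | cons x ls ih =>
    simp only [envs, List.mem_flatMap, ih, List.mem_cons, not_or]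
    constructor
    · rintro ⟨a, -, h⟩ y ⟨hy, hy'⟩
      rw [h y hy', Function.update_of_ne hy]
    · intro h
      refine ⟨e' x, mem_elems _, fun y hy => ?_⟩
      by_cases hyx : y = x
      · subst hyx; simp
      · rw [Function.update_of_ne hyx, h y ⟨hyx, hy⟩]

lemma length_envs (e : FOAssign A) (ls : List FOVar) :
    (envs e ls).length = Fintype.card A ^ ls.length := by
  induction ls generalizing e with
  | nil => rfl
  | cons x ls ih => simp [envs, List.length_flatMap, ih, length_elems, pow_succ, mul_comm]

lemma envs_append (e : FOAssign A) (ls ms : List FOVar) :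
    envs e (ls ++ ms) = (envs e ls).flatMap fun e' => envs e' ms := by
  induction ls generalizing e with
  | nil => simp [envs]
  | cons x ls ih => simp [envs, ih, List.flatMap_assoc]

namespace Cmd

/-- Nested loops. -/
def forAll (ls : List FOVar) (p : Cmd R) : Cmd R := ls.foldr each p

/-- Programs one after the other. -/
def seqs (l : List (Cmd R)) : Cmd R := l.foldr seq nop

lemma den_forAll (ls : List FOVar) (p : Cmd R) (e : FOAssign A) (k : SOAssign A → ℕ) :
    (forAll ls p).den 𝔄 e k = (envs e ls).foldr (fun e' k' => p.den 𝔄 e' k') k := by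
  induction ls generalizing e k with
  | nil => rfl
  | cons x ls ih =>
    have h : ∀ l : List A, l.foldr (fun a k' => (forAll ls p).den 𝔄 (Function.update e x a) k') k =
        (l.flatMap fun a => envs (Function.update e x a) ls).foldr
          (fun e' k' => p.den 𝔄 e' k') k := by
      intro l
      induction l with
      | nil => rfl
      | cons a l ihl => rw [List.foldr_cons, ihl, ih, List.flatMap_cons, List.foldr_append]
    exact h _

/-- The program ends deterministically, with relations that satisfy `Q`. -/
def DetTo (𝔄 : Interp R A) (p : Cmd R) (e : FOAssign A) (s : SOAssign A)
    (Q : SOAssign A → Prop) : Prop :=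
  ∃ s', (∀ k, p.den 𝔄 e k s = k s') ∧ Q s'

namespace DetTo

variable {p q : Cmd R} {e : FOAssign A} {s : SOAssign A} {Q Q' : SOAssign A → Prop}

lemma imp (h : DetTo 𝔄 p e s Q) (hQ : ∀ s', Q s' → Q' s') : DetTo 𝔄 p e s Q' :=
  Exists.imp (fun _ h' => ⟨h'.1, hQ _ h'.2⟩) h

protected lemma nop (h : Q s) : DetTo 𝔄 nop e s Q := ⟨s, fun _ => rfl, h⟩

protected lemma seq (hp : DetTo 𝔄 p e s Q) (hq : ∀ s', Q s' → DetTo 𝔄 q e s' Q') :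
    DetTo 𝔄 (p.seq q) e s Q' := by
  obtain ⟨s₁, h₁, hs₁⟩ := hp
  obtain ⟨s₂, h₂, hs₂⟩ := hq s₁ hs₁
  exact ⟨s₂, fun k => by rw [den, h₁, h₂], hs₂⟩

protected lemma ite {φ : SO R} (hp : φ.Sat 𝔄 e s → DetTo 𝔄 p e s Q)
    (hq : ¬ φ.Sat 𝔄 e s → DetTo 𝔄 q e s Q) : DetTo 𝔄 (ite φ p q) e s Q := by
  by_cases h : φ.Sat 𝔄 e s
  · obtain ⟨s', h', hs'⟩ := hp h
    exact ⟨s', fun k => by rw [den, if_pos h, h'], hs'⟩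
  · obtain ⟨s', h', hs'⟩ := hq h
    exact ⟨s', fun k => by rw [den, if_neg h, h'], hs'⟩

protected lemma put {X : SOVar} {u : Fin X.arity → FOVar} {b : Bool}
    (h : ∀ S : Finset (Fin X.arity → A),
      (∀ t, t ∈ S ↔ if t = (fun j => e (u j)) then b = true else t ∈ s X) →
      Q (Function.update s X S)) : DetTo 𝔄 (put X u b) e s Q := by
  classical
  refine ⟨_, fun k => ?_, h (if b then insert (fun j => e (u j)) (s X) else
    (s X).erase fun j => e (u j)) fun t => ?_⟩
  · rw [den]
  · by_cases ht : t = fun j => e (u j)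
    · cases b <;> simp [ht]
    · cases b <;> simp [ht]

/-- The invariant `I` is indexed by the list of the assignments treated so far; the loop ends with
the full list. -/
protected lemma forAll {ls : List FOVar} {I : List (FOAssign A) → SOAssign A → Prop}
    (h : ∀ l, ∀ e' ∈ envs e ls, ∀ s, I l s → DetTo 𝔄 p e' s (I (l ++ [e'])))
    (h0 : I [] s) : DetTo 𝔄 (forAll ls p) e s (I (envs e ls)) := by
  suffices H : ∀ l' l : List (FOAssign A), (∀ e' ∈ l', e' ∈ envs e ls) → ∀ s, I l s →
      ∃ s', (∀ k, l'.foldr (fun e' k' => p.den 𝔄 e' k') k s = k s') ∧ I (l ++ l') s' by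
    obtain ⟨s', h₁, h₂⟩ := H (envs e ls) [] (fun _ h => h) s h0
    exact ⟨s', fun k => by rw [den_forAll, h₁], h₂⟩
  intro l'
  induction l' with
  | nil => exact fun l _ s hs => ⟨s, fun _ => rfl, by simpa using hs⟩
  | cons e' l' ih =>
    intro l hl s hs
    obtain ⟨s₁, h₁, hs₁⟩ := h l e' (hl e' List.mem_cons_self) s hs
    obtain ⟨s₂, h₂, hs₂⟩ := ih (l ++ [e']) (fun e hh => hl e (List.mem_cons_of_mem _ hh)) s₁ hs₁
    exact ⟨s₂, fun k => by rw [List.foldr_cons, h₁, h₂], by simpa using hs₂⟩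

protected lemma seqs {α : Type*} {l : List α} {f : α → Cmd R} {I : List α → SOAssign A → Prop}
    (h : ∀ l', ∀ a ∈ l, ∀ s, I l' s → DetTo 𝔄 (f a) e s (I (l' ++ [a])))
    (h0 : I [] s) : DetTo 𝔄 (seqs (l.map f)) e s (I l) := by
  suffices H : ∀ l₁ l₂ : List α, (∀ a ∈ l₁, a ∈ l) → ∀ s, I l₂ s →
      DetTo 𝔄 (Cmd.seqs (l₁.map f)) e s (I (l₂ ++ l₁)) from H l [] (fun _ h => h) s h0
  intro l₁
  induction l₁ with
  | nil => exact fun l _ s hs => DetTo.nop (by simpa using hs)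
  | cons a l₁ ih =>
    intro l₂ hl s hs
    refine (h l₂ a (hl a List.mem_cons_self) s hs).seq fun s₁ hs₁ => ?_
    have := ih (l₂ ++ [a]) (fun e hh => hl e (List.mem_cons_of_mem _ hh)) s₁ hs₁
    rwa [List.append_assoc] at this

end DetTo

end Cmd

/-- The tuple of the values of consecutive variables from `b` on. -/
def tup (b m : ℕ) (j : Fin m) : FOVar := b + j

lemma exists_env (e : FOAssign A) (b m : ℕ) (t : Fin m → A) :
    ∃ e' ∈ envs e (List.range' b m), (fun j => e' (tup b m j)) = t := by
  refine ⟨fun x : ℕ => if h : b ≤ x ∧ x < b + m then t ⟨x - b, by obtain ⟨h₁, h₂⟩ := h; omega⟩ else e x, ?_, ?_⟩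
  · rw [mem_envs]
    intro x hx
    rw [List.mem_range'_1] at hx
    simp [hx]
  · funext j
    have : b ≤ b + (j : ℕ) ∧ b + (j : ℕ) < b + m := by omega
    simp [tup]

/-! ### Sums over relations -/

/-- The sum of the values of `F` over all choices of the relations in the list. -/
noncomputable def sumSO : List SOVar → (SOAssign A → ℕ) → SOAssign A → ℕ
  | [], F, s => F s
  | X :: l, F, s => ∑ B : Finset (Fin X.arity → A), sumSO l F (Function.update s X B)

lemma sumSO_add (l : List SOVar) (F G : SOAssign A → ℕ) (s : SOAssign A) :
    sumSO l (fun S => F S + G S) s = sumSO l F s + sumSO l G s := by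
  induction l generalizing s with
  | nil => rfl
  | cons X l ih => simp only [sumSO, ih, Finset.sum_add_distrib]

lemma sumSO_congr (l : List SOVar) {F G : SOAssign A → ℕ} {s : SOAssign A}
    (h : ∀ S, (∀ Y ∉ l, S Y = s Y) → F S = G S) : sumSO l F s = sumSO l G s := by
  induction l generalizing s with
  | nil => exact h s fun _ _ => rfl
  | cons X l ih =>
    refine Finset.sum_congr rfl fun B _ => ih fun S hS => h S fun Y hY => ?_
    rw [List.mem_cons, not_or] at hY
    rw [hS Y hY.2, Function.update_of_ne hY.1]

lemma sumSO_ne_zero (l : List SOVar) (F : SOAssign A → ℕ) (s : SOAssign A) :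
    sumSO l F s ≠ 0 ↔ ∃ S, (∀ Y ∉ l, S Y = s Y) ∧ F S ≠ 0 := by
  induction l generalizing s with
  | nil =>
    simp only [sumSO, List.not_mem_nil, not_false_eq_true, forall_const]
    constructor
    · exact fun h => ⟨s, fun _ => rfl, h⟩
    · rintro ⟨S, hS, h⟩
      rwa [← funext hS]
  | cons X l ih =>
    rw [sumSO, Ne, Finset.sum_eq_zero_iff]
    push Not
    simp only [Finset.mem_univ, true_and, ih]
    constructor
    · rintro ⟨B, S, hS, h⟩
      refine ⟨S, fun Y hY => ?_, h⟩
      rw [List.mem_cons, not_or] at hY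
      rw [hS Y hY.2, Function.update_of_ne hY.1]
    · rintro ⟨S, hS, h⟩
      refine ⟨S X, S, fun Y hY => ?_, h⟩
      by_cases hYX : Y = X
      · subst hYX; simp
      · rw [Function.update_of_ne hYX, hS Y (by simp [hYX, hY])]

/-- If `l` has no repetitions, then different summands belong to different relations, and only one
of them can be nonzero. A repeated variable would count the same relations several times. -/
lemma sumSO_le_one {l : List SOVar} (hl : l.Nodup) {F : SOAssign A → ℕ} {s : SOAssign A}
    (hF : ∀ S, F S ≤ 1)
    (h : ∀ S S', (∀ Y ∉ l, S Y = s Y) → (∀ Y ∉ l, S' Y = s Y) → F S ≠ 0 → F S' ≠ 0 → S = S') :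
    sumSO l F s ≤ 1 := by
  induction l generalizing s with
  | nil => exact hF s
  | cons X l ih =>
    rw [List.nodup_cons] at hl
    have hY : ∀ {S : SOAssign A} {B}, (∀ Y ∉ l, S Y = Function.update s X B Y) →
        ∀ Y ∉ X :: l, S Y = s Y := fun hS Y hY => by
      rw [List.mem_cons, not_or] at hY
      rw [hS Y hY.2, Function.update_of_ne hY.1]
    have h1 : ∀ B, sumSO l F (Function.update s X B) ≤ 1 := fun B =>
      ih hl.2 fun S S' hS hS' => h S S' (hY hS) (hY hS')
    rw [sumSO]
    by_cases h0 : ∃ B, sumSO l F (Function.update s X B) ≠ 0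
    · obtain ⟨B, hB⟩ := h0
      rw [Finset.sum_eq_single B]
      · exact h1 B
      · intro B' _ hne
        by_contra hB'
        obtain ⟨S, hS, hFS⟩ := (sumSO_ne_zero _ _ _).1 hB
        obtain ⟨S', hS', hFS'⟩ := (sumSO_ne_zero _ _ _).1 hB'
        have e := h S S' (hY hS) (hY hS') hFS hFS'
        have e₁ := hS X hl.1
        have e₂ := hS' X hl.1
        rw [Function.update_self] at e₁ e₂
        exact hne (by rw [← e₁, ← e₂, e])
      · simp
    · push Not at h0
      rw [Finset.sum_eq_zero fun B _ => h0 B]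
      exact zero_le_one

end CountLogic

namespace CountLogic

variable {R : Signature}

/-! ### Horn clauses and their dependence on the relations -/

namespace SO

lemma sat_congr {A : Type*} [LinearOrder A] {𝔄 : Interp R A} (φ : SO R) {e e' : FOAssign A}
    {s s' : SOAssign A} (he : ∀ x ∈ φ.freeFO, e x = e' x) (hs : ∀ X ∈ φ.freeSO, s X = s' X) :
    φ.Sat 𝔄 e s ↔ φ.Sat 𝔄 e' s' := by
  induction φ generalizing e e' s s' with
  | eq x y => simp only [Sat, he x (by simp [freeFO]), he y (by simp [freeFO])]
  | lt x y => simp only [Sat, he x (by simp [freeFO]), he y (by simp [freeFO])]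
  | rel i u => simp only [Sat, fun j => he (u j) (by simp [freeFO])]
  | top => rfl
  | app X u => simp only [Sat, fun j => he (u j) (by simp [freeFO]), hs X (by simp [freeSO])]
  | neg φ ih => exact not_congr (ih he hs)
  | or φ ψ ih₁ ih₂ =>
    exact or_congr (ih₁ (fun x hx => he x (.inl hx)) fun X hX => hs X (.inl hX))
      (ih₂ (fun x hx => he x (.inr hx)) fun X hX => hs X (.inr hX))
  | exFO x φ ih =>
    refine exists_congr fun a => ih (fun y hy => ?_) hs
    by_cases hyx : y = x
    · subst hyx; simp
    · rw [Function.update_of_ne hyx, Function.update_of_ne hyx, he y ⟨hy, hyx⟩]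
  | exSO X φ ih =>
    refine exists_congr fun B => ih he fun Y hY => ?_
    by_cases hYX : Y = X
    · subst hYX; simp
    · rw [Function.update_of_ne hYX, Function.update_of_ne hYX, hs Y ⟨hY, hYX⟩]

lemma IsFO.freeSO {φ : SO R} (h : φ.IsFO) : φ.freeSO = ∅ := by
  induction h <;> simp_all [SO.freeSO]

lemma IsNegLit.anti {A : Type*} [LinearOrder A] {𝔄 : Interp R A} {φ : SO R} (h : φ.IsNegLit)
    {e : FOAssign A} {s s' : SOAssign A} (hs : ∀ X, s X ⊆ s' X) (hφ : φ.Sat 𝔄 e s') :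
    φ.Sat 𝔄 e s := by
  induction h generalizing e with
  | app X u => exact fun h => hφ (hs X h)
  | exFO x _ ih => exact hφ.imp fun a ha => ih ha

/-- Without positive literals, the truth of a disjunction is preserved if the relations shrink. -/
lemma IsLitDisj.anti {A : Type*} [LinearOrder A] {𝔄 : Interp R A} {φ : SO R}
    (h : φ.IsLitDisj 0) {e : FOAssign A} {s s' : SOAssign A} (hs : ∀ X, s X ⊆ s' X)
    (hφ : φ.Sat 𝔄 e s') : φ.Sat 𝔄 e s := by
  suffices H : ∀ p, φ.IsLitDisj p → p = 0 → φ.Sat 𝔄 e s from H 0 h rfl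
  intro p hp
  clear h
  induction hp with
  | pos => exact fun h => absurd h one_ne_zero
  | negLit h => exact fun _ => h.anti hs hφ
  | fo h => exact fun _ => (sat_congr _ (fun _ _ => rfl) (by simp [h.freeSO])).1 hφ
  | or _ _ ih₁ ih₂ =>
    intro h
    rw [Nat.add_eq_zero_iff] at h
    exact hφ.imp (fun h' => ih₁ h' h.1) fun h' => ih₂ h' h.2

end SO

/-- A Horn clause `∀ z̄ (body ∨ hd args)`, in which `z̄` are consecutive variables. -/
structure Clause (R : Signature) where
  nz : ℕ
  body : SO R
  hd : SOVar
  args : Fin hd.arity → FOVar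

/-- The matrix of the clause is true. -/
def Clause.Holds {A : Type*} [LinearOrder A] (𝔄 : Interp R A) (cl : Clause R) (e : FOAssign A)
    (S : SOAssign A) : Prop :=
  cl.body.Sat 𝔄 e S ∨ (fun j => e (cl.args j)) ∈ S cl.hd

/-- The clause does not use the variables in `H`, and its head is among the given relations. -/
structure Clause.Ok (H : Set FOVar) (arrs : List SOVar) (cl : Clause R) : Prop where
  lit : cl.body.IsLitDisj 0
  free : ∀ x ∈ cl.body.freeFO, x ∉ H
  args : ∀ j, cl.args j ∉ H
  mem : cl.hd ∈ arrs

section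

variable {A : Type*} [Fintype A] [LinearOrder A] {𝔄 : Interp R A}

/-- All clauses are true. -/
def Full (𝔄 : Interp R A) (z : ℕ) (cls : List (Clause R)) (e : FOAssign A) (S : SOAssign A) :
    Prop :=
  ∀ cl ∈ cls, ∀ e' ∈ envs e (List.range' z cl.nz), cl.Holds 𝔄 e' S

lemma envs_agree {H : Set FOVar} {e₁ e₂ : FOAssign A} (h : ∀ x ∉ H, e₁ x = e₂ x) {ls : List FOVar}
    {e' : FOAssign A} (he' : e' ∈ envs e₁ ls) : ∃ e'' ∈ envs e₂ ls, ∀ x ∉ H, e' x = e'' x := by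
  classical
  refine ⟨fun x => if x ∈ ls then e' x else e₂ x, mem_envs.2 fun x hx => by simp [hx],
    fun x hx => ?_⟩
  by_cases hxl : x ∈ ls
  · simp [hxl]
  · simp [hxl, mem_envs.1 he' x hxl, h x hx]

lemma Clause.Ok.holds_congr {H : Set FOVar} {arrs : List SOVar} {cl : Clause R}
    (hcl : cl.Ok H arrs) {e₁ e₂ : FOAssign A} (h : ∀ x ∉ H, e₁ x = e₂ x) {S : SOAssign A} :
    cl.Holds 𝔄 e₁ S ↔ cl.Holds 𝔄 e₂ S := by
  refine or_congr (SO.sat_congr _ (fun x hx => h x (hcl.free x hx)) fun _ _ => rfl) ?_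
  simp only [fun j => h _ (hcl.args j)]

variable {z c : ℕ} {cls : List (Clause R)} {arrs : List SOVar} {H : Set FOVar}

/-- The programs loop over tuples with variables from `H`. This lemma says that such loops do not
disturb the clauses. -/
lemma Full.congr (hcls : ∀ cl ∈ cls, cl.Ok H arrs) {e₁ e₂ : FOAssign A}
    (h : ∀ x ∉ H, e₁ x = e₂ x) {S : SOAssign A} (hf : Full 𝔄 z cls e₁ S) : Full 𝔄 z cls e₂ S := by
  intro cl hcl e' he'
  obtain ⟨e'', he'', h''⟩ := envs_agree (fun x hx => (h x hx).symm) he'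
  exact ((hcls cl hcl).holds_congr h'').2 (hf cl hcl e'' he'')

end

/-! ### Least models -/

namespace Cmd

/-- Make a relation empty. -/
def clear (c : ℕ) (X : SOVar) : Cmd R :=
  forAll (List.range' c X.arity) (put X (tup c X.arity) false)

/-- Apply every instance of every clause. -/
def propagate (z : ℕ) (cls : List (Clause R)) : Cmd R :=
  seqs (cls.map fun cl => forAll (List.range' z cl.nz) (ite cl.body nop (put cl.hd cl.args true)))

/-- Compute the least model. -/
def model (c z : ℕ) (cls : List (Clause R)) (arrs : List SOVar) : Cmd R :=
  seq (seqs (arrs.map (clear c))) (seq (propagate z cls)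
    (seqs (arrs.map fun X => forAll (List.range' c X.arity) (propagate z cls))))

variable {A : Type*} [Fintype A] [LinearOrder A] {𝔄 : Interp R A} {e : FOAssign A}
  {s : SOAssign A}

lemma detTo_clear (c : ℕ) (X : SOVar) :
    DetTo 𝔄 (clear c X) e s fun s' => s' X = ∅ ∧ ∀ Y ≠ X, s' Y = s Y := by
  refine (DetTo.forAll (I := fun l s' => (∀ e' ∈ l, (fun j => e' (tup c X.arity j)) ∉ s' X) ∧
    ∀ Y ≠ X, s' Y = s Y) ?_ (by simp)).imp ?_
  · rintro l e' - s₁ ⟨h₁, h₂⟩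
    refine DetTo.put fun S hS => ⟨?_, fun Y hY => by rw [Function.update_of_ne hY, h₂ Y hY]⟩
    intro e'' he''
    rw [Function.update_self, hS]
    split_ifs with h
    · simp
    · rw [List.mem_append, List.mem_singleton] at he''
      rcases he'' with he'' | rfl
      · exact h₁ e'' he''
      · exact absurd rfl h
  · rintro s' ⟨h₁, h₂⟩
    refine ⟨Finset.eq_empty_of_forall_notMem fun t ht => ?_, h₂⟩
    obtain ⟨e', he', rfl⟩ := exists_env e c X.arity t
    exact h₁ e' he' ht

lemma detTo_clears (c : ℕ) (l : List SOVar) :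
    DetTo 𝔄 (seqs (l.map (clear c))) e s fun s' => (∀ X ∈ l, s' X = ∅) ∧ ∀ Y ∉ l, s' Y = s Y := by
  refine DetTo.seqs (I := fun l' s' => (∀ X ∈ l', s' X = ∅) ∧ ∀ Y ∉ l, s' Y = s Y) ?_ (by simp)
  rintro l' X hX s₁ ⟨h₁, h₂⟩
  refine (detTo_clear c X).imp fun s' ⟨h₃, h₄⟩ => ⟨fun Y hY => ?_, fun Y hY => ?_⟩
  · by_cases hYX : Y = X
    · rw [hYX, h₃]
    · rw [h₄ Y hYX, h₁ Y (by simpa [hYX] using hY)]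
  · rw [h₄ Y (by rintro rfl; exact hY hX), h₂ Y hY]

variable {z c : ℕ} {cls : List (Clause R)} {arrs : List SOVar} {H : Set FOVar}

/-- The relations `s` were obtained from `s₀` by the application of clauses. -/
structure Derived (𝔄 : Interp R A) (z : ℕ) (cls : List (Clause R)) (arrs : List SOVar)
    (e : FOAssign A) (s₀ s : SOAssign A) : Prop where
  frame : ∀ Y ∉ arrs, s Y = s₀ Y
  le : ∀ Y, s₀ Y ⊆ s Y
  sound : ∀ S, Full 𝔄 z cls e S → (∀ Y, s₀ Y ⊆ S Y) → ∀ Y, s Y ⊆ S Y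

lemma Derived.refl (s : SOAssign A) : Derived 𝔄 z cls arrs e s s :=
  ⟨fun _ _ => rfl, fun _ => subset_rfl, fun _ _ h => h⟩

lemma Derived.trans {s₁ s₂ s₃ : SOAssign A} (h₁ : Derived 𝔄 z cls arrs e s₁ s₂)
    (h₂ : Derived 𝔄 z cls arrs e s₂ s₃) : Derived 𝔄 z cls arrs e s₁ s₃ :=
  ⟨fun Y hY => (h₂.frame Y hY).trans (h₁.frame Y hY), fun Y => (h₁.le Y).trans (h₂.le Y),
    fun S hS h => h₂.sound S hS (h₁.sound S hS h)⟩

/-- Soundness rests on antitonicity: if the body of an instance fails for the current relations, it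
fails for every larger model `S`, which must then contain the head. If a round changes nothing, then
each instance was found true, or its head was added and had been there before. -/
lemma detTo_propagate (hcls : ∀ cl ∈ cls, cl.Ok H arrs) :
    DetTo 𝔄 (propagate z cls) e s fun s' =>
      Derived 𝔄 z cls arrs e s s' ∧ (s' = s → Full 𝔄 z cls e s) := by
  refine DetTo.seqs (I := fun l s' => Derived 𝔄 z cls arrs e s s' ∧
    (s' = s → Full 𝔄 z l e s)) ?_ ⟨.refl s, fun _ => by simp [Full]⟩
  rintro l cl hcl s₁ ⟨hd, hf⟩
  have hJ := DetTo.forAll (𝔄 := 𝔄) (p := ite cl.body nop (put cl.hd cl.args true)) (e := e) (s := s₁)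
    (ls := List.range' z cl.nz) (I := fun l' s' => Derived 𝔄 z cls arrs e s s' ∧
    (s' = s → Full 𝔄 z l e s) ∧ (s' = s → ∀ e' ∈ l', cl.Holds 𝔄 e' s)) ?_
    ⟨hd, hf, fun _ => by simp⟩
  · refine hJ.imp fun s' ⟨h₁, h₂, h₃⟩ => ⟨h₁, fun h cl' hcl' => ?_⟩
    rw [List.mem_append, List.mem_singleton] at hcl'
    rcases hcl' with hcl' | rfl
    · exact h₂ h cl' hcl'
    · exact h₃ h
  · rintro l' e' he' s₂ ⟨h₁, h₂, h₃⟩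
    refine DetTo.ite (fun hb => DetTo.nop ⟨h₁, h₂, fun h e'' he'' => ?_⟩) fun hb =>
      DetTo.put fun S hS => ?_
    · rw [List.mem_append, List.mem_singleton] at he''
      rcases he'' with he'' | rfl
      · exact h₃ h e'' he''
      · exact .inl (h ▸ hb)
    · have hle : ∀ Y, s₂ Y ⊆ Function.update s₂ cl.hd S Y := by
        intro Y t ht
        by_cases hY : Y = cl.hd
        · subst hY
          rw [Function.update_self, hS]
          split_ifs <;> simp [ht]
        · rwa [Function.update_of_ne hY]
      -- The relations only grow within a round. If the final ones equal `s`, so do all intermediate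
      -- ones.
      have heq : Function.update s₂ cl.hd S = s → s₂ = s := fun h =>
        funext fun Y => (h ▸ hle Y).antisymm (h₁.le Y)
      refine ⟨⟨fun Y hY => ?_, fun Y => (h₁.le Y).trans (hle Y), fun S' hS' hs' Y t ht => ?_⟩,
        fun h => h₂ (heq h), fun h e'' he'' => ?_⟩
      · rw [Function.update_of_ne (by rintro rfl; exact hY (hcls cl hcl).mem), h₁.frame Y hY]
      · have hle' := h₁.sound S' hS' hs'
        by_cases hY : Y = cl.hd
        · subst hY
          rw [Function.update_self, hS] at ht
          split_ifs at ht with htu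
          · rw [htu]
            exact (hS' cl hcl e' he').resolve_left fun hb' => hb ((hcls cl hcl).lit.anti hle' hb')
          · exact hle' _ ht
        · rw [Function.update_of_ne hY] at ht
          exact hle' Y ht
      · rw [List.mem_append, List.mem_singleton] at he''
        rcases he'' with he'' | rfl
        · exact h₃ (heq h) e'' he''
        · refine .inr ?_
          rw [← h, Function.update_self, hS]
          simp

/-- The number of tuples in the relations. -/
def size (arrs : List SOVar) (s : SOAssign A) : ℕ := (arrs.map fun X => (s X).card).sum

/-- Together with `size_le` this bounds the number of rounds that change something. -/
lemma size_lt {s s' : SOAssign A} (h : Derived 𝔄 z cls arrs e s s') (hne : s' ≠ s) :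
    size arrs s < size arrs s' := by
  obtain ⟨X, hX⟩ : ∃ X, s' X ≠ s X := by
    by_contra! hh
    exact hne (funext hh)
  have hXa : X ∈ arrs := by
    by_contra hh
    exact hX (h.frame X hh)
  refine List.sum_lt_sum _ _ (fun Y _ => Finset.card_le_card (h.le Y)) ⟨X, hXa, ?_⟩
  exact Finset.card_lt_card ((h.le X).ssubset_of_ne hX.symm)

lemma size_le (arrs : List SOVar) (s : SOAssign A) :
    size arrs s ≤ (arrs.map fun X => Fintype.card A ^ X.arity).sum := by
  refine List.sum_le_sum fun X _ => ?_
  exact (Finset.card_le_univ _).trans_eq (by simp)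

/-- The least model is computed. -/
lemma detTo_model (hcls : ∀ cl ∈ cls, cl.Ok H arrs) {m : ℕ} (hm : ∀ X ∈ arrs, X.arity ≤ m)
    (hH : ∀ x, c ≤ x → x < c + m → x ∈ H) :
    DetTo 𝔄 (model c z cls arrs) e s fun s' => (∀ Y ∉ arrs, s' Y = s Y) ∧ Full 𝔄 z cls e s' ∧
      ∀ S, Full 𝔄 z cls e S → (∀ Y ∉ arrs, S Y = s Y) → ∀ Y, s' Y ⊆ S Y := by
  refine (detTo_clears c arrs).seq fun s₀ ⟨h₁, h₂⟩ => ?_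
  -- After `j` rounds either the clauses are satisfied, or each round has added a tuple.
  let Inv (j : ℕ) (s' : SOAssign A) : Prop :=
    Derived 𝔄 z cls arrs e s₀ s' ∧ (Full 𝔄 z cls e s' ∨ j ≤ size arrs s')
  have step : ∀ j s₁ e', (∀ x ∉ H, e' x = e x) → Inv j s₁ →
      DetTo 𝔄 (propagate z cls) e' s₁ (Inv (j + 1)) := by
    rintro j s₁ e' he' ⟨hd, hf⟩
    refine (detTo_propagate hcls).imp fun s' ⟨hd', hf'⟩ => ?_
    have hd'' : Derived 𝔄 z cls arrs e s₁ s' :=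
      ⟨hd'.frame, hd'.le, fun S hS => hd'.sound S (hS.congr hcls fun x hx => (he' x hx).symm)⟩
    refine ⟨hd.trans hd'', ?_⟩
    by_cases hs : s' = s₁
    · exact .inl (hs ▸ (hf' hs).congr hcls he')
    · rcases hf with hf | hf
      -- Relations that satisfy the clauses cannot change any more: by soundness, with `s₁` itself
      -- as the model, nothing is added outside `s₁`.
      · exact absurd (funext fun Y => (hd''.sound _ hf (fun _ => subset_rfl) Y).antisymm
          (hd''.le Y)) hs
      · exact .inr (Nat.succ_le_of_lt (hf.trans_lt (size_lt hd'' hs)))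
  refine (step 0 s₀ e (fun _ _ => rfl) ⟨.refl s₀, .inr (Nat.zero_le _)⟩).seq fun s₁ hs₁ => ?_
  have hI := DetTo.seqs (𝔄 := 𝔄) (e := e) (s := s₁) (l := arrs)
    (f := fun X => forAll (List.range' c X.arity) (propagate z cls))
    (I := fun l s' => Inv (1 + (l.map fun X => Fintype.card A ^ X.arity).sum) s') ?_ hs₁
  · refine hI.imp fun s' ⟨hd, hf⟩ => ⟨fun Y hY => (hd.frame Y hY).trans (h₂ Y hY), ?_, ?_⟩
    -- The loops make up one round more than there are tuples over all the relations, so the second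
    -- alternative of `Inv` is impossible.
    · refine hf.resolve_right fun h => ?_
      have := size_le arrs s'
      omega
    · intro S hS hY
      refine hd.sound S hS fun Y => ?_
      by_cases hYa : Y ∈ arrs
      · rw [h₁ Y hYa]; exact Finset.empty_subset _
      · rw [h₂ Y hYa, hY Y hYa]
  · intro l X hX s₂ hs₂
    have := DetTo.forAll (𝔄 := 𝔄) (p := propagate z cls) (e := e) (s := s₂)
      (ls := List.range' c X.arity)
      (I := fun l' s' => Inv (1 + (l.map fun X => Fintype.card A ^ X.arity).sum + l'.length) s')
      ?_ hs₂
    · rw [length_envs, List.length_range'] at this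
      simpa [add_assoc] using this
    · intro l' e' he' s₃ hs₃
      rw [List.length_append, List.length_singleton]
      refine step _ s₃ e' (fun x hx => mem_envs.1 he' x fun hx' => hx ?_) hs₃
      rw [List.mem_range'_1] at hx'
      exact hH x hx'.1 (hx'.2.trans_le (Nat.add_le_add_left (hm X hX) c))

end Cmd

end CountLogic

namespace CountLogic

variable {R : Signature}

/-! ### Horn programs with guessed relations -/

namespace SOVar

/-- The relation of the tuples that are decided to be in `X`. -/
abbrev yes (X : SOVar) : SOVar := ⟨X.idx + 1, X.arity⟩

/-- The relation of the tuples that are decided not to be in `X`. -/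
abbrev no (X : SOVar) : SOVar := ⟨X.idx + 2, X.arity⟩

/-- The head of clauses without positive literal. -/
abbrev bad : SOVar := ⟨0, 0⟩

/-- The result of the last viability test. -/
abbrev viaFlag : SOVar := ⟨3, 0⟩

/-- The result of the previous viability test. -/
abbrev oldFlag : SOVar := ⟨7, 0⟩

lemma yes_injective : Function.Injective yes := fun X Y h => by
  cases X; cases Y; simpa [yes] using h

lemma no_injective : Function.Injective no := fun X Y h => by
  cases X; cases Y; simpa [no] using h

end SOVar

open SOVar

/-- The sum, over the values of the first `nx` variables, of the number of values of the relations
`arrs` for which there are values of `ny` further variables that satisfy all clauses. Blocks of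
`m` variables are left free for loops over tuples. -/
structure Problem (R : Signature) where
  nx : ℕ
  m : ℕ
  ny : ℕ
  arrs : List SOVar
  clauses : List (Clause R)

namespace Problem

/-- The start of the second block of free variables. -/
def c (P : Problem R) : ℕ := P.nx + P.m + P.ny

/-- The start of the variables of the clauses. -/
def z (P : Problem R) : ℕ := P.c + P.m

/-- The variables that the clauses do not use. -/
def hidden (P : Problem R) : Set FOVar :=
  -- The variables form consecutive blocks: `nx` summation variables, `m` loop variables of `guess`,
  -- `ny` witnesses, `m` loop variables of `clear` and `model`, and from `z` on the variables of the
  -- clauses. The second and the fourth block are hidden. In this order nested loops use increasing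
  -- variables.
  {x | P.nx ≤ x ∧ x < P.nx + P.m ∨ P.c ≤ x ∧ x < P.c + P.m}

/-- The conditions for `Problem.main` to be correct. -/
structure Wf (P : Problem R) : Prop where
  nodup : P.arrs.Nodup
  -- Indices modulo `4` keep the relations apart: residue `0` for the guessed relations and, with
  -- index `0`, for `bad`; residues `1` and `2` for the decisions; residue `3` for the two flags.
  dvd : ∀ X ∈ P.arrs, X.idx % 4 = 0
  ne_zero : ∀ X ∈ P.arrs, X.idx ≠ 0
  arity_le : ∀ X ∈ P.arrs, X.arity ≤ P.m
  ok : ∀ cl ∈ P.clauses, cl.Ok P.hidden (bad :: P.arrs)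
  free : ∀ cl ∈ P.clauses, ∀ X ∈ cl.body.freeSO, X ∈ P.arrs
  bounded : ∀ cl ∈ P.clauses, cl.body.Bounded (P.z + cl.nz)

/-- The tuples that are decided to be in `X` have to be in `X`. -/
def yesClause (P : Problem R) (X : SOVar) : Clause R where
  nz := X.arity
  body := .neg (.app X.yes (tup P.z X.arity))
  hd := X
  args := tup P.z X.arity

/-- The tuples that are decided not to be in `X` must not be in `X`. -/
def noClause (P : Problem R) (X : SOVar) : Clause R where
  nz := X.arity
  body := .or (.neg (.app X (tup P.z X.arity))) (.neg (.app X.no (tup P.z X.arity)))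
  hd := bad
  args := Fin.elim0

/-- All clauses. -/
def ext (P : Problem R) : List (Clause R) :=
  P.clauses ++ (P.arrs.map P.yesClause ++ P.arrs.map P.noClause)

variable {P : Problem R}

lemma tup_notMem_hidden {k : ℕ} (j : Fin k) : tup P.z k j ∉ P.hidden := by
  intro h
  replace h : P.nx ≤ P.z + (j : ℕ) ∧ P.z + (j : ℕ) < P.nx + P.m ∨
    P.c ≤ P.z + (j : ℕ) ∧ P.z + (j : ℕ) < P.c + P.m := h
  simp only [z, c] at h
  omega

lemma Wf.ok_ext (hP : P.Wf) : ∀ cl ∈ P.ext, cl.Ok P.hidden (bad :: P.arrs) := by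
  intro cl hcl
  simp only [ext, List.mem_append, List.mem_map] at hcl
  rcases hcl with hcl | ⟨X, hX, rfl⟩ | ⟨X, hX, rfl⟩
  · exact hP.ok cl hcl
  · refine ⟨.negLit (.app _ _), ?_, tup_notMem_hidden, List.mem_cons_of_mem _ hX⟩
    rintro _ ⟨j, rfl⟩
    exact tup_notMem_hidden j
  · refine ⟨.or (.negLit (.app _ _)) (.negLit (.app _ _)), ?_, fun j => j.elim0,
      List.mem_cons_self⟩
    rintro _ (⟨j, rfl⟩ | ⟨j, rfl⟩)
    · exact tup_notMem_hidden j
    · exact tup_notMem_hidden j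

/-- Set `viaFlag` if the decisions made so far can be extended to a solution. -/
def viable (P : Problem R) : Cmd R :=
  .seq (.put viaFlag Fin.elim0 false) (.forAll (List.range' (P.nx + P.m) P.ny)
    (.seq (.model P.c P.z P.ext (bad :: P.arrs))
      (.ite (.app bad Fin.elim0) .nop (.put viaFlag Fin.elim0 true))))

/-- Decide for one tuple whether it is in `X`, in every viable way. -/
def bit (P : Problem R) (X : SOVar) : Cmd R :=
  let u := tup P.nx X.arity
  let accept : Cmd R := .seq (.put X.no u false) (.put X.yes u true)
  -- A decided tuple is passed over, so the correctness of `bit` does not depend on the tuple being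
  -- undecided.
  .ite (.or (.app X.yes u) (.app X.no u)) .nop <|
    .seq (.put X.yes u true) <| .seq P.viable <|
    .seq (.ite (.app viaFlag Fin.elim0) (.put oldFlag Fin.elim0 true)
      (.put oldFlag Fin.elim0 false)) <|
    .seq (.put X.yes u false) <| .seq (.put X.no u true) <| .seq P.viable <|
    -- At this point the tuple is decided negatively, `viaFlag` tells whether this is viable, and
    -- `oldFlag` whether the positive decision was. If the negative one is not viable, then the
    -- positive one needs no check: some solution is known to exist.
    .ite (.app viaFlag Fin.elim0) (.ite (.app oldFlag Fin.elim0) (.fork accept .nop) .nop) accept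

/-- Decide for all tuples whether they are in the relations. -/
def guess (P : Problem R) : Cmd R :=
  .seqs (P.arrs.map fun X => .forAll (List.range' P.nx X.arity) (P.bit X))

/-- A program with one more run than the sum described by the problem. -/
def main (P : Problem R) : Cmd R :=
  .forAll (List.range' 0 P.nx) <| .seq (.seqs ((P.arrs.map yes ++ P.arrs.map no).map (.clear P.c)))
    -- The first branch goes on to the next values of the summation variables. The second one makes
    -- the runs that count solutions, and halts.
    <| .seq P.viable (.ite (.app viaFlag Fin.elim0) (.fork .nop (.seq P.guess .halt)) .nop)

end Problem

/-! ### Solutions that respect given decisions, and their number -/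

section

variable {A : Type*} [Fintype A] [LinearOrder A] {𝔄 : Interp R A} {e : FOAssign A}
  {s : SOAssign A}

/-- The relations `s'` are `s` with the truth value at one tuple changed. -/
structure IsPut (X : SOVar) (t : Fin X.arity → A) (b : Bool) (s s' : SOAssign A) : Prop where
  frame : ∀ Y ≠ X, s' Y = s Y
  mem : ∀ t', t' ∈ s' X ↔ if t' = t then b = true else t' ∈ s X

lemma Cmd.detTo_put (X : SOVar) (u : Fin X.arity → FOVar) (b : Bool) :
    DetTo 𝔄 (put X u b) e s (IsPut X (fun j => e (u j)) b s) :=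
  DetTo.put fun S hS => ⟨fun Y hY => by rw [Function.update_of_ne hY], fun t' => by
    rw [Function.update_self, hS]⟩

lemma IsPut.nonempty {X : SOVar} (hX : X.arity = 0) {t : Fin X.arity → A} {b : Bool}
    {s s' : SOAssign A} (h : IsPut X t b s s') : (s' X).Nonempty ↔ b = true := by
  have : IsEmpty (Fin X.arity) := by rw [hX]; infer_instance
  constructor
  · rintro ⟨t', ht'⟩
    simpa [Subsingleton.elim t' t] using (h.mem t').1 ht'
  · exact fun hb => ⟨t, (h.mem t).2 (by simp [hb])⟩

lemma sat_flag {X : SOVar} (hX : X.arity = 0) (u : Fin X.arity → FOVar) :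
    (SO.app X u : SO R).Sat 𝔄 e s ↔ (s X).Nonempty := by
  have : IsEmpty (Fin X.arity) := by rw [hX]; infer_instance
  exact ⟨fun h => ⟨_, h⟩, fun ⟨t, ht⟩ => by rwa [Subsingleton.elim t fun j => e (u j)] at ht⟩

/-- The same decisions have been made. -/
def Same (s s' : SOAssign A) : Prop := ∀ Y, Y.idx % 4 = 1 ∨ Y.idx % 4 = 2 → s Y = s' Y

lemma Same.trans {s₁ s₂ s₃ : SOAssign A} (h₁ : Same s₁ s₂) (h₂ : Same s₂ s₃) : Same s₁ s₃ :=
  fun Y hY => (h₁ Y hY).trans (h₂ Y hY)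

lemma IsPut.same {X : SOVar} (hX : X.idx % 4 = 0 ∨ X.idx % 4 = 3) {t : Fin X.arity → A} {b : Bool}
    {s s' : SOAssign A} (h : IsPut X t b s s') : Same s' s :=
  fun Y hY => h.frame Y (by rintro rfl; omega)

/-- Unlike in `sumSO_congr`, the relations outside the list may differ on the two sides. This allows
a comparison of counts for different decisions. -/
lemma sumSO_congr' (l : List SOVar) {F G : SOAssign A → ℕ} {s s' : SOAssign A}
    (h : ∀ S S', (∀ Y ∈ l, S Y = S' Y) → (∀ Y ∉ l, S Y = s Y) → (∀ Y ∉ l, S' Y = s' Y) →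
      F S = G S') : sumSO l F s = sumSO l G s' := by
  induction l generalizing s s' with
  | nil => exact h s s' (by simp) (fun _ _ => rfl) fun _ _ => rfl
  | cons X l ih =>
    refine Finset.sum_congr rfl fun B _ => ih fun S S' hSS hS hS' => h S S' ?_ ?_ ?_
    · intro Y hY
      by_cases hYl : Y ∈ l
      · exact hSS Y hYl
      · obtain rfl : Y = X := by simpa [hYl] using hY
        rw [hS Y hYl, hS' Y hYl, Function.update_self, Function.update_self]
    all_goals
      intro Y hY
      rw [List.mem_cons, not_or] at hY
    · rw [hS Y hY.2, Function.update_of_ne hY.1]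
    · rw [hS' Y hY.2, Function.update_of_ne hY.1]

namespace Problem

variable {P : Problem R}

/-- The relations respect the decisions and satisfy the clauses. -/
structure SolAt (𝔄 : Interp R A) (P : Problem R) (e : FOAssign A) (S : SOAssign A) : Prop where
  bad : S bad = ∅
  yes : ∀ X ∈ P.arrs, ∀ t : Fin X.arity → A, t ∈ S X.yes → t ∈ S X
  no : ∀ X ∈ P.arrs, ∀ t : Fin X.arity → A, t ∈ S X.no → t ∉ S X
  full : Full 𝔄 P.z P.clauses e S

/-- The relations respect the decisions and satisfy the clauses for suitable witnesses. -/
def Sol (𝔄 : Interp R A) (P : Problem R) (e : FOAssign A) (S : SOAssign A) : Prop :=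
  ∃ e' ∈ envs e (List.range' (P.nx + P.m) P.ny), P.SolAt 𝔄 e' S

/-- As `bad` is empty, a clause with head `bad` demands that its body is true, which is the meaning
of a clause without positive literal. -/
lemma full_ext {S : SOAssign A} (hS : S SOVar.bad = ∅) :
    Full 𝔄 P.z P.ext e S ↔ P.SolAt 𝔄 e S := by
  constructor
  · intro h
    refine ⟨hS, fun X hX t ht => ?_, fun X hX t ht ht' => ?_, fun cl hcl => h cl ?_⟩
    · obtain ⟨e', he', rfl⟩ := exists_env e P.z X.arity t
      exact (h (P.yesClause X) (by
        simp only [ext, List.mem_append]; exact .inr (.inl (List.mem_map_of_mem hX))) e' he').resolve_left (not_not.2 ht)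
    · obtain ⟨e', he', rfl⟩ := exists_env e P.z X.arity t
      rcases h (P.noClause X) (by simp only [ext, List.mem_append]; exact .inr (.inr (List.mem_map_of_mem hX))) e' he'
        with (h' | h') | h'
      · exact h' ht'
      · exact h' ht
      · have h'' : (fun j => e' (Fin.elim0 j)) ∈ S SOVar.bad := h'
        rw [hS] at h''
        exact absurd h'' (Finset.notMem_empty _)
    · simp only [ext, List.mem_append]; tauto
  · intro h cl hcl e' he'
    simp only [ext, List.mem_append, List.mem_map] at hcl
    rcases hcl with hcl | ⟨X, hX, rfl⟩ | ⟨X, hX, rfl⟩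
    · exact h.full cl hcl e' he'
    · exact or_iff_not_imp_left.2 fun h' => h.yes X hX _ (not_not.1 h')
    · refine .inl (or_iff_not_imp_right.2 fun h' => h.no X hX _ (not_not.1 h'))

lemma Wf.full_congr (hP : P.Wf) {S S' : SOAssign A} (h : ∀ X ∈ P.arrs, S X = S' X)
    (hb : S SOVar.bad = S' SOVar.bad) (hf : Full 𝔄 P.z P.clauses e S) :
    Full 𝔄 P.z P.clauses e S' := by
  intro cl hcl e' he'
  refine (hf cl hcl e' he').imp (fun h' => ?_) fun h' => ?_
  · exact (SO.sat_congr _ (fun _ _ => rfl) fun X hX => h X (hP.free cl hcl X hX)).1 h'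
  · have : S cl.hd = S' cl.hd := by
      rcases List.mem_cons.1 (hP.ok cl hcl).mem with h₁ | h₁
      · rw [h₁, hb]
      · exact h _ h₁
    rwa [← this]

/-- Only the flags have index `3` modulo `4`, and neither the clauses nor the decisions mention
them. -/
lemma Wf.solAt_congr (hP : P.Wf) {S S' : SOAssign A} (h : ∀ Y, Y.idx % 4 ≠ 3 → S Y = S' Y)
    (hS : P.SolAt 𝔄 e S) : P.SolAt 𝔄 e S' := by
  have h4 := hP.dvd
  refine ⟨?_, fun X hX t => ?_, fun X hX t => ?_, hP.full_congr (fun X hX => h X ?_) (h _ ?_)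
    hS.full⟩
  · rw [← h _ (by simp), hS.bad]
  · rw [← h X.yes (by have := h4 X hX; simp only; omega), ← h X (by have := h4 X hX; omega)]
    exact hS.yes X hX t
  · rw [← h X.no (by have := h4 X hX; simp only; omega), ← h X (by have := h4 X hX; omega)]
    exact hS.no X hX t
  · have := h4 X hX; omega
  · simp

open Classical in
/-- The number of solutions that respect the decisions. -/
noncomputable def count (𝔄 : Interp R A) (P : Problem R) (e : FOAssign A) (s : SOAssign A) : ℕ :=
  sumSO P.arrs (fun S => if P.Sol 𝔄 e S then 1 else 0) (Function.update s SOVar.bad ∅)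

lemma Wf.bad_notMem (hP : P.Wf) : SOVar.bad ∉ P.arrs := fun h => hP.ne_zero _ h rfl

lemma count_ne_zero : P.count 𝔄 e s ≠ 0 ↔
    ∃ e' ∈ envs e (List.range' (P.nx + P.m) P.ny), ∃ S, (∀ Y ∉ SOVar.bad :: P.arrs, S Y = s Y) ∧
      P.SolAt 𝔄 e' S := by
  classical
  rw [count, sumSO_ne_zero]
  constructor
  · rintro ⟨S, hS, h⟩
    obtain ⟨e', he', h'⟩ : P.Sol 𝔄 e S := by by_contra hh; simp [hh] at h
    refine ⟨e', he', S, fun Y hY => ?_, h'⟩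
    rw [List.mem_cons, not_or] at hY
    rw [hS Y hY.2, Function.update_of_ne hY.1]
  · rintro ⟨e', he', S, hS, h⟩
    refine ⟨S, fun Y hY => ?_, ?_⟩
    · by_cases hYb : Y = SOVar.bad
      · subst hYb
        rw [Function.update_self, h.bad]
      · rw [Function.update_of_ne hYb, hS Y (by simp [hYb, hY])]
    · rw [if_pos ⟨e', he', h⟩]
      exact one_ne_zero

lemma Wf.solAt_congr_env (hP : P.Wf) {e₁ e₂ : FOAssign A} (h : ∀ x ∉ P.hidden, e₁ x = e₂ x)
    {S : SOAssign A} (hS : P.SolAt 𝔄 e₁ S) : P.SolAt 𝔄 e₂ S :=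
  ⟨hS.bad, hS.yes, hS.no, hS.full.congr hP.ok h⟩

lemma Wf.sol_congr_env (hP : P.Wf) {e₁ e₂ : FOAssign A} (h : ∀ x ∉ P.hidden, e₁ x = e₂ x)
    {S : SOAssign A} (hS : P.Sol 𝔄 e₁ S) : P.Sol 𝔄 e₂ S := by
  obtain ⟨e', he', hS⟩ := hS
  obtain ⟨e'', he'', h''⟩ := envs_agree h he'
  exact ⟨e'', he'', hP.solAt_congr_env h'' hS⟩

lemma Wf.count_congr_env (hP : P.Wf) {e₁ e₂ : FOAssign A} (h : ∀ x ∉ P.hidden, e₁ x = e₂ x) :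
    P.count 𝔄 e₁ s = P.count 𝔄 e₂ s := by
  classical
  refine sumSO_congr _ fun S _ => if_congr ⟨hP.sol_congr_env h, hP.sol_congr_env fun x hx =>
    (h x hx).symm⟩ rfl rfl

/-- Transfers a solution to the decisions recorded in `s'`, if it happens to respect them. The
decisions under which it was a solution play no role. -/
lemma Wf.sol_of_agree (hP : P.Wf) {s' S S' : SOAssign A} (h : ∀ Y ∈ P.arrs, S Y = S' Y)
    (hS' : ∀ Y ∉ P.arrs, S' Y = Function.update s' SOVar.bad ∅ Y)
    (hyes : ∀ X ∈ P.arrs, ∀ t : Fin X.arity → A, t ∈ s' X.yes → t ∈ S X)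
    (hno : ∀ X ∈ P.arrs, ∀ t : Fin X.arity → A, t ∈ s' X.no → t ∉ S X)
    (hsol : P.Sol 𝔄 e S) : P.Sol 𝔄 e S' := by
  have hb : S' SOVar.bad = ∅ := by rw [hS' _ hP.bad_notMem, Function.update_self]
  have h4 := hP.dvd
  obtain ⟨e', he', hS⟩ := hsol
  refine ⟨e', he', hb, fun X hX t ht => ?_, fun X hX t ht => ?_,
    hP.full_congr h (by rw [hb, hS.bad]) hS.full⟩
  · have h0 := h4 X hX
    rw [hS' X.yes (fun hm => by have := h4 _ hm; simp only at this; omega),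
      Function.update_of_ne (by simp [SOVar.bad, yes])] at ht
    rw [← h X hX]
    exact hyes X hX t ht
  · have h0 := h4 X hX
    rw [hS' X.no (fun hm => by have := h4 _ hm; simp only at this; omega),
      Function.update_of_ne (by simp [SOVar.bad, no])] at ht
    rw [← h X hX]
    exact hno X hX t ht

lemma Wf.mem_of_sol (hP : P.Wf) {s S : SOAssign A}
    (hS : ∀ Y ∉ P.arrs, S Y = Function.update s SOVar.bad ∅ Y) (hsol : P.Sol 𝔄 e S) :
    ∀ X ∈ P.arrs, ∀ t : Fin X.arity → A, (t ∈ s X.yes → t ∈ S X) ∧ (t ∈ s X.no → t ∉ S X) := by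
  obtain ⟨e', he', h⟩ := hsol
  have h4 := hP.dvd
  intro X hX t
  have h0 := h4 X hX
  have h₁ := h.yes X hX t
  have h₂ := h.no X hX t
  rw [hS X.yes (fun hm => by have := h4 _ hm; simp only at this; omega),
    Function.update_of_ne (by simp [SOVar.bad, yes])] at h₁
  rw [hS X.no (fun hm => by have := h4 _ hm; simp only at this; omega),
    Function.update_of_ne (by simp [SOVar.bad, no])] at h₂
  exact ⟨h₁, h₂⟩

lemma Wf.count_congr (hP : P.Wf) {s s' : SOAssign A} (h : Same s s') :
    P.count 𝔄 e s = P.count 𝔄 e s' := by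
  classical
  have h4 := hP.dvd
  have key : ∀ {s s' S S' : SOAssign A}, Same s s' → (∀ Y ∈ P.arrs, S Y = S' Y) →
      (∀ Y ∉ P.arrs, S Y = Function.update s SOVar.bad ∅ Y) →
      (∀ Y ∉ P.arrs, S' Y = Function.update s' SOVar.bad ∅ Y) → P.Sol 𝔄 e S → P.Sol 𝔄 e S' := by
    intro s s' S S' h h₁ h₂ h₃ hsol
    refine hP.sol_of_agree h₁ h₃ (fun X hX t => ?_) (fun X hX t => ?_) hsol
    · rw [← h X.yes (by have := h4 X hX; simp only; omega)]
      exact (hP.mem_of_sol h₂ hsol X hX t).1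
    · rw [← h X.no (by have := h4 X hX; simp only; omega)]
      exact (hP.mem_of_sol h₂ hsol X hX t).2
  refine sumSO_congr' _ fun S S' h₁ h₂ h₃ => if_congr ⟨key h h₁ h₂ h₃, key (fun Y hY => (h Y hY).symm)
    (fun Y hY => (h₁ Y hY).symm) h₃ h₂⟩ rfl rfl

/-- A tuple is in the relation or not. -/
lemma Wf.count_split (hP : P.Wf) {X : SOVar} (hX : X ∈ P.arrs) {t : Fin X.arity → A}
    {s s₁ s₂ : SOAssign A} (h₁ : IsPut X.yes t true s s₁) (h₂ : IsPut X.no t true s s₂) :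
    P.count 𝔄 e s = P.count 𝔄 e s₁ + P.count 𝔄 e s₂ := by
  classical
  have h4 := hP.dvd
  have hyn : ∀ Y : SOVar, Y ∈ P.arrs → Y.no ≠ X.yes ∧ Y.yes ≠ X.no := by
    intro Y hY
    have h0 := h4 X hX
    have h0' := h4 Y hY
    constructor <;> intro h <;> have := congrArg SOVar.idx h <;> simp only at this <;> omega
  -- Heterogeneous equality is needed since the type of `t'` depends on `Y`, which is equal to `X`
  -- only in one of the cases.
  have hs₁ : ∀ Y ∈ P.arrs, ∀ t' : Fin Y.arity → A, (t' ∈ s₁ Y.no ↔ t' ∈ s Y.no) ∧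
      (t' ∈ s₁ Y.yes ↔ t' ∈ s Y.yes ∨ Y = X ∧ t' ≍ t) := by
    intro Y hY t'
    refine ⟨by rw [h₁.frame _ (hyn Y hY).1], ?_⟩
    by_cases hYX : Y = X
    · subst hYX
      rw [h₁.mem]
      split_ifs with h <;> simp [h]
    · rw [h₁.frame _ (fun h => hYX (yes_injective h))]
      simp [hYX]
  have hs₂ : ∀ Y ∈ P.arrs, ∀ t' : Fin Y.arity → A, (t' ∈ s₂ Y.yes ↔ t' ∈ s Y.yes) ∧
      (t' ∈ s₂ Y.no ↔ t' ∈ s Y.no ∨ Y = X ∧ t' ≍ t) := by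
    intro Y hY t'
    refine ⟨by rw [h₂.frame _ (hyn Y hY).2], ?_⟩
    by_cases hYX : Y = X
    · subst hYX
      rw [h₂.mem]
      split_ifs with h <;> simp [h]
    · rw [h₂.frame _ (fun h => hYX (no_injective h))]
      simp [hYX]
  -- Solutions under the additional decision are the old solutions that contain `t`. Both counts
  -- thereby become sums over the same relations, and the split is pointwise.
  have e₁ : P.count 𝔄 e s₁ = sumSO P.arrs (fun S => if P.Sol 𝔄 e S ∧ t ∈ S X then 1 else 0)
      (Function.update s SOVar.bad ∅) := by
    refine sumSO_congr' _ fun S S' hSS hS hS' => if_congr ⟨fun h => ?_, fun h => ?_⟩ rfl rfl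
    · have hm := hP.mem_of_sol hS h
      refine ⟨hP.sol_of_agree hSS hS' (fun Y hY t' ht' => (hm Y hY t').1 ?_)
        (fun Y hY t' ht' => (hm Y hY t').2 ?_) h, ?_⟩
      · exact (hs₁ Y hY t').2.2 (.inl ht')
      · exact (hs₁ Y hY t').1.2 ht'
      · rw [← hSS X hX]
        exact (hm X hX t).1 ((hs₁ X hX t).2.2 (.inr ⟨rfl, HEq.rfl⟩))
    · have hm := hP.mem_of_sol hS' h.1
      refine hP.sol_of_agree (fun Y hY => (hSS Y hY).symm) hS (fun Y hY t' ht' => ?_)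
        (fun Y hY t' ht' => (hm Y hY t').2 ((hs₁ Y hY t').1.1 ht')) h.1
      rcases (hs₁ Y hY t').2.1 ht' with h' | ⟨rfl, h'⟩
      · exact (hm Y hY t').1 h'
      · rw [eq_of_heq h']; exact h.2
  have e₂ : P.count 𝔄 e s₂ = sumSO P.arrs (fun S => if P.Sol 𝔄 e S ∧ t ∉ S X then 1 else 0)
      (Function.update s SOVar.bad ∅) := by
    refine sumSO_congr' _ fun S S' hSS hS hS' => if_congr ⟨fun h => ?_, fun h => ?_⟩ rfl rfl
    · have hm := hP.mem_of_sol hS h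
      refine ⟨hP.sol_of_agree hSS hS' (fun Y hY t' ht' => (hm Y hY t').1 ?_)
        (fun Y hY t' ht' => (hm Y hY t').2 ?_) h, ?_⟩
      · exact (hs₂ Y hY t').1.2 ht'
      · exact (hs₂ Y hY t').2.2 (.inl ht')
      · rw [← hSS X hX]
        exact (hm X hX t).2 ((hs₂ X hX t).2.2 (.inr ⟨rfl, HEq.rfl⟩))
    · have hm := hP.mem_of_sol hS' h.1
      refine hP.sol_of_agree (fun Y hY => (hSS Y hY).symm) hS
        (fun Y hY t' ht' => (hm Y hY t').1 ((hs₂ Y hY t').1.1 ht')) (fun Y hY t' ht' => ?_) h.1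
      rcases (hs₂ Y hY t').2.1 ht' with h' | ⟨rfl, h'⟩
      · exact (hm Y hY t').2 h'
      · rw [eq_of_heq h']; exact h.2
  rw [e₁, e₂, ← sumSO_add, count]
  refine sumSO_congr _ fun S _ => ?_
  by_cases h : P.Sol 𝔄 e S <;> by_cases h' : t ∈ S X <;> simp [h, h']

/-- When every tuple is decided, the decisions determine the relations. -/
lemma Wf.count_le_one (hP : P.Wf) (h : ∀ X ∈ P.arrs, ∀ t : Fin X.arity → A, t ∈ s X.yes ∨ t ∈ s X.no) :
    P.count 𝔄 e s ≤ 1 := by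
  classical
  refine sumSO_le_one hP.nodup (fun S => by split_ifs <;> simp) fun S S' hS hS' h₁ h₂ => ?_
  have h₁' : P.Sol 𝔄 e S := by by_contra hh; simp [hh] at h₁
  have h₂' : P.Sol 𝔄 e S' := by by_contra hh; simp [hh] at h₂
  have hm := hP.mem_of_sol hS h₁'
  have hm' := hP.mem_of_sol hS' h₂'
  funext X
  by_cases hX : X ∈ P.arrs
  · ext t
    rcases h X hX t with ht | ht
    · exact iff_of_true ((hm X hX t).1 ht) ((hm' X hX t).1 ht)
    · exact iff_of_false ((hm X hX t).2 ht) ((hm' X hX t).2 ht)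
  · rw [hS X hX, hS' X hX]

end Problem

end

end CountLogic

namespace CountLogic

open SOVar Cmd

variable {R : Signature} {A : Type*} [Fintype A] [LinearOrder A] {𝔄 : Interp R A}
  {e : FOAssign A} {s : SOAssign A}

/-! ### Correctness of the counting program -/

namespace Problem

variable {P : Problem R}

/-- For a fixed witness, a least model with empty `bad` is itself a solution. Conversely the least
model lies inside every solution, so if there is one, `bad` is not derived. -/
lemma Wf.detTo_viable (hP : P.Wf) : DetTo 𝔄 P.viable e s fun s' =>
    Same s' s ∧ s' oldFlag = s oldFlag ∧ ((s' viaFlag).Nonempty ↔ P.count 𝔄 e s ≠ 0) := by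
  have h4 := hP.dvd
  have hmem : ∀ Y : SOVar, Y.idx % 4 ≠ 0 → Y ∉ SOVar.bad :: P.arrs := by
    intro Y hY hm
    rcases List.mem_cons.1 hm with rfl | hm
    · exact hY rfl
    · exact hY (h4 Y hm)
  have hP' : ∀ X ∈ SOVar.bad :: P.arrs, X.arity ≤ P.m := by
    intro X hX
    rcases List.mem_cons.1 hX with rfl | hX
    · exact Nat.zero_le _
    · exact hP.arity_le X hX
  refine (detTo_put _ _ _).seq fun s₀ h₀ => ?_
  refine (DetTo.forAll (I := fun l s' => (∀ Y, Y ≠ viaFlag → Y ∉ SOVar.bad :: P.arrs → s' Y = s Y) ∧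
    ((s' viaFlag).Nonempty ↔ ∃ e' ∈ l, ∃ S, (∀ Y ∉ SOVar.bad :: P.arrs, S Y = s Y) ∧
      P.SolAt 𝔄 e' S)) ?_ ⟨fun Y hY _ => h₀.frame Y hY, by simp [h₀.nonempty rfl]⟩).imp ?_
  · rintro l e' he' s₁ ⟨h₁, h₂⟩
    refine (detTo_model hP.ok_ext hP' fun x hx hx' => .inr ⟨hx, hx'⟩).seq
      fun s₂ ⟨h₃, h₄, h₅⟩ => ?_
    refine DetTo.ite (fun hb => DetTo.nop ⟨fun Y hY hY' => ?_, ?_⟩)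
      fun hb => (detTo_put _ _ _).imp fun s₃ h₆ => ⟨fun Y hY hY' => ?_, ?_⟩
    · rw [h₃ Y hY', h₁ Y hY hY']
    · rw [h₃ _ (hmem _ (by simp)), h₂]
      refine exists_congr fun e'' => and_congr_left fun ⟨S, hS, hsol⟩ => ?_
      rw [List.mem_append, List.mem_singleton]
      refine ⟨.inl, fun h => h.resolve_right ?_⟩
      rintro rfl
      -- Minimality only concerns models that agree with the current relations outside `bad` and
      -- `arrs`. As `viaFlag` may have changed during the loop, the solution is adjusted there
      -- first.
      have hsol' : P.SolAt 𝔄 e'' (Function.update S viaFlag (s₁ viaFlag)) :=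
        hP.solAt_congr (fun Y hY => (Function.update_of_ne (by rintro rfl; simp at hY) _ _).symm)
          hsol
      have := h₅ _ ((full_ext hsol'.bad).2 hsol') (fun Y hY => by
        by_cases hYV : Y = viaFlag
        · subst hYV; rw [Function.update_self]
        · rw [Function.update_of_ne hYV, hS Y hY, h₁ Y hYV hY]) SOVar.bad
      rw [hsol'.bad] at this
      rw [sat_flag rfl] at hb
      obtain ⟨t, ht⟩ := hb
      exact absurd (this ht) (Finset.notMem_empty _)
    · rw [h₆.frame Y hY, h₃ Y hY', h₁ Y hY hY']
    · rw [sat_flag rfl, Finset.not_nonempty_iff_eq_empty] at hb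
      -- The least model is the solution sought, with `viaFlag` put back to its value in `s`.
      refine iff_of_true ((h₆.nonempty rfl).2 rfl) ⟨e', by simp,
        Function.update s₂ viaFlag (s viaFlag), fun Y hY => ?_, ?_⟩
      · by_cases hYV : Y = viaFlag
        · subst hYV; rw [Function.update_self]
        · rw [Function.update_of_ne hYV, h₃ Y hY, h₁ Y hYV hY]
      · exact hP.solAt_congr (fun Y hY => (Function.update_of_ne (by rintro rfl; simp at hY) _ _).symm)
          ((full_ext hb).1 h₄)
  · rintro s' ⟨h₁, h₂⟩
    refine ⟨fun Y hY => h₁ Y (by rintro rfl; simp at hY) (hmem Y (by omega)),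
      h₁ _ (by simp) (hmem _ (by simp)), ?_⟩
    rw [h₂, count_ne_zero]

/-- All tuples outside `U` are decided. -/
def Decided (P : Problem R) (U : Set (Σ X : SOVar, Fin X.arity → A)) (s : SOAssign A) : Prop :=
  ∀ X ∈ P.arrs, ∀ t : Fin X.arity → A, (⟨X, t⟩ : Σ X : SOVar, Fin X.arity → A) ∉ U →
    t ∈ s X.yes ∨ t ∈ s X.no

/-- The continuation `k` counts the solutions, if all tuples outside `U` are decided. -/
def Counts (𝔄 : Interp R A) (P : Problem R) (e : FOAssign A)
    (U : Set (Σ X : SOVar, Fin X.arity → A)) (k : SOAssign A → ℕ) : Prop :=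
  ∀ s, P.count 𝔄 e s ≠ 0 → P.Decided U s → k s = P.count 𝔄 e s

/-- The count splits according to the membership of the tuple, and `bit` follows exactly the viable
halves. The condition that the count is not zero is inherited by each branch taken, which excludes
dead ends. -/
lemma Wf.counts_bit (hP : P.Wf) {X : SOVar} (hX : X ∈ P.arrs)
    {U : Set (Σ X : SOVar, Fin X.arity → A)} {k : SOAssign A → ℕ} (hk : P.Counts 𝔄 e U k) :
    P.Counts 𝔄 e (insert ⟨X, fun j => e (tup P.nx X.arity j)⟩ U) ((P.bit X).den 𝔄 e k) := by
  intro s hs hdec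
  have h0 := hP.dvd X hX
  set u := tup P.nx X.arity with hu
  set t : Fin X.arity → A := fun j => e (u j) with ht
  by_cases hd : t ∈ s X.yes ∨ t ∈ s X.no
  · have : (P.bit X).den 𝔄 e k s = k s := by
      rw [bit, den, if_pos (show SO.Sat 𝔄 (.or (.app X.yes u) (.app X.no u)) e s from hd), den]
    rw [this]
    refine hk s hs fun Y hY t' ht' => ?_
    by_cases hYt : (⟨Y, t'⟩ : Σ X : SOVar, Fin X.arity → A) = ⟨X, t⟩
    · cases hYt
      exact hd
    · exact hdec Y hY t' fun h => (Set.mem_insert_iff.1 h).elim hYt ht'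
  have hyn : X.yes ≠ X.no := by simp [yes, no]
  -- `bit` is cut into its deterministic part `pre` and the choice `last`. The regrouping costs
  -- nothing, because `den` of a sequence is composition of continuations.
  let accept : Cmd R := .seq (.put X.no u false) (.put X.yes u true)
  let last : Cmd R := .ite (.app viaFlag Fin.elim0) (.ite (.app oldFlag Fin.elim0)
    (.fork accept .nop) .nop) accept
  let pre : Cmd R := .seq (.put X.yes u true) <| .seq P.viable <|
    .seq (.ite (.app viaFlag Fin.elim0) (.put oldFlag Fin.elim0 true)
      (.put oldFlag Fin.elim0 false)) <|
    .seq (.put X.yes u false) <| .seq (.put X.no u true) P.viable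
  have hbit : (P.bit X).den 𝔄 e k s = pre.den 𝔄 e (last.den 𝔄 e k) s := by
    rw [bit, den, if_neg (show ¬ SO.Sat 𝔄 (.or (.app X.yes u) (.app X.no u)) e s from hd)]
    rfl
  have hpre : DetTo 𝔄 pre e s fun s' => ∃ s₁ s₂, IsPut X.yes t true s s₁ ∧ IsPut X.no t true s s₂ ∧
      Same s' s₂ ∧ ((s' oldFlag).Nonempty ↔ P.count 𝔄 e s₁ ≠ 0) ∧
      ((s' viaFlag).Nonempty ↔ P.count 𝔄 e s₂ ≠ 0) := by
    refine (detTo_put _ _ _).seq fun s₁ h₁ => hP.detTo_viable.seq fun s₂ ⟨h₂, _, h₂'⟩ => ?_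
    refine DetTo.seq (Q := fun s₃ => Same s₃ s₂ ∧
      ((s₃ oldFlag).Nonempty ↔ P.count 𝔄 e s₁ ≠ 0)) ?_ fun s₃ ⟨h₃, h₃'⟩ => ?_
    · refine DetTo.ite (fun hv => (detTo_put _ _ _).imp fun s₃ h₃ =>
        ⟨h₃.same (by simp), ?_⟩) fun hv => (detTo_put _ _ _).imp fun s₃ h₃ => ⟨h₃.same (by simp), ?_⟩
      all_goals
        rw [sat_flag rfl, h₂'] at hv
        simp [h₃.nonempty rfl, hv]
    · have hs₃ := h₃.trans h₂
      refine (detTo_put _ _ _).seq fun s₄ h₄ => (detTo_put _ _ _).seq fun s₅ h₅ => ?_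
      -- The tuple was undecided in `s`, so removing the trial decision restores the decisions of
      -- `s`.
      have hs₄ : Same s₄ s := by
        intro Y hY
        by_cases hYX : Y = X.yes
        · subst hYX
          ext t'
          rw [h₄.mem, hs₃ _ hY, h₁.mem]
          split_ifs with h
          · simp only [false_iff]
            exact fun h' => hd (.inl (by rw [h] at h'; exact h'))
          · rfl
        · rw [h₄.frame _ hYX, hs₃ Y hY, h₁.frame _ hYX]
      obtain ⟨s₆, h₆⟩ : ∃ s₆, IsPut X.no t true s s₆ := by
        obtain ⟨s₆, -, h₆⟩ := detTo_put (𝔄 := 𝔄) (e := e) (s := s) X.no u true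
        exact ⟨s₆, h₆⟩
      have hs₅ : Same s₅ s₆ := by
        intro Y hY
        by_cases hYX : Y = X.no
        · subst hYX
          ext t'
          rw [h₅.mem, hs₄ _ hY, h₆.mem]
        · rw [h₅.frame _ hYX, hs₄ Y hY, h₆.frame _ hYX]
      refine hP.detTo_viable.imp fun s₇ ⟨h₇, h₇', h₇''⟩ => ⟨s₁, s₆, h₁, h₆, h₇.trans hs₅, ?_, ?_⟩
      · rw [h₇', h₅.frame _ ?_, h₄.frame _ ?_, h₃'] <;> intro h <;>
          have := congrArg SOVar.idx h <;> simp only at this <;> omega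
      · rw [h₇'', hP.count_congr hs₅]
  obtain ⟨s', hs', s₁, s₂, h₁, h₂, h₃, hold, hvia⟩ := hpre
  have hacc : ∃ s'', accept.den 𝔄 e k s' = k s'' ∧ Same s'' s₁ := by
    obtain ⟨s₄, h₄, h₅⟩ : DetTo 𝔄 accept e s' fun s'' => Same s'' s₁ := by
      refine (detTo_put _ _ _).seq fun s₄ h₄ => (detTo_put _ _ _).imp fun s₅ h₅ Y hY => ?_
      have hs₄ : Same s₄ s := by
        intro Y hY
        by_cases hYX : Y = X.no
        · subst hYX
          ext t'
          rw [h₄.mem, h₃ _ hY, h₂.mem]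
          split_ifs with h
          · simp only [false_iff]
            exact fun h' => hd (.inr (by rw [h] at h'; exact h'))
          · rfl
        · rw [h₄.frame _ hYX, h₃ Y hY, h₂.frame _ hYX]
      by_cases hYX : Y = X.yes
      · subst hYX
        ext t'
        rw [h₅.mem, hs₄ _ hY, h₁.mem]
      · rw [h₅.frame _ hYX, hs₄ Y hY, h₁.frame _ hYX]
    exact ⟨s₄, h₄ k, h₅⟩
  obtain ⟨s'', hs'', hsame⟩ := hacc
  have hsplit := hP.count_split (𝔄 := 𝔄) (e := e) hX h₁ h₂
  have hdec' : ∀ {s₃}, (∀ Y : SOVar, ∀ t' : Fin Y.arity → A, t' ∈ s Y.yes ∨ t' ∈ s Y.no ∨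
      (⟨Y, t'⟩ : Σ X : SOVar, Fin X.arity → A) = ⟨X, t⟩ → t' ∈ s₃ Y.yes ∨ t' ∈ s₃ Y.no) →
      P.Decided U s₃ := by
    intro s₃ h Y hY t' ht'
    by_cases hYt : (⟨Y, t'⟩ : Σ X : SOVar, Fin X.arity → A) = ⟨X, t⟩
    · exact h Y t' (.inr (.inr hYt))
    · exact h Y t' (by rw [← or_assoc]; exact .inl (hdec Y hY t' fun h =>
        (Set.mem_insert_iff.1 h).elim hYt ht'))
  have mono : ∀ {Z : SOVar} {b : Fin Z.arity → A} {s₃}, IsPut Z b true s s₃ → b ∈ s₃ Z ∧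
      ∀ Y, ∀ t' : Fin Y.arity → A, t' ∈ s Y → t' ∈ s₃ Y := by
    intro Z b s₃ h
    refine ⟨(h.mem b).2 (by simp), fun Y t' ht' => ?_⟩
    by_cases hYZ : Y = Z
    · subst hYZ
      rw [h.mem]
      split_ifs <;> simp [ht']
    · rwa [h.frame Y hYZ]
  have hdec₁ : P.Decided U s₁ := hdec' fun Y t' h => by
    rcases h with h | h | h
    · exact .inl ((mono h₁).2 Y.yes t' h)
    · exact .inr ((mono h₁).2 Y.no t' h)
    · cases h
      exact .inl (mono h₁).1
  have hdec₂ : P.Decided U s₂ := hdec' fun Y t' h => by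
    rcases h with h | h | h
    · exact .inl ((mono h₂).2 Y.yes t' h)
    · exact .inr ((mono h₂).2 Y.no t' h)
    · cases h
      exact .inr (mono h₂).1
  have hdsame : ∀ {s₃ s₄ : SOAssign A}, Same s₃ s₄ → P.Decided U s₄ → P.Decided U s₃ := by
    intro s₃ s₄ h hd Y hY t' ht'
    have h0' := hP.dvd Y hY
    rw [h Y.yes (by simp only; omega), h Y.no (by simp only; omega)]
    exact hd Y hY t' ht'
  have hk₁ : P.count 𝔄 e s₁ ≠ 0 → k s'' = P.count 𝔄 e s₁ := fun h => by
    rw [← hP.count_congr hsame] at h ⊢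
    exact hk s'' h (hdsame hsame hdec₁)
  have hk₂ : P.count 𝔄 e s₂ ≠ 0 → k s' = P.count 𝔄 e s₂ := fun h => by
    rw [← hP.count_congr h₃] at h ⊢
    exact hk s' h (hdsame h₃ hdec₂)
  rw [hbit, hs', hsplit]
  simp only [last, den, sat_flag (X := viaFlag) rfl, sat_flag (X := oldFlag) rfl, hold, hvia]
  -- The sum of the two counts is not zero. If the negative half is empty, the positive one is not,
  -- and `accept` is right without a further test.
  by_cases hv : P.count 𝔄 e s₂ = 0
  · rw [if_neg (by simpa using hv), hv, add_zero]
    refine hs''.trans (hk₁ ?_)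
    omega
  · rw [if_pos hv]
    by_cases ho : P.count 𝔄 e s₁ = 0
    · rw [if_neg (by simpa using ho), ho, zero_add, hk₂ hv]
    · rw [if_pos ho, hk₂ hv, ← hk₁ ho]
      exact congrArg (· + _) hs''

lemma Wf.counts_congr_env (hP : P.Wf) {e₁ e₂ : FOAssign A} (h : ∀ x ∉ P.hidden, e₁ x = e₂ x)
    {U : Set (Σ X : SOVar, Fin X.arity → A)} {k : SOAssign A → ℕ} (hk : P.Counts 𝔄 e₁ U k) :
    P.Counts 𝔄 e₂ U k := by
  intro s hs
  rw [← hP.count_congr_env h] at hs ⊢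
  exact hk s hs

/-- The programs are treated from the last to the first: `U` collects the tuples that the remaining
program visits, and every other tuple has been decided. At the start `U` is everything, and no
decision is required. -/
lemma Wf.counts_guess (hP : P.Wf) :
    P.Counts 𝔄 e Set.univ (P.guess.den 𝔄 e fun _ => 1) := by
  have key : ∀ l : List SOVar, (∀ X ∈ l, X ∈ P.arrs) → P.Counts 𝔄 e {p | p.1 ∈ l}
      ((seqs (l.map fun X => forAll (List.range' P.nx X.arity) (P.bit X))).den 𝔄 e fun _ => 1) := by
    intro l
    induction l with
    | nil =>
      intro _ s hs hd
      -- At the end the count is at most one since all is decided, and it is not zero by assumption.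
      -- So it is the one run that is left.
      have := hP.count_le_one (𝔄 := 𝔄) (e := e) fun X hX t => hd X hX t (by simp)
      show 1 = _
      omega
    | cons X l ih =>
      intro hl
      have hX := hl X List.mem_cons_self
      show P.Counts 𝔄 e _ ((forAll (List.range' P.nx X.arity) (P.bit X)).den 𝔄 e
        ((seqs (l.map fun X => forAll (List.range' P.nx X.arity) (P.bit X))).den 𝔄 e fun _ => 1))
      have ih' := ih fun Y hY => hl Y (List.mem_cons_of_mem _ hY)
      rw [den_forAll]
      -- The same backward induction over the tuples of the single relation `X`.
      have inner : ∀ l' : List (FOAssign A), (∀ e' ∈ l', e' ∈ envs e (List.range' P.nx X.arity)) →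
          P.Counts 𝔄 e ({p | p.1 ∈ l} ∪ {p | ∃ e' ∈ l', p = ⟨X, fun j => e' (tup P.nx X.arity j)⟩})
            (l'.foldr (fun e' k' => (P.bit X).den 𝔄 e' k') ((seqs (l.map fun X =>
              forAll (List.range' P.nx X.arity) (P.bit X))).den 𝔄 e fun _ => 1)) := by
        intro l'
        induction l' with
        | nil => simpa using ih'
        | cons e' l' ihl =>
          intro hl'
          have hag : ∀ x ∉ P.hidden, e' x = e x := fun x hx =>
            mem_envs.1 (hl' e' List.mem_cons_self) x fun hx' => hx (by
              rw [List.mem_range'_1] at hx'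
              exact .inl ⟨hx'.1, hx'.2.trans_le (Nat.add_le_add_left (hP.arity_le X hX) _)⟩)
          have h₁ := ihl fun e'' he'' => hl' e'' (List.mem_cons_of_mem _ he'')
          have h₂ := hP.counts_congr_env hag (hP.counts_bit hX (hP.counts_congr_env
            (fun x hx => (hag x hx).symm) h₁))
          convert h₂ using 1
          · ext p
            simp only [Set.mem_union, Set.mem_insert_iff, Set.mem_ofPred_eq, List.mem_cons,
              or_and_right, exists_or, exists_eq_left]
            tauto
          · rfl
      have h := inner _ fun _ h => h
      convert h using 1
      ext ⟨Y, t⟩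
      simp only [Set.mem_union, Set.mem_ofPred_eq, List.mem_cons]
      constructor
      · rintro (rfl | h)
        · obtain ⟨e', he', rfl⟩ := exists_env e P.nx Y.arity t
          exact .inr ⟨e', he', rfl⟩
        · exact .inl h
      · rintro (h | ⟨e', -, h⟩)
        · exact .inr h
        · cases h
          exact .inl rfl
  intro s hs hd
  exact key P.arrs (fun _ h => h) s hs fun X hX t h => absurd hX h

/-- The relations satisfy the clauses for suitable witnesses. -/
def Models (𝔄 : Interp R A) (P : Problem R) (e : FOAssign A) (S : SOAssign A) : Prop :=
  ∃ e' ∈ envs e (List.range' (P.nx + P.m) P.ny), Full 𝔄 P.z P.clauses e' S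

open Classical in
/-- The sum described by the problem. -/
noncomputable def value (𝔄 : Interp R A) (P : Problem R) (e : FOAssign A) : ℕ :=
  ((envs e (List.range' 0 P.nx)).map fun e' =>
    sumSO P.arrs (fun S => if P.Models 𝔄 e' S then 1 else 0) fun _ => ∅).sum

/-- The continuation is constant, so it does not matter which relations a round leaves behind. Each
round adds its number of solutions by a fork, or nothing if there are none. -/
lemma Wf.den_main (hP : P.Wf) {k : SOAssign A → ℕ} {n : ℕ} (hk : ∀ s, k s = n) :
    P.main.den 𝔄 e k s = n + P.value 𝔄 e := by
  classical
  rw [main, den_forAll, value]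
  have h4 := hP.dvd
  induction envs e (List.range' 0 P.nx) generalizing s with
  | nil => simp [hk]
  | cons e' l ih =>
    set k' := l.foldr (fun e' k' => den 𝔄 _ e' k') k with hk'
    rw [List.foldr_cons, List.map_cons, List.sum_cons, add_left_comm, ← hk']
    obtain ⟨s₁, h₁, h₁', -⟩ := detTo_clears (𝔄 := 𝔄) (e := e') (s := s) P.c
      (P.arrs.map yes ++ P.arrs.map no)
    obtain ⟨s₂, h₂, h₂', -, h₃⟩ := hP.detTo_viable (𝔄 := 𝔄) (e := e') (s := s₁)
    rw [den, h₁, den, h₂]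
    -- With all decisions cleared every model is a solution.
    have hcount : P.count 𝔄 e' s₁ = sumSO P.arrs (fun S =>
        if P.Models 𝔄 e' S then 1 else 0) fun _ => ∅ := by
      have he : ∀ X ∈ P.arrs, s₁ X.yes = ∅ ∧ s₁ X.no = ∅ := fun X hX =>
        ⟨h₁' _ (List.mem_append_left _ (List.mem_map_of_mem hX)),
          h₁' _ (List.mem_append_right _ (List.mem_map_of_mem hX))⟩
      refine sumSO_congr' _ fun S S' hSS hS hS' => if_congr ⟨?_, ?_⟩ rfl rfl
      · rintro ⟨e'', he'', h⟩
        exact ⟨e'', he'', hP.full_congr hSS (by rw [h.bad, hS' _ hP.bad_notMem]) h.full⟩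
      · rintro ⟨e'', he'', h⟩
        have hb : S SOVar.bad = ∅ := by rw [hS _ hP.bad_notMem, Function.update_self]
        refine hP.sol_of_agree (S := S') (fun Y hY => (hSS Y hY).symm) hS ?_ ?_ ⟨e'', he'',
          by rw [hS' _ hP.bad_notMem], fun X hX t ht => ?_, fun X hX t ht => ?_, h⟩
        · intro X hX t ht
          rw [(he X hX).1] at ht
          exact absurd ht (Finset.notMem_empty _)
        · intro X hX t ht
          rw [(he X hX).2] at ht
          exact absurd ht (Finset.notMem_empty _)
        · have h0 := h4 X hX
          rw [hS' _ (fun hm => by have := h4 _ hm; simp only at this; omega)] at ht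
          exact absurd ht (Finset.notMem_empty _)
        · have h0 := h4 X hX
          rw [hS' _ (fun hm => by have := h4 _ hm; simp only at this; omega)] at ht
          exact absurd ht (Finset.notMem_empty _)
    rw [← hcount]
    by_cases hc : P.count 𝔄 e' s₁ = 0
    · rw [den, if_neg (by rw [sat_flag rfl, h₃]; simpa using hc), den, hc, zero_add]
      exact ih
    · rw [den, if_pos (by rw [sat_flag rfl, h₃]; exact hc), den, den, den, add_comm]
      refine congrArg₂ (· + ·) ?_ ih
      rw [← hP.count_congr h₂'] at hc ⊢
      exact hP.counts_guess s₂ hc fun X hX t ht => absurd (Set.mem_univ _) ht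

end Problem

/-! ### Bounds for the loop variables -/

lemma SO.Bounded.anti {φ : SO R} {d d' : ℕ} (h : φ.Bounded d') (hd : d ≤ d') : φ.Bounded d := by
  induction φ generalizing d d' with
  | neg φ ih => exact ih h hd
  | or φ ψ ih₁ ih₂ => exact ⟨ih₁ h.1 hd, ih₂ h.2 hd⟩
  | exFO x φ ih => exact ⟨hd.trans h.1, h.2⟩
  | exSO => exact h
  | _ => trivial

namespace Cmd

lemma Bounded.anti {p : Cmd R} {d d' : ℕ} (h : p.Bounded d') (hd : d ≤ d') : p.Bounded d := by
  induction p generalizing d d' with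
  | ite φ p q ih₁ ih₂ => exact ⟨h.1.anti hd, ih₁ h.2.1 hd, ih₂ h.2.2 hd⟩
  | each x p ih => exact ⟨hd.trans h.1, h.2⟩
  | seq p q ih₁ ih₂ => exact ⟨ih₁ h.1 hd, ih₂ h.2 hd⟩
  | fork p q ih₁ ih₂ => exact ⟨ih₁ h.1 hd, ih₂ h.2 hd⟩
  | _ => trivial

lemma bounded_forAll {p : Cmd R} {d b k : ℕ} (hb : d ≤ b) (hp : p.Bounded (b + k)) :
    (forAll (List.range' b k) p).Bounded d := by
  induction k generalizing d b with
  | zero => exact hp.anti hb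
  | succ k ih => exact ⟨hb, ih le_rfl (by rwa [Nat.add_assoc, Nat.add_comm 1])⟩

lemma bounded_seqs {l : List (Cmd R)} {d : ℕ} (h : ∀ p ∈ l, p.Bounded d) : (seqs l).Bounded d := by
  induction l with
  | nil => trivial
  | cons p l ih =>
    exact ⟨h p List.mem_cons_self, ih fun q hq => h q (List.mem_cons_of_mem _ hq)⟩

lemma bounded_clears {d c : ℕ} (h : d ≤ c) (l : List SOVar) :
    (seqs (l.map (clear c)) : Cmd R).Bounded d :=
  bounded_seqs fun p hp => by
    obtain ⟨X, -, rfl⟩ := List.mem_map.1 hp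
    exact bounded_forAll h trivial

lemma bounded_propagate {d z : ℕ} (h : d ≤ z) {cls : List (Clause R)}
    (hcls : ∀ cl ∈ cls, cl.body.Bounded (z + cl.nz)) : (propagate z cls).Bounded d :=
  bounded_seqs fun p hp => by
    obtain ⟨cl, hcl, rfl⟩ := List.mem_map.1 hp
    exact bounded_forAll h ⟨hcls cl hcl, trivial, trivial⟩

lemma bounded_model {d c z m : ℕ} (hc : d ≤ c) (h : c + m ≤ z) {cls : List (Clause R)}
    {arrs : List SOVar} (hm : ∀ X ∈ arrs, X.arity ≤ m)
    (hcls : ∀ cl ∈ cls, cl.body.Bounded (z + cl.nz)) : (model c z cls arrs).Bounded d := by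
  refine ⟨bounded_clears hc _, bounded_propagate (by omega) hcls, bounded_seqs fun p hp => ?_⟩
  obtain ⟨X, hX, rfl⟩ := List.mem_map.1 hp
  exact bounded_forAll hc (bounded_propagate (by have := hm X hX; omega) hcls)

end Cmd

namespace Problem

variable {P : Problem R}

lemma Wf.bounded_viable (hP : P.Wf) {d : ℕ} (hd : d ≤ P.nx + P.m) : P.viable.Bounded d := by
  refine ⟨trivial, bounded_forAll hd ⟨bounded_model (m := P.m) le_rfl le_rfl ?_ ?_, trivial,
    trivial, trivial⟩⟩
  · intro X hX
    rcases List.mem_cons.1 hX with rfl | hX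
    · exact Nat.zero_le _
    · exact hP.arity_le X hX
  · intro cl hcl
    simp only [ext, List.mem_append, List.mem_map] at hcl
    rcases hcl with hcl | ⟨X, -, rfl⟩ | ⟨X, -, rfl⟩
    · exact hP.bounded cl hcl
    · trivial
    · exact ⟨trivial, trivial⟩

lemma Wf.bounded_main (hP : P.Wf) : P.main.Bounded 0 := by
  refine bounded_forAll le_rfl ⟨bounded_clears (by simp only [c]; omega) _, hP.bounded_viable
    (by omega), trivial, ⟨trivial, bounded_seqs fun p hp => ?_, trivial⟩, trivial⟩
  obtain ⟨X, hX, rfl⟩ := List.mem_map.1 hp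
  have hv := hP.bounded_viable (Nat.add_le_add_left (hP.arity_le X hX) P.nx)
  exact bounded_forAll (by omega) ⟨⟨trivial, trivial⟩, trivial, trivial, hv,
    ⟨trivial, trivial, trivial⟩, trivial, trivial, hv, trivial,
    ⟨trivial, ⟨⟨trivial, trivial⟩, trivial⟩, trivial⟩, trivial, trivial⟩

end Problem

end CountLogic

namespace CountLogic

variable {R : Signature}

/-! ### Rewriting quantitative formulae as sums of simple terms -/

lemma QSO.eval_congr {A : Type*} [Fintype A] [LinearOrder A] {𝔄 : Interp R A} (α : QSO R)
    {e e' : FOAssign A} {s s' : SOAssign A} (he : ∀ x ∈ α.freeFO, e x = e' x)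
    (hs : ∀ X ∈ α.freeSO, s X = s' X) : α.eval 𝔄 e s = α.eval 𝔄 e' s' := by
  have hupd : ∀ {x : FOVar} {S : Set FOVar} {e e' : FOAssign A} (a : A),
      (∀ y ∈ S \ {x}, e y = e' y) →
      ∀ y ∈ S, Function.update e x a y = Function.update e' x a y := by
    intro x S e e' a h y hy
    by_cases hyx : y = x
    · subst hyx; simp
    · rw [Function.update_of_ne hyx, Function.update_of_ne hyx, h y ⟨hy, hyx⟩]
  have hupd' : ∀ {X : SOVar} {S : Set SOVar} {s s' : SOAssign A} (B : Finset (Fin X.arity → A)),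
      (∀ Y ∈ S \ {X}, s Y = s' Y) →
      ∀ Y ∈ S, Function.update s X B Y = Function.update s' X B Y := by
    intro X S s s' B h Y hY
    by_cases hYX : Y = X
    · subst hYX; simp
    · rw [Function.update_of_ne hYX, Function.update_of_ne hYX, h Y ⟨hY, hYX⟩]
  induction α generalizing e e' s s' with
  | bool φ =>
    classical
    exact if_congr (φ.sat_congr he hs) rfl rfl
  | const n => rfl
  | add α β ih₁ ih₂ =>
    exact congrArg₂ (· + ·) (ih₁ (fun x hx => he x (.inl hx)) fun X hX => hs X (.inl hX))
      (ih₂ (fun x hx => he x (.inr hx)) fun X hX => hs X (.inr hX))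
  | mul α β ih₁ ih₂ =>
    exact congrArg₂ (· * ·) (ih₁ (fun x hx => he x (.inl hx)) fun X hX => hs X (.inl hX))
      (ih₂ (fun x hx => he x (.inr hx)) fun X hX => hs X (.inr hX))
  | sumFO x α ih => exact Finset.sum_congr rfl fun a _ => ih (hupd a he) hs
  | prodFO x α ih => exact Finset.prod_congr rfl fun a _ => ih (hupd a he) hs
  | sumSO X α ih => exact Finset.sum_congr rfl fun B _ => ih he (hupd' B hs)
  | prodSO X α ih => exact Finset.prod_congr rfl fun B _ => ih he (hupd' B hs)

/-- A formula with a renaming of its free variables. -/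
structure Renamed (R : Signature) where
  φ : SO R
  ρ : FOVar → ℕ
  σ : SOVar → ℕ

/-- The renamed formula is true. -/
def Renamed.Holds {A : Type*} [LinearOrder A] (𝔄 : Interp R A) (c : Renamed R) (e : FOAssign A)
    (S : SOAssign A) : Prop :=
  c.φ.Sat 𝔄 (fun x => e (c.ρ x)) fun X => S ⟨c.σ X, X.arity⟩

/-- The free variables of the renamed formula are among the given ones. -/
structure Renamed.Over (c : Renamed R) (D : Set FOVar) (arrs : List SOVar) : Prop where
  fo : ∀ x ∈ c.φ.freeFO, c.ρ x ∈ D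
  so : ∀ X ∈ c.φ.freeSO, (⟨c.σ X, X.arity⟩ : SOVar) ∈ arrs

lemma Renamed.Over.holds_congr {A : Type*} [LinearOrder A] {𝔄 : Interp R A} {c : Renamed R}
    {D : Set FOVar} {arrs : List SOVar} (hc : c.Over D arrs) {e e' : FOAssign A}
    {S S' : SOAssign A} (he : ∀ x ∈ D, e x = e' x) (hS : ∀ X ∈ arrs, S X = S' X) :
    c.Holds 𝔄 e S ↔ c.Holds 𝔄 e' S' :=
  SO.sat_congr _ (fun x hx => he _ (hc.fo x hx)) fun X hX => hS _ (hc.so X hX)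

/-- The new name `d` is larger than all names in use, so giving it a value affects the renamed
variable only. -/
lemma update_rename {A : Type*} {d : ℕ} {ρ : FOVar → ℕ} (e : FOAssign A) {D : Set FOVar} {x : FOVar}
    (hρ : ∀ y ∈ D \ {x}, ρ y < d) (a : A) :
    ∀ y ∈ D, Function.update e d a (Function.update ρ x d y) =
      Function.update (fun y => e (ρ y)) x a y := by
  intro y hy
  by_cases hyx : y = x
  · subst hyx; simp
  · rw [Function.update_of_ne hyx, Function.update_of_ne hyx, Function.update_of_ne]
    exact (hρ y ⟨hy, hyx⟩).ne

/-- The relations are numbered consecutively. -/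
def Numbered (l : List SOVar) : Prop :=
  l.map SOVar.idx = (List.range l.length).map fun i => 4 * i + 4

lemma Numbered.concat {l : List SOVar} (h : Numbered l) (n : ℕ) :
    Numbered (l ++ [⟨4 * l.length + 4, n⟩]) := by
  rw [Numbered, List.map_append, h, List.length_append, List.length_singleton, List.range_succ,
    List.map_append]
  rfl

lemma Numbered.nodup {l : List SOVar} (h : Numbered l) : l.Nodup := by
  refine List.Nodup.of_map SOVar.idx ?_
  rw [h]
  refine List.nodup_range.map fun i j (hij : 4 * i + 4 = 4 * j + 4) => ?_
  omega

lemma Numbered.idx {l : List SOVar} (h : Numbered l) {X : SOVar} (hX : X ∈ l) :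
    ∃ i < l.length, X.idx = 4 * i + 4 := by
  have : X.idx ∈ l.map SOVar.idx := List.mem_map_of_mem hX
  rw [h, List.mem_map] at this
  obtain ⟨i, hi, h⟩ := this
  exact ⟨i, List.mem_range.1 hi, h.symm⟩

/-- The sum over `k` first-order variables and the relations `arrs` of the truth value of a
conjunction. -/
structure Term (R : Signature) where
  k : ℕ
  arrs : List SOVar
  cons : List (Renamed R)

namespace Term

/-- The product of terms. -/
def append (T T' : Term R) : Term R := ⟨T.k + T'.k, T.arrs ++ T'.arrs, T.cons ++ T'.cons⟩

/-- The term has the free variables below `d` and the relations `ctx`. -/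
structure Ok (d : ℕ) (ctx : List SOVar) (T : Term R) : Prop where
  scope : ∀ c ∈ T.cons, c.Over {x : ℕ | x < d + T.k} (ctx ++ T.arrs)
  horn : ∀ c ∈ T.cons, c.φ.IsExHorn
  numbered : Numbered (ctx ++ T.arrs)

open Classical in
/-- The truth value of the conjunction. -/
noncomputable def truth {A : Type*} [LinearOrder A] (𝔄 : Interp R A) (T : Term R) (e : FOAssign A)
    (S : SOAssign A) : ℕ :=
  if ∀ c ∈ T.cons, c.Holds 𝔄 e S then 1 else 0

/-- The value of the term. -/
noncomputable def val {A : Type*} [Fintype A] [LinearOrder A] (𝔄 : Interp R A) (T : Term R) (d : ℕ)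
    (e : FOAssign A) (s : SOAssign A) : ℕ :=
  ((envs e (List.range' d T.k)).map fun e' => sumSO T.arrs (T.truth 𝔄 e') s).sum

end Term

/-! ### Interchange of sums over lists and over relations -/

section

variable {A : Type*} [Fintype A] {ι κ : Type*}

lemma sum_map_comm (L : List ι) (M : List κ) (f : ι → κ → ℕ) :
    (L.map fun i => (M.map fun j => f i j).sum).sum =
      (M.map fun j => (L.map fun i => f i j).sum).sum := by
  induction L with
  | nil => simp
  | cons i L ih => simp [ih, List.sum_map_add]

lemma sum_map_flatMap (L : List ι) (g : ι → List κ) (f : κ → ℕ) :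
    ((L.flatMap g).map f).sum = (L.map fun i => ((g i).map f).sum).sum := by
  induction L with
  | nil => rfl
  | cons i L ih => simp [ih]

lemma sum_map_finset_sum [Fintype κ] (L : List ι) (f : ι → κ → ℕ) :
    (L.map fun i => ∑ j, f i j).sum = ∑ j, (L.map fun i => f i j).sum := by
  induction L with
  | nil => simp
  | cons i L ih => simp [ih, Finset.sum_add_distrib]

lemma sumSO_append (l l' : List SOVar) (F : SOAssign A → ℕ) (s : SOAssign A) :
    sumSO (l ++ l') F s = sumSO l (fun S => sumSO l' F S) s := by
  induction l generalizing s with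
  | nil => rfl
  | cons X l ih => exact Finset.sum_congr rfl fun B _ => ih _

lemma sumSO_mul_left (l : List SOVar) (c : ℕ) (F : SOAssign A → ℕ) (s : SOAssign A) :
    sumSO l (fun S => c * F S) s = c * sumSO l F s := by
  induction l generalizing s with
  | nil => rfl
  | cons X l ih => simp only [sumSO, ih, Finset.mul_sum]

lemma sumSO_list_sum (l : List SOVar) (L : List ι) (F : ι → SOAssign A → ℕ) (s : SOAssign A) :
    sumSO l (fun S => (L.map fun i => F i S).sum) s = (L.map fun i => sumSO l (F i) s).sum := by
  induction l generalizing s with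
  | nil => rfl
  | cons X l ih => simp only [sumSO, ih, sum_map_finset_sum]

lemma sum_elems [LinearOrder A] (f : A → ℕ) : ((elems A).map f).sum = ∑ a, f a := by
  rw [← List.sum_toFinset f (nodup_elems A)]
  exact Finset.sum_congr (by ext a; simp [mem_elems]) fun _ _ => rfl

end

namespace Term

variable {A : Type*} [Fintype A] [LinearOrder A] {𝔄 : Interp R A} {e : FOAssign A}
  {s : SOAssign A}

lemma truth_append (T T' : Term R) (S : SOAssign A) :
    (T.append T').truth 𝔄 e S = T.truth 𝔄 e S * T'.truth 𝔄 e S := by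
  classical
  simp only [truth, append, List.mem_append, or_imp, forall_and]
  split_ifs <;> simp_all

lemma Ok.truth_congr {d : ℕ} {ctx : List SOVar} {T : Term R} (hT : T.Ok d ctx) {e' : FOAssign A}
    {S S' : SOAssign A} (he : ∀ x < d + T.k, e x = e' x) (hS : ∀ X ∈ ctx ++ T.arrs, S X = S' X) :
    T.truth 𝔄 e S = T.truth 𝔄 e' S' := by
  classical
  refine if_congr (forall₂_congr fun c hc => ?_) rfl rfl
  exact (hT.scope c hc).holds_congr he hS

/-- This is distributivity. The variables of `T'` are numbered after those of `T`, so its sums can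
be moved inside the sums of `T`, past the truth value of `T`. -/
lemma Ok.val_append {d : ℕ} {ctx : List SOVar} {T T' : Term R} (hT : T.Ok d ctx)
    (hT' : T'.Ok (d + T.k) (ctx ++ T.arrs)) :
    (T.append T').val 𝔄 d e s = ((envs e (List.range' d T.k)).map fun e' =>
      sumSO T.arrs (fun S => T.truth 𝔄 e' S * T'.val 𝔄 (d + T.k) e' S) s).sum := by
  have hr : List.range' d (T.append T').k = List.range' d T.k ++ List.range' (d + T.k) T'.k := by
    rw [append, ← List.range'_append_1]
  rw [val, hr, envs_append, sum_map_flatMap]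
  refine congrArg List.sum (List.map_congr_left fun e' _ => ?_)
  simp only [val, ← List.sum_map_mul_left]
  rw [sumSO_list_sum]
  refine congrArg List.sum (List.map_congr_left fun e'' he'' => ?_)
  have ha : (T.append T').arrs = T.arrs ++ T'.arrs := rfl
  rw [ha, sumSO_append]
  refine sumSO_congr _ fun S _ => ?_
  rw [← sumSO_mul_left]
  refine sumSO_congr _ fun S' hS' => ?_
  -- The truth value of `T` involves neither the first-order variables of `T'`, which start at `d +
  -- T.k`, nor its relations, which are different by the numbering.
  rw [truth_append, hT.truth_congr (e := e'') (e' := e') (S := S') (S' := S)]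
  · intro x hx
    refine mem_envs.1 he'' x fun hx' => ?_
    have := (List.mem_range'_1.1 hx').1
    have hx : (x : ℕ) < d + T.k := hx
    omega
  · exact fun X hX => hS' X fun hX' => List.disjoint_of_nodup_append hT'.numbered.nodup hX hX'

end Term

namespace QSO

/-- The formula as a sum of terms, in a context with the first-order variables below `d` and the
relations `ctx`. -/
def terms : QSO R → ℕ → List SOVar → (FOVar → ℕ) → (SOVar → ℕ) → List (Term R)
  | bool φ, _, _, ρ, σ => [⟨0, [], [⟨φ, ρ, σ⟩]⟩]
  | const n, _, _, _, _ => List.replicate n ⟨0, [], []⟩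
  | add α β, d, ctx, ρ, σ => terms α d ctx ρ σ ++ terms β d ctx ρ σ
  | mul α β, d, ctx, ρ, σ => (terms α d ctx ρ σ).flatMap fun T =>
      (terms β (d + T.k) (ctx ++ T.arrs) ρ σ).map T.append
  | sumFO x α, d, ctx, ρ, σ => (terms α (d + 1) ctx (Function.update ρ x d) σ).map fun T =>
      { T with k := T.k + 1 }
  | sumSO X α, d, ctx, ρ, σ => (terms α d (ctx ++ [⟨4 * ctx.length + 4, X.arity⟩]) ρ
      (Function.update σ X (4 * ctx.length + 4))).map fun T =>
      { T with arrs := ⟨4 * ctx.length + 4, X.arity⟩ :: T.arrs }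
  | prodFO _ _, _, _, _, _ => []
  | prodSO _ _, _, _, _, _ => []

/-- The free variables of the formula are renamed to those of the context. -/
structure InCtx (α : QSO R) (d : ℕ) (ctx : List SOVar) (ρ : FOVar → ℕ) (σ : SOVar → ℕ) :
    Prop where
  fo : ∀ x ∈ α.freeFO, ρ x < d
  so : ∀ X ∈ α.freeSO, (⟨σ X, X.arity⟩ : SOVar) ∈ ctx
  numbered : Numbered ctx

section

variable {α β : QSO R} {d : ℕ} {ctx : List SOVar} {ρ : FOVar → ℕ} {σ : SOVar → ℕ}

lemma InCtx.mono (h : α.InCtx d ctx ρ σ) {d' : ℕ} {l : List SOVar} (hd : d ≤ d')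
    (hn : Numbered (ctx ++ l)) : α.InCtx d' (ctx ++ l) ρ σ :=
  ⟨fun x hx => (h.fo x hx).trans_le hd, fun X hX => List.mem_append_left _ (h.so X hX), hn⟩

lemma InCtx.sumFO {x : FOVar} (h : (QSO.sumFO x α).InCtx d ctx ρ σ) :
    α.InCtx (d + 1) ctx (Function.update ρ x d) σ := by
  refine ⟨fun y hy => ?_, h.so, h.numbered⟩
  by_cases hyx : y = x
  · subst hyx; rw [Function.update_self]; exact Nat.lt_succ_self d
  · rw [Function.update_of_ne hyx]
    exact (h.fo y ⟨hy, hyx⟩).trans (Nat.lt_succ_self d)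

lemma InCtx.sumSO {X : SOVar} (h : (QSO.sumSO X α).InCtx d ctx ρ σ) :
    α.InCtx d (ctx ++ [⟨4 * ctx.length + 4, X.arity⟩]) ρ
      (Function.update σ X (4 * ctx.length + 4)) := by
  refine ⟨h.fo, fun Y hY => ?_, h.numbered.concat _⟩
  by_cases hYX : Y = X
  · subst hYX; rw [Function.update_self]; simp
  · rw [Function.update_of_ne hYX]
    exact List.mem_append_left _ (h.so Y ⟨hY, hYX⟩)

lemma ok_terms (hα : α.IsSigma SO.IsExHorn) (h : α.InCtx d ctx ρ σ) :
    ∀ T ∈ α.terms d ctx ρ σ, T.Ok d ctx := by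
  induction hα generalizing d ctx ρ σ with
  | @bool φ hφ =>
    intro T hT
    obtain rfl := List.mem_singleton.1 hT
    refine ⟨fun c hc => ?_, fun c hc => ?_, by simpa using h.numbered⟩
    · obtain rfl := List.mem_singleton.1 hc
      exact ⟨h.fo, fun X hX => by simpa using h.so X hX⟩
    · obtain rfl := List.mem_singleton.1 hc
      exact hφ
  | const n =>
    intro T hT
    obtain rfl := List.eq_of_mem_replicate hT
    exact ⟨by simp, by simp, by simpa using h.numbered⟩
  | add _ _ ih₁ ih₂ =>
    intro T hT
    rcases List.mem_append.1 hT with hT | hT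
    · exact ih₁ ⟨fun x hx => h.fo x (.inl hx), fun X hX => h.so X (.inl hX), h.numbered⟩ T hT
    · exact ih₂ ⟨fun x hx => h.fo x (.inr hx), fun X hX => h.so X (.inr hX), h.numbered⟩ T hT
  | @mul α β _ _ ih₁ ih₂ =>
    intro T₀ hT₀
    obtain ⟨T, hT, hT₀⟩ := List.mem_flatMap.1 hT₀
    obtain ⟨T', hT', rfl⟩ := List.mem_map.1 hT₀
    have h₁ := ih₁ ⟨fun x hx => h.fo x (.inl hx), fun X hX => h.so X (.inl hX), h.numbered⟩ T hT
    have hβ : β.InCtx d ctx ρ σ :=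
      ⟨fun x hx => h.fo x (.inr hx), fun X hX => h.so X (.inr hX), h.numbered⟩
    have h₂ := ih₂ (hβ.mono (Nat.le_add_right d T.k) h₁.numbered) T' hT'
    refine ⟨fun c hc => ?_, fun c hc => ?_, ?_⟩
    · rcases List.mem_append.1 hc with hc | hc
      · refine ⟨fun x hx => ?_, fun X hX => ?_⟩
        · have : (c.ρ x : ℕ) < d + T.k := (h₁.scope c hc).fo x hx
          show (c.ρ x : ℕ) < d + (T.k + T'.k)
          omega
        · have := (h₁.scope c hc).so X hX
          simp only [Term.append, List.mem_append] at this ⊢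
          tauto
      · refine ⟨fun x hx => ?_, fun X hX => ?_⟩
        · have : (c.ρ x : ℕ) < d + T.k + T'.k := (h₂.scope c hc).fo x hx
          show (c.ρ x : ℕ) < d + (T.k + T'.k)
          omega
        · have := (h₂.scope c hc).so X hX
          simp only [Term.append, List.mem_append] at this ⊢
          tauto
    · rcases List.mem_append.1 hc with hc | hc
      · exact h₁.horn c hc
      · exact h₂.horn c hc
    · have := h₂.numbered
      rwa [List.append_assoc] at this
  | sumFO x _ ih =>
    intro T₀ hT₀
    obtain ⟨T, hT, rfl⟩ := List.mem_map.1 hT₀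
    have h₁ := ih h.sumFO T hT
    refine ⟨fun c hc => ⟨fun y hy => ?_, (h₁.scope c hc).so⟩, h₁.horn, h₁.numbered⟩
    have : (c.ρ y : ℕ) < d + 1 + T.k := (h₁.scope c hc).fo y hy
    show (c.ρ y : ℕ) < d + (T.k + 1)
    omega
  | sumSO X _ ih =>
    intro T₀ hT₀
    obtain ⟨T, hT, rfl⟩ := List.mem_map.1 hT₀
    have h₁ := ih h.sumSO T hT
    refine ⟨fun c hc => ⟨(h₁.scope c hc).fo, fun Y hY => ?_⟩, h₁.horn, ?_⟩
    · have := (h₁.scope c hc).so Y hY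
      rwa [List.append_assoc] at this
    · have := h₁.numbered
      rwa [List.append_assoc] at this

variable {A : Type*} [Fintype A] [LinearOrder A] {𝔄 : Interp R A}

/-- Each quantitative operation becomes an operation on lists of terms: a constant is repetition of
the empty conjunction, addition is concatenation, and multiplication pairs terms in an extended
context. A sum prefixes a fresh variable to each term. -/
theorem sum_terms (hα : α.IsSigma SO.IsExHorn) (h : α.InCtx d ctx ρ σ) (e : FOAssign A)
    (s : SOAssign A) : ((α.terms d ctx ρ σ).map fun T => T.val 𝔄 d e s).sum =
      α.eval 𝔄 (fun x => e (ρ x)) fun X => s ⟨σ X, X.arity⟩ := by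
  classical
  induction hα generalizing d ctx ρ σ e s with
  | bool hφ =>
    simp only [terms, List.map_cons, List.map_nil, List.sum_cons, List.sum_nil, add_zero, Term.val,
      List.range'_zero, envs, CountLogic.sumSO, Term.truth, List.mem_singleton, forall_eq, eval]
    rfl
  | const n => simp [terms, Term.val, envs, CountLogic.sumSO, Term.truth, eval]
  | add _ _ ih₁ ih₂ =>
    rw [terms, List.map_append, List.sum_append,
      ih₁ ⟨fun x hx => h.fo x (.inl hx), fun X hX => h.so X (.inl hX), h.numbered⟩,
      ih₂ ⟨fun x hx => h.fo x (.inr hx), fun X hX => h.so X (.inr hX), h.numbered⟩, eval]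
  | @mul α β h₁ h₂ ih₁ ih₂ =>
    have hα' : α.InCtx d ctx ρ σ :=
      ⟨fun x hx => h.fo x (.inl hx), fun X hX => h.so X (.inl hX), h.numbered⟩
    have hβ : β.InCtx d ctx ρ σ :=
      ⟨fun x hx => h.fo x (.inr hx), fun X hX => h.so X (.inr hX), h.numbered⟩
    rw [terms, sum_map_flatMap, eval, ← ih₁ hα', ← List.sum_map_mul_right]
    refine congrArg List.sum (List.map_congr_left fun T hT => ?_)
    have hT' := ok_terms h₁ hα' T hT
    have hβ' := hβ.mono (Nat.le_add_right d T.k) hT'.numbered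
    rw [List.map_map]
    have e₁ : ((terms β (d + T.k) (ctx ++ T.arrs) ρ σ).map
        ((fun T => T.val 𝔄 d e s) ∘ T.append)) =
        (terms β (d + T.k) (ctx ++ T.arrs) ρ σ).map fun T' =>
        ((envs e (List.range' d T.k)).map fun e' =>
        CountLogic.sumSO T.arrs (fun S => T.truth 𝔄 e' S * T'.val 𝔄 (d + T.k) e' S) s).sum :=
      List.map_congr_left fun T' hT'' => hT'.val_append (ok_terms h₂ hβ' T' hT'')
    rw [e₁, sum_map_comm, Term.val, ← List.sum_map_mul_right]
    refine congrArg List.sum (List.map_congr_left fun e' he' => ?_)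
    rw [← sumSO_list_sum, mul_comm, ← sumSO_mul_left]
    refine sumSO_congr _ fun S hS => ?_
    rw [List.sum_map_mul_left, ih₂ hβ', mul_comm]
    -- The free variables of `β` belong to the old context. So its value is the same for all values
    -- of the variables that `T` sums over, and it factors out.
    refine congrArg (· * _) (eval_congr _ (fun x hx => mem_envs.1 he' _ fun hx' => ?_)
      fun X hX => hS _ fun hX' => ?_)
    · have h₁ : (ρ x : ℕ) < d := hβ.fo x hx
      have := (List.mem_range'_1.1 hx').1
      omega
    · exact List.disjoint_of_nodup_append hT'.numbered.nodup (hβ.so X hX) hX'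
  | sumFO x _ ih =>
    rw [terms, List.map_map, eval, ← sum_elems]
    have e₁ : ∀ T : Term R, ((fun T => T.val 𝔄 d e s) ∘ fun T : Term R =>
        { T with k := T.k + 1 }) T =
        ((elems A).map fun a => T.val 𝔄 (d + 1) (Function.update e d a) s).sum := by
      intro T
      simp only [Function.comp_apply, Term.val, List.range'_succ, envs, sum_map_flatMap]
      rfl
    rw [List.map_congr_left fun T _ => e₁ T, sum_map_comm]
    refine congrArg List.sum (List.map_congr_left fun a _ => ?_)
    rw [ih h.sumFO]
    exact eval_congr _ (update_rename e h.fo a) fun _ _ => rfl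
  | sumSO X _ ih =>
    rw [terms, List.map_map, eval]
    have e₁ : ∀ T : Term R, ((fun T => T.val 𝔄 d e s) ∘ fun T : Term R =>
        { T with arrs := ⟨4 * ctx.length + 4, X.arity⟩ :: T.arrs }) T =
        ∑ B : Finset (Fin X.arity → A), T.val 𝔄 d e
          (Function.update s ⟨4 * ctx.length + 4, X.arity⟩ B) := by
      intro T
      simp only [Function.comp_apply, Term.val, CountLogic.sumSO]
      exact sum_map_finset_sum _ _
    rw [List.map_congr_left fun T _ => e₁ T, sum_map_finset_sum]
    refine Finset.sum_congr rfl fun B _ => ?_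
    rw [ih h.sumSO]
    refine eval_congr _ (fun _ _ => rfl) fun Y hY => ?_
    by_cases hYX : Y = X
    · subst hYX
      -- The type of a relation depends on the variable. The index is generalised to `j` because it
      -- cannot be rewritten in place.
      have key : ∀ j, j = 4 * ctx.length + 4 →
          Function.update s ⟨4 * ctx.length + 4, Y.arity⟩ B ⟨j, Y.arity⟩ = B := by
        rintro j rfl
        exact Function.update_self ..
      have h₁ := key _ (Function.update_self Y (4 * ctx.length + 4) σ)
      have h₂ : Function.update (fun X => s ⟨σ X, X.arity⟩ : SOAssign A) Y B Y = B :=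
        Function.update_self ..
      exact h₁.trans h₂.symm
    · have key : ∀ j, j = σ Y →
          Function.update s ⟨4 * ctx.length + 4, X.arity⟩ B ⟨j, Y.arity⟩ = s ⟨σ Y, Y.arity⟩ := by
        rintro j rfl
        refine Function.update_of_ne (fun heq => ?_) ..
        obtain ⟨i, hi, hi'⟩ := h.numbered.idx (h.so Y ⟨hY, hYX⟩)
        have := congrArg SOVar.idx heq
        simp only at this hi'
        omega
      have h₁ := key _ (Function.update_of_ne hYX (4 * ctx.length + 4) σ)
      have h₂ : Function.update (fun X => s ⟨σ X, X.arity⟩ : SOAssign A) X B Y = s ⟨σ Y, Y.arity⟩ :=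
        Function.update_of_ne hYX ..
      exact h₁.trans h₂.symm

end

end QSO

end CountLogic

namespace CountLogic

universe u

variable {R : Signature}

open SOVar

/-! ### Renaming of variables -/

namespace SO

/-- Second-order quantifiers do not occur. -/
def NoSO : SO R → Prop
  | neg φ => NoSO φ
  | or φ ψ => NoSO φ ∧ NoSO ψ
  | exFO _ φ => NoSO φ
  | exSO _ _ => False
  | _ => True

lemma IsFO.noSO {φ : SO R} (h : φ.IsFO) : φ.NoSO := by
  induction h with
  | neg _ ih => exact ih
  | or _ _ ih₁ ih₂ => exact ⟨ih₁, ih₂⟩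
  | exFO _ _ ih => exact ih
  | _ => trivial

lemma IsNegLit.noSO {φ : SO R} (h : φ.IsNegLit) : φ.NoSO := by
  induction h with
  | app => trivial
  | exFO _ _ ih => exact ih

lemma IsLitDisj.noSO {p : ℕ} {φ : SO R} (h : φ.IsLitDisj p) : φ.NoSO := by
  induction h with
  | pos => trivial
  | negLit h => exact h.noSO
  | fo h => exact h.noSO
  | or _ _ ih₁ ih₂ => exact ⟨ih₁, ih₂⟩

/-- Rename the free variables and let the bound variables increase inwards from `d` on. -/
def rename : SO R → (FOVar → ℕ) → (SOVar → ℕ) → ℕ → SO R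
  | eq x y, ρ, _, _ => eq (ρ x) (ρ y)
  | lt x y, ρ, _, _ => lt (ρ x) (ρ y)
  | rel i u, ρ, _, _ => rel i fun j => ρ (u j)
  | top, _, _, _ => top
  | app X u, ρ, σ, _ => app ⟨σ X, X.arity⟩ fun j => ρ (u j)
  | neg φ, ρ, σ, d => neg (rename φ ρ σ d)
  | or φ ψ, ρ, σ, d => or (rename φ ρ σ d) (rename ψ ρ σ d)
  | exFO x φ, ρ, σ, d => exFO d (rename φ (Function.update ρ x d) σ (d + 1))
  | exSO _ _, _, _, _ => top

variable {φ : SO R} {ρ : FOVar → ℕ} {σ : SOVar → ℕ} {d : ℕ}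

lemma bounded_rename : (φ.rename ρ σ d).Bounded d := by
  induction φ generalizing ρ d with
  | neg φ ih => exact ih
  | or φ ψ ih₁ ih₂ => exact ⟨ih₁, ih₂⟩
  | exFO x φ ih => exact ⟨le_rfl, ih⟩
  | _ => trivial

lemma freeFO_rename : ∀ y ∈ (φ.rename ρ σ d).freeFO, ∃ x ∈ φ.freeFO, ρ x = y := by
  induction φ generalizing ρ d with
  | eq x y => rintro _ (rfl | rfl) <;> simp [freeFO]
  | lt x y => rintro _ (rfl | rfl) <;> simp [freeFO]
  | rel i u => rintro _ ⟨j, rfl⟩; exact ⟨u j, ⟨j, rfl⟩, rfl⟩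
  | app X u => rintro _ ⟨j, rfl⟩; exact ⟨u j, ⟨j, rfl⟩, rfl⟩
  | top => exact fun y hy => hy.elim
  | exSO => exact fun y hy => hy.elim
  | neg φ ih => exact ih
  | or φ ψ ih₁ ih₂ =>
    rintro y (hy | hy)
    · obtain ⟨x, hx, h⟩ := ih₁ y hy
      exact ⟨x, .inl hx, h⟩
    · obtain ⟨x, hx, h⟩ := ih₂ y hy
      exact ⟨x, .inr hx, h⟩
  | exFO z φ ih =>
    rintro y ⟨hy, hyd⟩
    obtain ⟨x, hx, h⟩ := ih y hy
    have hxz : x ≠ z := by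
      rintro rfl
      rw [Function.update_self] at h
      exact hyd h.symm
    rw [Function.update_of_ne hxz] at h
    exact ⟨x, ⟨hx, hxz⟩, h⟩

lemma freeSO_rename :
    ∀ Y ∈ (φ.rename ρ σ d).freeSO, ∃ X ∈ φ.freeSO, (⟨σ X, X.arity⟩ : SOVar) = Y := by
  induction φ generalizing ρ d with
  | app X u => rintro _ rfl; exact ⟨X, rfl, rfl⟩
  | neg φ ih => exact ih
  | or φ ψ ih₁ ih₂ =>
    rintro y (hy | hy)
    · obtain ⟨x, hx, h⟩ := ih₁ y hy
      exact ⟨x, .inl hx, h⟩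
    · obtain ⟨x, hx, h⟩ := ih₂ y hy
      exact ⟨x, .inr hx, h⟩
  | exFO z φ ih => exact ih
  | _ => exact fun y hy => hy.elim

/-- Bound variables get names from `d` on and free ones have names below `d`, so nothing is
captured. -/
lemma sat_rename {A : Type*} [LinearOrder A] {𝔄 : Interp R A} (hφ : φ.NoSO)
    (hρ : ∀ x ∈ φ.freeFO, ρ x < d) {e : FOAssign A} {S : SOAssign A} :
    (φ.rename ρ σ d).Sat 𝔄 e S ↔ φ.Sat 𝔄 (fun x => e (ρ x)) fun X => S ⟨σ X, X.arity⟩ := by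
  induction φ generalizing ρ d e with
  | exSO => exact hφ.elim
  | neg φ ih => exact not_congr (ih hφ hρ)
  | or φ ψ ih₁ ih₂ =>
    exact or_congr (ih₁ hφ.1 fun x hx => hρ x (.inl hx)) (ih₂ hφ.2 fun x hx => hρ x (.inr hx))
  | exFO x φ ih =>
    refine exists_congr fun a => (ih hφ fun y hy => ?_).trans
      (sat_congr _ (update_rename e hρ a) fun _ _ => rfl)
    by_cases hyx : y = x
    · subst hyx; rw [Function.update_self]; exact Nat.lt_succ_self d
    · rw [Function.update_of_ne hyx]
      exact (hρ y ⟨hy, hyx⟩).trans (Nat.lt_succ_self d)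
  | _ => rfl

lemma IsFO.rename (h : φ.IsFO) : (φ.rename ρ σ d).IsFO := by
  induction h generalizing ρ d with
  | eq => exact .eq _ _
  | lt => exact .lt _ _
  | rel => exact .rel _ _
  | top => exact .top
  | neg _ ih => exact .neg ih
  | or _ _ ih₁ ih₂ => exact .or ih₁ ih₂
  | exFO _ _ ih => exact .exFO _ ih

lemma IsNegLit.rename (h : φ.IsNegLit) : (φ.rename ρ σ d).IsNegLit := by
  induction h generalizing ρ d with
  | app => exact .app _ _
  | exFO _ _ ih => exact .exFO _ ih

lemma IsLitDisj.rename {p : ℕ} (h : φ.IsLitDisj p) : (φ.rename ρ σ d).IsLitDisj p := by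
  induction h with
  | pos => exact .pos _ _
  | negLit h => exact .negLit h.rename
  | fo h => exact .fo h.rename
  | or _ _ ih₁ ih₂ => exact .or ih₁ ih₂

/-- The positive literal can be separated from the others. -/
lemma IsLitDisj.split {p : ℕ} (h : φ.IsLitDisj p) (hp : p ≤ 1) : p = 0 ∨
    ∃ (ψ : SO R) (X : SOVar) (u : Fin X.arity → FOVar), ψ.IsLitDisj 0 ∧
      (∀ x ∈ ψ.freeFO, x ∈ φ.freeFO) ∧ (∀ Y ∈ ψ.freeSO, Y ∈ φ.freeSO) ∧
      (∀ j, u j ∈ φ.freeFO) ∧ X ∈ φ.freeSO ∧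
      ∀ {A : Type u} [LinearOrder A] (𝔄 : Interp R A) (e : FOAssign A) (S : SOAssign A),
        φ.Sat 𝔄 e S ↔ ψ.Sat 𝔄 e S ∨ (fun j => e (u j)) ∈ S X := by
  induction h with
  | pos X u =>
    -- The false formula `¬⊤` stands for the empty rest of the disjunction.
    exact .inr ⟨.neg .top, X, u, .fo (.neg .top), fun x hx => hx.elim, fun x hx => hx.elim,
      fun j => ⟨j, rfl⟩, rfl, fun 𝔄 e S => by simp [Sat]⟩
  | negLit => exact .inl rfl
  | fo => exact .inl rfl
  | @or p q φ₁ φ₂ h₁ h₂ ih₁ ih₂ =>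
    by_cases hq : q = 0
    · subst hq
      refine (ih₁ (by omega)).imp id ?_
      rintro ⟨ψ, X, u, hψ, h₃, h₄, h₅, h₆, h₇⟩
      refine ⟨.or ψ φ₂, X, u, .or hψ h₂, fun x hx => hx.imp (h₃ x) id,
        fun Y hY => hY.imp (h₄ Y) id, fun j => .inl (h₅ j), .inl h₆, fun 𝔄 e S => ?_⟩
      exact (or_congr_left (h₇ 𝔄 e S)).trans or_right_comm
    · obtain rfl : p = 0 := by omega
      obtain ⟨ψ, X, u, hψ, h₃, h₄, h₅, h₆, h₇⟩ := (ih₂ (by omega)).resolve_left hq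
      refine .inr ⟨.or φ₁ ψ, X, u, .or h₁ hψ, fun x hx => hx.imp id (h₃ x),
        fun Y hY => hY.imp id (h₄ Y), fun j => .inr (h₅ j), .inr h₆, fun 𝔄 e S => ?_⟩
      exact (or_congr_right (h₇ 𝔄 e S)).trans or_assoc.symm

end SO

/-! ### Terms as problems -/

/-- The conditions on the clauses of a problem, for clause variables from `z` on. -/
structure Clause.Good (H : Set FOVar) (arrs : List SOVar) (z : ℕ) (cl : Clause R) : Prop where
  ok : cl.Ok H (bad :: arrs)
  free : ∀ X ∈ cl.body.freeSO, X ∈ arrs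
  bounded : cl.body.Bounded (z + cl.nz)

variable {H : Set FOVar} {arrs : List SOVar} {d : ℕ}

/-- A positive literal becomes the head. Without one the head is `bad`, which adds nothing to the
disjunction as `bad` is empty. Each universal quantifier takes the next variable from `d` on. -/
lemma SO.IsHornClause.exists_clause {φ : SO R} (hφ : φ.IsHornClause) {ρ : FOVar → ℕ}
    {σ : SOVar → ℕ} (hc : (⟨φ, ρ, σ⟩ : Renamed R).Over {x : ℕ | x < d ∧ x ∉ H} arrs)
    (hH : ∀ x : ℕ, d ≤ x → x ∉ H) : ∃ cl : Clause R, cl.Good H arrs d ∧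
      ∀ {A : Type u} [Fintype A] [LinearOrder A] (𝔄 : Interp R A) (e : FOAssign A)
        (S : SOAssign A), S bad = ∅ → ((⟨φ, ρ, σ⟩ : Renamed R).Holds 𝔄 e S ↔
          ∀ e' ∈ envs e (List.range' d cl.nz), cl.Holds 𝔄 e' S) := by
  induction hφ generalizing ρ d with
  | @body p φ hp hφ =>
    have hlt : ∀ x ∈ φ.freeFO, ρ x < d := fun x hx => (hc.fo x hx).1
    rcases hφ.split hp with rfl | ⟨ψ, X, u, hψ, h₃, h₄, h₅, h₆, h₇⟩
    · refine ⟨⟨0, φ.rename ρ σ d, bad, Fin.elim0⟩, ⟨⟨hφ.rename, ?_, fun j => j.elim0,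
        List.mem_cons_self⟩, ?_, SO.bounded_rename⟩, fun 𝔄 e S hS => ?_⟩
      · intro y hy
        obtain ⟨x, hx, rfl⟩ := SO.freeFO_rename y hy
        exact (hc.fo x hx).2
      · intro Y hY
        obtain ⟨X, hX, rfl⟩ := SO.freeSO_rename Y hY
        exact hc.so X hX
      · simp only [List.range'_zero, envs, List.mem_singleton, forall_eq, Clause.Holds,
          SO.sat_rename hφ.noSO hlt]
        rw [hS]
        exact (or_iff_left (Finset.notMem_empty _)).symm
    · refine ⟨⟨0, ψ.rename ρ σ d, ⟨σ X, X.arity⟩, fun j => ρ (u j)⟩, ⟨⟨hψ.rename, ?_,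
        fun j => (hc.fo _ (h₅ j)).2, List.mem_cons_of_mem _ (hc.so X h₆)⟩, ?_,
        SO.bounded_rename⟩, fun 𝔄 e S hS => ?_⟩
      · intro y hy
        obtain ⟨x, hx, rfl⟩ := SO.freeFO_rename y hy
        exact (hc.fo x (h₃ x hx)).2
      · intro Y hY
        obtain ⟨X, hX, rfl⟩ := SO.freeSO_rename Y hY
        exact hc.so X (h₄ X hX)
      · simp only [List.range'_zero, envs, List.mem_singleton, forall_eq, Clause.Holds,
          SO.sat_rename hψ.noSO fun x hx => hlt x (h₃ x hx)]
        exact h₇ 𝔄 _ _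
  | @all x φ _ ih =>
    have hc' : (⟨φ, Function.update ρ x d, σ⟩ : Renamed R).Over {x : ℕ | x < d + 1 ∧ x ∉ H} arrs := by
      refine ⟨fun y hy => ?_, hc.so⟩
      simp only
      by_cases hyx : y = x
      · subst hyx
        rw [Function.update_self]
        exact ⟨Nat.lt_succ_self d, hH d le_rfl⟩
      · rw [Function.update_of_ne hyx]
        have h := hc.fo y ⟨hy, hyx⟩
        exact ⟨h.1.trans (Nat.lt_succ_self d), h.2⟩
    obtain ⟨cl, hcl, h⟩ := ih hc' fun y hy => hH y (by omega)
    refine ⟨{ cl with nz := cl.nz + 1 }, ⟨⟨hcl.ok.lit, hcl.ok.free, hcl.ok.args, hcl.ok.mem⟩,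
      hcl.free, ?_⟩, fun 𝔄 e S hS => ?_⟩
    · have := hcl.bounded
      rwa [Nat.add_assoc, Nat.add_comm 1] at this
    · have e₁ : (⟨SO.allFO x φ, ρ, σ⟩ : Renamed R).Holds 𝔄 e S ↔ ∀ a,
          (⟨φ, Function.update ρ x d, σ⟩ : Renamed R).Holds 𝔄 (Function.update e d a) S := by
        simp only [Renamed.Holds, SO.allFO, SO.Sat, not_exists, not_not]
        exact forall_congr' fun a => SO.sat_congr _ (fun y hy => (update_rename e
          (fun y hy => (hc.fo y hy).1) a y hy).symm) fun _ _ => rfl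
      rw [e₁]
      simp only [List.range'_succ, envs, List.mem_flatMap, forall_exists_index, and_imp]
      constructor
      · exact fun h' e' a _ he' => (h 𝔄 _ S hS).1 (h' a) e' he'
      · exact fun h' a => (h 𝔄 _ S hS).2 fun e' he' => h' e' a (mem_elems a) he'

lemma Full.append {A : Type*} [Fintype A] [LinearOrder A] {𝔄 : Interp R A} {e : FOAssign A}
    {S : SOAssign A} {l l' : List (Clause R)} :
    Full 𝔄 d (l ++ l') e S ↔ Full 𝔄 d l e S ∧ Full 𝔄 d l' e S := by
  simp only [Full, List.mem_append, or_imp, forall_and]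

lemma SO.IsHorn.exists_clauses {φ : SO R} (hφ : φ.IsHorn) {ρ : FOVar → ℕ}
    {σ : SOVar → ℕ} (hc : (⟨φ, ρ, σ⟩ : Renamed R).Over {x : ℕ | x < d ∧ x ∉ H} arrs)
    (hH : ∀ x : ℕ, d ≤ x → x ∉ H) : ∃ cls : List (Clause R), (∀ cl ∈ cls, cl.Good H arrs d) ∧
      ∀ {A : Type u} [Fintype A] [LinearOrder A] (𝔄 : Interp R A) (e : FOAssign A)
        (S : SOAssign A), S bad = ∅ →
          ((⟨φ, ρ, σ⟩ : Renamed R).Holds 𝔄 e S ↔ Full 𝔄 d cls e S) := by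
  induction hφ with
  | clause hφ =>
    obtain ⟨cl, hcl, h⟩ := hφ.exists_clause hc hH
    refine ⟨[cl], fun cl' hcl' => ?_, fun 𝔄 e S hS => ?_⟩
    · rwa [List.mem_singleton.1 hcl']
    · rw [h 𝔄 e S hS]
      simp [Full]
  | @and φ ψ _ _ ih₁ ih₂ =>
    obtain ⟨l₁, hl₁, h₁⟩ := ih₁ ⟨fun x hx => hc.fo x (.inl hx), fun X hX => hc.so X (.inl hX)⟩
    obtain ⟨l₂, hl₂, h₂⟩ := ih₂ ⟨fun x hx => hc.fo x (.inr hx), fun X hX => hc.so X (.inr hX)⟩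
    refine ⟨l₁ ++ l₂, fun cl hcl => (List.mem_append.1 hcl).elim (hl₁ cl) (hl₂ cl),
      fun 𝔄 e S hS => ?_⟩
    rw [Full.append, ← h₁ 𝔄 e S hS, ← h₂ 𝔄 e S hS]
    simp only [Renamed.Holds, SO.and, SO.Sat, not_or, not_not]

lemma exists_clauses (cs : List (Renamed R)) (hcs : ∀ c ∈ cs, c.φ.IsHorn)
    (hc : ∀ c ∈ cs, c.Over {x : ℕ | x < d ∧ x ∉ H} arrs)
    (hH : ∀ x : ℕ, d ≤ x → x ∉ H) : ∃ cls : List (Clause R), (∀ cl ∈ cls, cl.Good H arrs d) ∧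
      ∀ {A : Type u} [Fintype A] [LinearOrder A] (𝔄 : Interp R A) (e : FOAssign A)
        (S : SOAssign A), S bad = ∅ → ((∀ c ∈ cs, c.Holds 𝔄 e S) ↔ Full 𝔄 d cls e S) := by
  induction cs with
  | nil => exact ⟨[], by simp, by simp [Full]⟩
  | cons c cs ih =>
    obtain ⟨l₁, hl₁, h₁⟩ := (hcs c List.mem_cons_self).exists_clauses (hc c List.mem_cons_self) hH
    obtain ⟨l₂, hl₂, h₂⟩ := ih (fun c h => hcs c (List.mem_cons_of_mem _ h))
      fun c h => hc c (List.mem_cons_of_mem _ h)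
    refine ⟨l₁ ++ l₂, fun cl hcl => (List.mem_append.1 hcl).elim (hl₁ cl) (hl₂ cl),
      fun 𝔄 e S hS => ?_⟩
    rw [Full.append, ← h₁ 𝔄 e S hS, ← h₂ 𝔄 e S hS, List.forall_mem_cons]

/-- The existential quantifiers become quantifiers over consecutive variables. -/
lemma SO.IsExHorn.exists_horn {φ : SO R} (hφ : φ.IsExHorn) {ρ : FOVar → ℕ}
    {σ : SOVar → ℕ} (hc : (⟨φ, ρ, σ⟩ : Renamed R).Over {x : ℕ | x < d ∧ x ∉ H} arrs)
    (hH : ∀ x : ℕ, d ≤ x → x ∉ H) : ∃ (k : ℕ) (c : Renamed R), c.φ.IsHorn ∧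
      c.Over {x : ℕ | x < d + k ∧ x ∉ H} arrs ∧
      ∀ {A : Type u} [Fintype A] [LinearOrder A] (𝔄 : Interp R A) (e : FOAssign A)
        (S : SOAssign A), (⟨φ, ρ, σ⟩ : Renamed R).Holds 𝔄 e S ↔
          ∃ e' ∈ envs e (List.range' d k), c.Holds 𝔄 e' S := by
  induction hφ generalizing ρ d with
  | horn hφ => exact ⟨0, ⟨_, ρ, σ⟩, hφ, hc, fun 𝔄 e S => by simp [envs]⟩
  | @ex x φ _ ih =>
    have hc' : (⟨φ, Function.update ρ x d, σ⟩ : Renamed R).Over {x : ℕ | x < d + 1 ∧ x ∉ H} arrs := by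
      refine ⟨fun y hy => ?_, hc.so⟩
      simp only
      by_cases hyx : y = x
      · subst hyx
        rw [Function.update_self]
        exact ⟨Nat.lt_succ_self d, hH d le_rfl⟩
      · rw [Function.update_of_ne hyx]
        have h := hc.fo y ⟨hy, hyx⟩
        exact ⟨h.1.trans (Nat.lt_succ_self d), h.2⟩
    obtain ⟨k, c, hh, ho, h⟩ := ih hc' fun y hy => hH y (by omega)
    refine ⟨k + 1, c, hh, ?_, fun 𝔄 e S => ?_⟩
    · rwa [Nat.add_assoc, Nat.add_comm 1] at ho
    · have e₁ : (⟨SO.exFO x φ, ρ, σ⟩ : Renamed R).Holds 𝔄 e S ↔ ∃ a,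
          (⟨φ, Function.update ρ x d, σ⟩ : Renamed R).Holds 𝔄 (Function.update e d a) S :=
        exists_congr fun a => SO.sat_congr _ (fun y hy => (update_rename e
          (fun y hy => (hc.fo y hy).1) a y hy).symm) fun _ _ => rfl
      rw [e₁]
      simp only [List.range'_succ, envs, List.mem_flatMap, h]
      constructor
      · rintro ⟨a, e', he', h'⟩
        exact ⟨e', ⟨a, mem_elems a, he'⟩, h'⟩
      · rintro ⟨e', ⟨a, -, he'⟩, h'⟩
        exact ⟨a, e', he', h'⟩

/-- The witnesses of different conjuncts occupy disjoint blocks of variables, so the existential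
quantifiers can be moved in front of the conjunction. -/
lemma exists_horns (cs : List (Renamed R)) (hcs : ∀ c ∈ cs, c.φ.IsExHorn)
    (hc : ∀ c ∈ cs, c.Over {x : ℕ | x < d ∧ x ∉ H} arrs)
    (hH : ∀ x : ℕ, d ≤ x → x ∉ H) : ∃ (k : ℕ) (cs' : List (Renamed R)),
      (∀ c ∈ cs', c.φ.IsHorn) ∧ (∀ c ∈ cs', c.Over {x : ℕ | x < d + k ∧ x ∉ H} arrs) ∧
      ∀ {A : Type u} [Fintype A] [LinearOrder A] (𝔄 : Interp R A) (e : FOAssign A)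
        (S : SOAssign A), (∀ c ∈ cs, c.Holds 𝔄 e S) ↔
          ∃ e' ∈ envs e (List.range' d k), ∀ c ∈ cs', c.Holds 𝔄 e' S := by
  induction cs generalizing d with
  | nil => exact ⟨0, [], by simp, by simp, by simp [envs]⟩
  | cons c cs ih =>
    obtain ⟨k₁, c', hh₁, ho₁, h₁⟩ := (hcs c List.mem_cons_self).exists_horn
      (hc c List.mem_cons_self) hH
    have hcs' : ∀ c ∈ cs, c.Over {x : ℕ | x < d ∧ x ∉ H} arrs := fun c h =>
      hc c (List.mem_cons_of_mem _ h)
    obtain ⟨k₂, cs', hh₂, ho₂, h₂⟩ := ih (d := d + k₁)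
      (fun c h => hcs c (List.mem_cons_of_mem _ h))
      (fun c h => ⟨fun x hx => ⟨((hcs' c h).fo x hx).1.trans_le (Nat.le_add_right _ _),
        ((hcs' c h).fo x hx).2⟩, (hcs' c h).so⟩) fun x hx => hH x (by omega)
    refine ⟨k₁ + k₂, c' :: cs', ?_, ?_, fun {A} _ _ 𝔄 e S => ?_⟩
    · exact List.forall_mem_cons.2 ⟨hh₁, hh₂⟩
    · refine List.forall_mem_cons.2 ⟨⟨fun x hx => ⟨?_, (ho₁.fo x hx).2⟩, ho₁.so⟩, ?_⟩
      · have := (ho₁.fo x hx).1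
        omega
      · rwa [Nat.add_assoc] at ho₂
    · rw [← List.range'_append_1, envs_append]
      simp only [List.forall_mem_cons, List.mem_flatMap]
      have agree : ∀ {e e' : FOAssign A} {b k : ℕ}, e' ∈ envs e (List.range' b k) →
          ∀ x ∈ {x : ℕ | x < b ∧ x ∉ H}, e' x = e x := fun he' x hx =>
        mem_envs.1 he' x fun hx' => by
          have h₁ := (List.mem_range'_1.1 hx').1
          have h₂ : x < _ := hx.1
          omega
      constructor
      · rintro ⟨hc₁, hc₂⟩
        obtain ⟨e', he', hc'⟩ := (h₁ 𝔄 e S).1 hc₁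
        obtain ⟨e'', he'', hcs''⟩ := (h₂ 𝔄 e' S).1 fun c h =>
          ((hcs' c h).holds_congr (agree he') fun _ _ => rfl).2 (hc₂ c h)
        exact ⟨e'', ⟨e', he', he''⟩, (ho₁.holds_congr (agree he'') fun _ _ => rfl).2 hc', hcs''⟩
      · rintro ⟨e'', ⟨e', he', he''⟩, hc', hcs''⟩
        refine ⟨(h₁ 𝔄 e S).2 ⟨e', he', (ho₁.holds_congr (agree he'') fun _ _ => rfl).1 hc'⟩,
          fun c h => ((hcs' c h).holds_congr (agree he') fun _ _ => rfl).1 ?_⟩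
        exact (h₂ 𝔄 e' S).2 ⟨e'', he'', hcs''⟩ c h

/-- Existential variables are placed after the first hidden block, clause variables after the second
one. The numbering of the relations yields the residues that `Problem.Wf` asks for. -/
lemma Term.Ok.exists_problem {T : Term R} (hT : T.Ok 0 []) : ∃ P : Problem R, P.Wf ∧
    ∀ {A : Type u} [Fintype A] [LinearOrder A] (𝔄 : Interp R A) (e : FOAssign A),
      P.value 𝔄 e = T.val 𝔄 0 e fun _ => ∅ := by
  classical
  -- The sum of the arities serves as a bound for each of them.
  set m := (T.arrs.map SOVar.arity).sum with hm
  have hs := hT.scope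
  simp only [List.nil_append, zero_add] at hs
  obtain ⟨ny, cs, hh, ho, h⟩ := exists_horns (d := T.k + m)
    (H := {x : ℕ | T.k ≤ x ∧ x < T.k + m}) (arrs := T.arrs) T.cons hT.horn
    (fun c hc => ⟨fun x hx => by
      have h₁ : c.ρ x < T.k := (hs c hc).fo x hx
      exact ⟨by omega, fun h₂ => by have := h₂.1; omega⟩, (hs c hc).so⟩)
    fun x hx h₂ => by have := h₂.2; omega
  let c := T.k + m + ny
  obtain ⟨cls, hcls, h'⟩ := exists_clauses (d := c + m)
    (H := {x : ℕ | T.k ≤ x ∧ x < T.k + m ∨ c ≤ x ∧ x < c + m}) (arrs := T.arrs) cs hh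
    (fun c' hc => ⟨fun x hx => by
      obtain ⟨h₁, h₂⟩ := (ho c' hc).fo x hx
      exact ⟨by omega, fun h₃ => h₃.elim h₂ fun h₄ => by have := h₄.1; omega⟩, (ho c' hc).so⟩)
    fun x hx h₂ => by
      rcases h₂ with ⟨-, h₂⟩ | ⟨-, h₂⟩ <;> omega
  have hn : Numbered T.arrs := hT.numbered
  refine ⟨⟨T.k, m, ny, T.arrs, cls⟩, ⟨hn.nodup, fun X hX => ?_, fun X hX => ?_, fun X hX => ?_,
    fun cl hcl => (hcls cl hcl).ok, fun cl hcl => (hcls cl hcl).free,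
    fun cl hcl => (hcls cl hcl).bounded⟩, fun 𝔄 e => ?_⟩
  · obtain ⟨i, -, hi⟩ := hn.idx hX
    simp only at *
    omega
  · obtain ⟨i, -, hi⟩ := hn.idx hX
    omega
  · exact List.single_le_sum (fun _ _ => Nat.zero_le _) _ (List.mem_map_of_mem hX)
  · refine congrArg List.sum (List.map_congr_left fun e' _ => sumSO_congr _ fun S hS => ?_)
    have hb : S bad = ∅ := hS _ fun hb => by
      obtain ⟨i, -, hi⟩ := hn.idx hb
      simp at hi
    refine if_congr ?_ rfl rfl
    rw [h 𝔄 e' S]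
    exact exists_congr fun e'' => and_congr_right fun _ => (h' 𝔄 e'' S hb).symm

/-! ### The program for a sentence -/

/-- The programs of the terms are run one after the other. Each adds its value to the constant run
count of what follows, and the empty program at the end contributes the additional run. -/
theorem QSO.exists_cmd {α : QSO R} (hα : α.IsSigma SO.IsExHorn) (hs : α.IsSentence) :
    ∃ p : Cmd R, p.Bounded 0 ∧ ∀ {A : Type u} [Fintype A] [LinearOrder A] (𝔄 : Interp R A)
      (e : FOAssign A) (v : FOAssign A) (V : SOAssign A),
        p.den 𝔄 e (fun _ => 1) (fun _ => ∅) = α.eval 𝔄 v V + 1 := by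
  -- A sentence has no free variables, so constant renamings are admissible in the empty context.
  have hctx : α.InCtx 0 [] (fun _ => 0) (fun _ => 0) :=
    ⟨by simp [hs.1], by simp [hs.2], rfl⟩
  have key : ∀ L : List (Term R), (∀ T ∈ L, T.Ok 0 []) → ∃ p : Cmd R, p.Bounded 0 ∧
      ∀ {A : Type u} [Fintype A] [LinearOrder A] (𝔄 : Interp R A) (e : FOAssign A)
        (s : SOAssign A), p.den 𝔄 e (fun _ => 1) s =
          (L.map fun T => T.val 𝔄 0 e fun _ => ∅).sum + 1 := by
    intro L
    induction L with
    | nil => exact fun _ => ⟨.nop, trivial, fun 𝔄 e s => rfl⟩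
    | cons T L ih =>
      intro hL
      obtain ⟨P, hP, hval⟩ := (hL T List.mem_cons_self).exists_problem
      obtain ⟨p, hp, h⟩ := ih fun T hT => hL T (List.mem_cons_of_mem _ hT)
      refine ⟨.seq P.main p, ⟨hP.bounded_main, hp⟩, fun 𝔄 e s => ?_⟩
      rw [Cmd.den, hP.den_main (h 𝔄 e), hval, List.map_cons, List.sum_cons]
      omega
  obtain ⟨p, hp, h⟩ := key _ (ok_terms hα hctx)
  refine ⟨p, hp, fun 𝔄 e v V => ?_⟩
  rw [h, sum_terms hα hctx]
  congr 1
  exact eval_congr _ (by simp [hs.1]) (by simp [hs.2])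

end CountLogic

theorem mainTheorem11 (R : CountLogic.Signature) (α : CountLogic.QSO R)
    (hα : CountLogic.QSO.IsSigma CountLogic.SO.IsExHorn α) (hs : α.IsSentence) :
    ∃ f ∈ CountLogic.TotP,
      ∀ (A : Type*) [Fintype A] [LinearOrder A] (𝔄 : CountLogic.Interp R A)
        (v : CountLogic.FOAssign A) (V : CountLogic.SOAssign A),
        α.eval 𝔄 v V = f (CountLogic.enc 𝔄) := by
  obtain ⟨p, hp, h⟩ := CountLogic.QSO.exists_cmd hα hs
  refine ⟨fun x => (CountLogic.Prog.runner p).total x - 1, ⟨CountLogic.Prog.runner p,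
    CountLogic.Prog.runner_polyTime p hp, fun x => ?_⟩, fun A _ _ 𝔄 v V => ?_⟩
  · have := CountLogic.Prog.runner_total_pos p hp x
    exact (Nat.sub_add_cancel this).symm
  -- An assignment exists only on a nonempty domain.
  · have : Nonempty A := ⟨v 0⟩
    have hpos : 0 < (CountLogic.elems A).length := by
      rw [CountLogic.length_elems]
      exact Fintype.card_pos
    -- The machine starts with all registers at `0`, which represents the assignment of the least
    -- element to every variable.
    have ht := CountLogic.Prog.runner_total p hp 𝔄 (e := fun _ => (CountLogic.elems A)[0])
      fun _ => CountLogic.rank_getElem 0 hpos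
    have h' := h 𝔄 (fun _ => (CountLogic.elems A)[0]) v V
    show _ = (CountLogic.Prog.runner p).total _ - 1
    rw [ht, h', Nat.add_sub_cancel]
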